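/- **Theorem 3 (Simple Connectedness of the Euclidean Plane).** Let $P\subset\mathbb R^2$ be a simple polygon (a simple closed polygonal curve with at least three vertices), and let $S$ be a closed axis-parallel square whose interior contains $P$. Then $S$ has triangulations of arbitrarily small mesh. Moreover, for every finite triangulation $T_0$ of $S$ (in particular for an arbitrarily fine one) and every point $p_0\in P$, there is a triangulation $T$ of $S$, a subdivision of $T_0$, with the following properties. 1. The discrete space formed by the vertices, edges and triangles (2-cells) of $T$ is simply connected in the discrete sense defined below. 2. There is a simple cycle $C$ in the edge graph of $T$ whose edges have union exactly $P$; all vertices of $P$ and the point $p_0$ are vertices of $C$. No triangle of $T$ has all three vertices on $C$, and $C$ has wide angles: (i) for every vertex $x$ of $C$, the two neighbours of $x$ on $C$ are at distance at least $3$ in the link of $x$ (so that on either side at least three triangles at $x$ lie between them); (ii) every path in $T$ that connects two different, nonadjacent vertices of $C$ without using edges of $C$ has at least three edges. 3. For every vertex $p$ of $C$, there is a contraction $C=C_0,C_1,\dots,C_m=\{p\}$ of $C$ to $p$ such that, for each $i<m$, the curve $C_{i+1}$ arises from $C_i$ by removing one triangle $\Delta_i$ from the region enclosed by $C_i$: the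 set of triangles of $T$ enclosed by $C_{i+1}$ is that of $C_i$ without $\Delta_i$, and the sum modulo $2$ of the edge sets of $C_i$ and $C_{i+1}$ is the set of the three edges of $\Delta_i$. Here $\Delta_i$ contains a vertex of $C_i$ that is farthest from $p$ among all the vertices of $C_i$, with respect to graph-distance in the graph formed by the vertices and edges of the triangles enclosed by $C_i$. *Definitions.* Let $D, D'$ be simple cycles of $T$ (or single vertices). They are *gradually varied* if the sum modulo $2$ of their edge sets is the sum modulo $2$ of the boundaries of some triangles of $T$, each with all its vertices on $D$ or $D'$. They *cross over* each other if $D=\dots a\,p\,b\dots s\,q\,t\dots$ and $D'=\dots a'\,p\,b\dots s\,q\,t'\dots$ share a stretch from $p$ to $q$ (possibly $p=q$) and no edge next to it, and $D'$ arrives at $p$ from one side of $D$ and leaves $q$ to the other side. They are *side-gradually varied* if they are gradually varied and do not cross over each other. A simple cycle $C$ *can be contracted* to a vertex $p$ of $C$ if there is a sequence $C=C_0,\dots,C_n=\{p\}$ (a *contraction*) in which $C_0,\dots,C_{n-1}$ are simple cycles, all $C_i$ contain $p$, a vertex that belongs to some $C_i$ but not to a later $C_j$ does not belong to any $C_k$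 with $k>j$, and $C_i$, $C_{i+1}$ are side-gradually varied for all $i<n$. A discrete space is *simply connected* if it is connected and each simple cycle can be contracted to each of its vertices. -/

import Mathlib

namespace DiscretePlane

/-- The Euclidean plane. -/
abbrev Plane := EuclideanSpace ℝ (Fin 2)

/-! ### Polygons and squares -/

/-- A polygon is simple if it has at least three vertices, its vertices are distinct, and two
different sides have no point in common except a common end point. -/
def IsSimplePolygon {n : ℕ} (P : Polygon Plane n) : Prop :=
  3 ≤ n ∧ Function.Injective P.vertices ∧
    ∀ i j : Fin n, i ≠ j →
      P.edgeSet ℝ i ∩ P.edgeSet ℝ j = {P i, P (finRotate n i)} ∩ {P j, P (finRotate n j)}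

/-- The closed axis-parallel square with centre `c` and side length `2 * r`. -/
def square (c : Plane) (r : ℝ) : Set Plane :=
  {z | |z 0 - c 0| ≤ r ∧ |z 1 - c 1| ≤ r}

/-! ### Triangulations -/

/-- `K` is a (finite) triangulation of the set `S`. -/
def IsTriangulation (K : Geometry.SimplicialComplex ℝ Plane) (S : Set Plane) : Prop :=
  K.faces.Finite ∧ K.space = S

/-- Every face of `K` has diameter at most `ε`. -/
def HasMeshLE (K : Geometry.SimplicialComplex ℝ Plane) (ε : ℝ) : Prop :=
  ∀ s ∈ K.faces, ∀ x ∈ convexHull ℝ (s : Set Plane), ∀ y ∈ convexHull ℝ (s : Set Plane),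
    dist x y ≤ ε

/-- `K` is a subdivision of `L`. -/
def IsSubdivision (K L : Geometry.SimplicialComplex ℝ Plane) : Prop :=
  K.space = L.space ∧
    ∀ s ∈ K.faces, ∃ t ∈ L.faces, convexHull ℝ (s : Set Plane) ⊆ convexHull ℝ (t : Set Plane)

/-! ### The discrete space of a triangulation: vertices, edges, 2-cells -/

/-- The graph formed by the vertices and edges of `K` (points of the plane that are not vertices of
`K` are isolated). -/
def graph (K : Geometry.SimplicialComplex ℝ Plane) : SimpleGraph Plane where
  Adj x y := x ≠ y ∧ ∃ s ∈ K.faces, x ∈ s ∧ y ∈ s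
  symm := ⟨fun _ _ h => ⟨h.1.symm, by
    obtain ⟨s, hs, hx, hy⟩ := h.2
    exact ⟨s, hs, hy, hx⟩⟩⟩
  loopless := ⟨fun _ h => h.1 rfl⟩

/-- The 2-cells of `K`: its triangles. -/
def cells (K : Geometry.SimplicialComplex ℝ Plane) : Set (Finset Plane) :=
  {t | t ∈ K.faces ∧ t.card = 3}

/-- The three edges of a triangle. -/
def cellEdges (t : Finset Plane) : Set (Sym2 Plane) :=
  {e | ¬ e.IsDiag ∧ ∀ x ∈ e, x ∈ t}

variable {K : Geometry.SimplicialComplex ℝ Plane}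

/-- A simple cycle of `K`, as a subgraph. -/
def IsSimpleCycle (C : (graph K).Subgraph) : Prop :=
  ∃ (u : Plane) (w : (graph K).Walk u u), w.IsCycle ∧ w.toSubgraph = C

/-- The set of points of the plane lying on the edges of `C`. -/
def carrier (C : (graph K).Subgraph) : Set Plane :=
  {z | ∃ x y : Plane, C.Adj x y ∧ z ∈ segment ℝ x y}

/-! ### Discrete deformation -/

/-- The sum modulo 2 of (the edge sets of) `C` and `C'`. -/
def xorSum (C C' : (graph K).Subgraph) : Set (Sym2 Plane) :=
  (C.edgeSet \ C'.edgeSet) ∪ (C'.edgeSet \ C.edgeSet)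

/-- `C` and `C'` are gradually varied: their sum modulo 2 is the sum modulo 2 of the boundaries of
2-cells all of whose vertices lie on `C` or `C'`. -/
def GraduallyVaried (C C' : (graph K).Subgraph) : Prop :=
  ∃ A : Finset (Finset Plane),
    (∀ t ∈ A, t ∈ cells K ∧ (t : Set Plane) ⊆ C.verts ∪ C'.verts) ∧
    ∀ e : Sym2 Plane, e ∈ xorSum C C' ↔ Odd {t ∈ (A : Set (Finset Plane)) | e ∈ cellEdges t}.ncard

/-- The cross product (determinant) of two plane vectors. -/
def cross (u v : Plane) : ℝ := u 0 * v 1 - u 1 * v 0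

/-- The point `x` lies strictly on the left of the path `a → p → b` at `p`: turning
counterclockwise around `p` one meets, from the ray `p b` on, the ray `p x` strictly before the ray
`p a`. The first case is that of an angle from `p b` to `p a` less than `π`. -/
def LeftOf (a p b x : Plane) : Prop :=
  (0 < cross (b - p) (a - p) ∧ 0 < cross (b - p) (x - p) ∧ 0 < cross (x - p) (a - p)) ∨
  (cross (b - p) (a - p) ≤ 0 ∧ (0 < cross (b - p) (x - p) ∨ 0 < cross (x - p) (a - p)))

/-- `C` and `C'` cross over each other: `C = … a p b … s q t …` and `C' = … a' p b … s q t' …`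
share exactly the stretch `p b … s q` (possibly `p = q`) there, and `C'` arrives at `p` from one
side of `C` and leaves from `q` to the other side.
Here `a = x 0`, `p = x 1`, `b = x 2`, `s = x k`, `q = x (k + 1)`, `t = x (k + 2)`. -/
def CrossOver (C C' : (graph K).Subgraph) : Prop :=
  ∃ (k : ℕ) (x : ℕ → Plane) (a' t' : Plane),
    (∀ i ≤ k + 1, C.Adj (x i) (x (i + 1))) ∧
    (∀ i ≤ k, x i ≠ x (i + 2)) ∧
    (∀ i, 1 ≤ i → i ≤ k → C'.Adj (x i) (x (i + 1))) ∧
    ¬ C'.Adj (x 0) (x 1) ∧ ¬ C'.Adj (x (k + 1)) (x (k + 2)) ∧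
    C'.Adj a' (x 1) ∧ ¬ C.Adj a' (x 1) ∧
    C'.Adj (x (k + 1)) t' ∧ ¬ C.Adj (x (k + 1)) t' ∧
    ¬ (LeftOf (x 0) (x 1) (x 2) a' ↔ LeftOf (x k) (x (k + 1)) (x (k + 2)) t')

/-- Side-gradually varied: gradually varied and not crossing over each other. -/
def SideGraduallyVaried (C C' : (graph K).Subgraph) : Prop :=
  GraduallyVaried C C' ∧ ¬ CrossOver C C'

/-- `Q 0, …, Q n` is a contraction of the simple cycle `C` to its vertex `p`: simple cycles
`C = Q 0, …, Q (n - 1)` followed by the point `p = Q n`, all containing `p`, such that a vertex that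
has been left is never met again and consecutive ones are side-gradually varied. -/
structure IsContraction (C : (graph K).Subgraph) (p : Plane) (n : ℕ)
    (Q : ℕ → (graph K).Subgraph) : Prop where
  start : Q 0 = C
  finish : Q n = (graph K).singletonSubgraph p
  isSimpleCycle : ∀ i < n, IsSimpleCycle (Q i)
  mem : ∀ i ≤ n, p ∈ (Q i).verts
  left_forever : ∀ (q : Plane) (i j k : ℕ), i ≤ j → j ≤ k → k ≤ n →
    q ∈ (Q i).verts → q ∉ (Q j).verts → q ∉ (Q k).verts
  sideGraduallyVaried : ∀ i < n, SideGraduallyVaried (Q i) (Q (i + 1))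

/-- The discrete space of the triangulation `K` is simply connected: it is connected, and every
simple cycle can be contracted to every vertex on it. -/
def IsDiscretelySimplyConnected (K : Geometry.SimplicialComplex ℝ Plane) : Prop :=
  (∃ x, x ∈ K.vertices) ∧
  (∀ x ∈ K.vertices, ∀ y ∈ K.vertices, (graph K).Reachable x y) ∧
  ∀ C : (graph K).Subgraph, IsSimpleCycle C → ∀ p ∈ C.verts,
    ∃ (n : ℕ) (Q : ℕ → (graph K).Subgraph), IsContraction C p n Q

/-! ### Wide angles -/

/-- The link of the vertex `x`: its edges correspond to the triangles containing `x`. -/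
def link (K : Geometry.SimplicialComplex ℝ Plane) (x : Plane) : SimpleGraph Plane where
  Adj y z := x ≠ y ∧ x ≠ z ∧ y ≠ z ∧ ∃ t ∈ cells K, x ∈ t ∧ y ∈ t ∧ z ∈ t
  symm := ⟨fun _ _ h => ⟨h.2.1, h.1, h.2.2.1.symm, by
    obtain ⟨t, ht, hx, hy, hz⟩ := h.2.2.2
    exact ⟨t, ht, hx, hz, hy⟩⟩⟩
  loopless := ⟨fun _ h => h.2.2.1 rfl⟩

/-- `C` is a discrete curve: it does not contain all the vertices of a 2-cell. -/
def IsDiscreteCurve (C : (graph K).Subgraph) : Prop :=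
  ∀ t ∈ cells K, ¬ ((t : Set Plane) ⊆ C.verts)

/-- `C` has wide angles: at each vertex `x` of `C`, the two neighbours of `x` on `C` are at distance
at least 3 in the link of `x`, and every path that connects two different nonadjacent vertices of
`C` without using edges of `C` has at least three edges. -/
def HasWideAngles (C : (graph K).Subgraph) : Prop :=
  (∀ x y z : Plane, C.Adj x y → C.Adj x z → y ≠ z → 3 ≤ (link K x).edist y z) ∧
  ∀ p ∈ C.verts, ∀ q ∈ C.verts, p ≠ q → ¬ C.Adj p q →
    ∀ w : (graph K).Walk p q, (∀ e ∈ w.edges, e ∉ C.edgeSet) → 3 ≤ w.length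

/-! ### Removing farthest triangles -/

/-- The points enclosed by `C`: those in bounded components of the complement of `C`. -/
def inside (C : (graph K).Subgraph) : Set Plane :=
  {z | z ∉ carrier C ∧ Bornology.IsBounded (connectedComponentIn (carrier C)ᶜ z)}

/-- The triangles of `K` that are enclosed by `C`. -/
def insideCells (C : (graph K).Subgraph) : Set (Finset Plane) :=
  {t | t ∈ cells K ∧ interior (convexHull ℝ (t : Set Plane)) ⊆ inside C}

/-- The graph formed by the vertices and edges of the triangles enclosed by `C`. -/
def regionGraph (C : (graph K).Subgraph) : SimpleGraph Plane where
  Adj x y := x ≠ y ∧ ∃ t ∈ insideCells C, x ∈ t ∧ y ∈ t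
  symm := ⟨fun _ _ h => ⟨h.1.symm, by
    obtain ⟨t, ht, hx, hy⟩ := h.2
    exact ⟨t, ht, hy, hx⟩⟩⟩
  loopless := ⟨fun _ h => h.1 rfl⟩

/-- `C'` arises from `C` by removing from the region enclosed by `C` one triangle, which contains a
vertex of `C` that has the largest graph-distance to `p` among the vertices of `C`. -/
def IsFarthestRemoval (p : Plane) (C C' : (graph K).Subgraph) : Prop :=
  ∃ t ∈ insideCells C, insideCells C' = insideCells C \ {t} ∧ xorSum C C' = cellEdges t ∧
    ∃ x ∈ t, x ∈ C.verts ∧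
      ∀ y ∈ C.verts, (regionGraph C).edist p y ≤ (regionGraph C).edist p x

end DiscretePlane

open DiscretePlane

/-! All triangulations constructed here come from the square cut by a diagonal, by starring faces at
inner points (`star`). Starring keeps the properties collected in `Good`. The decisive one is
`HasPotential`: every closed walk is, modulo 2, a sum of boundaries of triangles. Starring each edge
crossed by a line at its crossing point yields a triangulation without faces crossing that line
(`Good.exists_oneSided`). Cutting along a grid makes the mesh small. Cutting along the zero lines of
affine functions that cut out the faces of the given triangulation `T₀` yields a subdivision of
`T₀`; thus nothing has to be shown for `T₀` itself. Cutting also along the sides of the polygon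
turns it into a simple cycle `C` of edges. Further starrings, which do not touch the edges of `C`,
remove all chords of `C` and all vertices off `C` with two nonadjacent neighbours on `C`
(`Good.exists_full_noBridge`). As `C` has at least four vertices, it is then a discrete curve with
wide angles.

For the contraction, let `C` be any simple cycle. By `HasPotential` it is the boundary modulo 2 of a
set `A` of triangles. This set is unique, because a nonempty finite set of triangles has a nonempty
boundary (`exists_edge_mem_unique`, `bd_injective`). The triangles enclosed by `C` are exactly those
of `A` (`Good.insideCells_eq`). On the one hand, off `C` the union of `A` is open and closed, and it
is bounded. On the other hand, the triangles that can be reached from a triangle outside `A` without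
crossing `C` cannot have their whole boundary on `C`, since otherwise they would form the empty set
or `A`; so the border of the square can be reached.

To shrink `C` towards `p`, take a vertex `x` of `C` farthest from `p` in the enclosed region, and
the triangle `x y w` of `A` at an edge `x y` of `C`. If `w` is off `C`, the triangle is removed by a
detour through `w`. If two sides of a triangle lie on `C`, it is removed by a shortcut along the
third; if all three do, `C` is the triangle and shrinks to `p`. Otherwise a side is a chord that
cuts `A` into two pieces, and the search goes on in a piece that contains `p` at most as an end of
the chord (`exists_step_of_isPiece`). The pieces get smaller, and the removed triangle still
contains a farthest vertex: a path from `p` to a point behind a chord at `x` must pass an end of the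
chord, so that point is at least as far as `x` (`IsPiece.edist_le`).

Consecutive cycles differ by the boundary of one triangle and are therefore gradually varied. They
do not cross over, since at both ends of a common stretch the new edges leave along the removed
triangle, whose orientation decides the side at both ends. A vertex that has been left does not
return because the enclosed sets decrease (`left_forever_of_insideCells`). -/

namespace DiscretePlane

open Geometry

/-! ### Barycentric coordinates and open simplices -/

/-- `w` is a system of barycentric coordinates of `x` with respect to the points of `s`. -/
def IsCoord (s : Finset Plane) (x : Plane) (w : Plane → ℝ) : Prop :=
  (∀ y, 0 ≤ w y) ∧ (∀ y ∉ s, w y = 0) ∧ ∑ y ∈ s, w y = 1 ∧ ∑ y ∈ s, w y • y = x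

lemma mem_convexHull_iff_exists_isCoord {s : Finset Plane} {x : Plane} :
    x ∈ convexHull ℝ (s : Set Plane) ↔ ∃ w, IsCoord s x w := by
  rw [Finset.mem_convexHull']
  constructor
  · rintro ⟨w, h0, h1, h2⟩
    refine ⟨fun y => if y ∈ s then w y else 0, fun y => ?_, fun y hy => if_neg hy, ?_, ?_⟩
    · by_cases hy : y ∈ s
      · simpa [hy] using h0 y hy
      · simp [hy]
    · rw [← h1]; exact Finset.sum_congr rfl fun y hy => if_pos hy
    · rw [← h2]; exact Finset.sum_congr rfl fun y hy => by simp only [if_pos hy]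
  · rintro ⟨w, h0, -, h1, h2⟩
    exact ⟨w, fun y _ => h0 y, h1, h2⟩

lemma IsCoord.mem {s : Finset Plane} {x : Plane} {w : Plane → ℝ} (h : IsCoord s x w) :
    x ∈ convexHull ℝ (s : Set Plane) :=
  mem_convexHull_iff_exists_isCoord.2 ⟨w, h⟩

lemma IsCoord.of_support {s t : Finset Plane} {x : Plane} {w : Plane → ℝ} (h : IsCoord s x w)
    (ht : ∀ y ∉ t, w y = 0) : IsCoord t x w := by
  classical
  obtain ⟨h0, hs, h1, h2⟩ := h
  have key : ∀ {M : Type} [AddCommMonoid M] (f : Plane → M), (∀ y, w y = 0 → f y = 0) →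
      ∑ y ∈ t, f y = ∑ y ∈ s, f y := by
    intro M _ f hf
    have e1 : ∑ y ∈ t ∩ s, f y = ∑ y ∈ t, f y := by
      refine Finset.sum_subset Finset.inter_subset_left fun y hy hys => hf y (hs y fun h => ?_)
      exact hys (Finset.mem_inter.2 ⟨hy, h⟩)
    have e2 : ∑ y ∈ t ∩ s, f y = ∑ y ∈ s, f y := by
      refine Finset.sum_subset Finset.inter_subset_right fun y hy hys => hf y (ht y fun h => ?_)
      exact hys (Finset.mem_inter.2 ⟨h, hy⟩)
    rw [← e1, e2]
  refine ⟨h0, ht, ?_, ?_⟩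
  · rw [key w fun y hy => hy, h1]
  · rw [key (fun y => w y • y) fun y hy => by rw [hy, zero_smul], h2]

lemma IsCoord.mono {s t : Finset Plane} {x : Plane} {w : Plane → ℝ} (h : IsCoord s x w)
    (hst : s ⊆ t) : IsCoord t x w :=
  h.of_support fun y hy => h.2.1 y fun hys => hy (hst hys)

lemma eq_zero_of_sum_eq_zero {s : Finset Plane} (hs : AffineIndependent ℝ ((↑) : s → Plane))
    {w : Plane → ℝ} (h0 : ∑ y ∈ s, w y = 0) (h1 : ∑ y ∈ s, w y • y = 0) : ∀ y ∈ s, w y = 0 := by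
  rw [affineIndependent_iff] at hs
  intro y hy
  refine hs Finset.univ (fun y => w y) ?_ ?_ ⟨y, hy⟩ (Finset.mem_univ _)
  · rw [← h0]; exact Finset.sum_coe_sort s w
  · rw [← h1]; exact Finset.sum_coe_sort s (fun y => w y • y)

lemma IsCoord.unique_of_indep {s : Finset Plane} (hs : AffineIndependent ℝ ((↑) : s → Plane))
    {x : Plane} {w w' : Plane → ℝ} (h : IsCoord s x w) (h' : IsCoord s x w') : w = w' := by
  funext y
  by_cases hy : y ∈ s
  · refine sub_eq_zero.1 (eq_zero_of_sum_eq_zero hs (w := fun y => w y - w' y) ?_ ?_ y hy)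
    · rw [Finset.sum_sub_distrib, h.2.2.1, h'.2.2.1, sub_self]
    · simp_rw [sub_smul]
      rw [Finset.sum_sub_distrib, h.2.2.2, h'.2.2.2, sub_self]
  · rw [h.2.1 y hy, h'.2.1 y hy]

/-- The point lies in the hull of the common vertices of the two faces, and its coordinates there,
extended by zero, serve for both faces. So coordinates depend on the point only and not on the face,
which is the form in which the intersection axiom of a complex is used. -/
lemma IsCoord.unique {K : SimplicialComplex ℝ Plane} {s t : Finset Plane} (hs : s ∈ K.faces)
    (ht : t ∈ K.faces) {x : Plane} {w w' : Plane → ℝ} (h : IsCoord s x w) (h' : IsCoord t x w') :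
    w = w' := by
  classical
  have hx := K.inter_subset_convexHull hs ht ⟨h.mem, h'.mem⟩
  rw [← Finset.coe_inter] at hx
  obtain ⟨v, hv⟩ := mem_convexHull_iff_exists_isCoord.1 hx
  rw [h.unique_of_indep (K.indep hs) (hv.mono Finset.inter_subset_left),
    h'.unique_of_indep (K.indep ht) (hv.mono Finset.inter_subset_right)]

/-- The points of the relative interior of the simplex spanned by `s`. -/
def openHull (s : Finset Plane) : Set Plane :=
  {x | ∃ w, IsCoord s x w ∧ ∀ y ∈ s, 0 < w y}

lemma openHull_subset (s : Finset Plane) : openHull s ⊆ convexHull ℝ (s : Set Plane) :=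
  fun _ ⟨_, h, _⟩ => h.mem

/-- The subset is the set of points with positive weight. -/
lemma exists_mem_openHull {s : Finset Plane} {x : Plane} (hx : x ∈ convexHull ℝ (s : Set Plane)) :
    ∃ t ⊆ s, t.Nonempty ∧ x ∈ openHull t := by
  classical
  obtain ⟨w, hw⟩ := mem_convexHull_iff_exists_isCoord.1 hx
  have hc : IsCoord (s.filter fun y => 0 < w y) x w := hw.of_support fun y hy => by
    by_cases hys : y ∈ s
    · exact le_antisymm (not_lt.1 fun h => hy (Finset.mem_filter.2 ⟨hys, h⟩)) (hw.1 y)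
    · exact hw.2.1 y hys
  refine ⟨s.filter fun y => 0 < w y, Finset.filter_subset _ _, ?_, w, hc, fun y hy =>
    (Finset.mem_filter.1 hy).2⟩
  by_contra hne
  rw [Finset.not_nonempty_iff_eq_empty] at hne
  have := hc.2.2.1
  rw [hne] at this
  simp at this

/-- The common coordinates of `x` are positive on `s` and vanish off `t`. This is the tool for
locating a point: every face through `x` contains the face whose open simplex contains `x`. -/
lemma subset_of_mem_openHull {K : SimplicialComplex ℝ Plane} {s t : Finset Plane}
    (hs : s ∈ K.faces) (ht : t ∈ K.faces) {x : Plane} (hx : x ∈ openHull s)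
    (hxt : x ∈ convexHull ℝ (t : Set Plane)) : s ⊆ t := by
  obtain ⟨w, hw, hpos⟩ := hx
  obtain ⟨v, hv⟩ := mem_convexHull_iff_exists_isCoord.1 hxt
  have e := hw.unique hs ht hv
  intro y hy
  by_contra hyt
  have := hpos y hy
  rw [e, hv.2.1 y hyt] at this
  exact lt_irrefl _ this

lemma exists_face_mem_openHull {K : SimplicialComplex ℝ Plane} {x : Plane} (hx : x ∈ K.space) :
    ∃ s ∈ K.faces, x ∈ openHull s := by
  obtain ⟨s, hs, hxs⟩ := SimplicialComplex.mem_space_iff.1 hx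
  obtain ⟨t, hts, hne, hxt⟩ := exists_mem_openHull hxs
  exact ⟨t, K.down_closed hs hts hne, hxt⟩

lemma mem_openHull_pair {a b x : Plane} (hab : a ≠ b) {α β : ℝ} (hα : 0 < α) (hβ : 0 < β)
    (h1 : α + β = 1) (hx : α • a + β • b = x) : x ∈ openHull {a, b} := by
  classical
  refine ⟨fun y => if y = a then α else if y = b then β else 0, ⟨fun y => ?_, fun y hy => ?_, ?_,
    ?_⟩, fun y hy => ?_⟩
  · dsimp only; split_ifs <;> positivity
  · simp only [Finset.mem_insert, Finset.mem_singleton, not_or] at hy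
    simp [hy.1, hy.2]
  · rw [Finset.sum_pair hab]; simp [hab.symm, h1]
  · rw [Finset.sum_pair hab]; simp [hab.symm, hx]
  · dsimp only; simp only [Finset.mem_insert, Finset.mem_singleton] at hy
    rcases hy with rfl | rfl
    · simpa using hα
    · simpa [hab.symm] using hβ

/-! ### Edges and triangles -/

lemma card_le_three {K : SimplicialComplex ℝ Plane} {s : Finset Plane} (hs : s ∈ K.faces) :
    s.card ≤ 3 := by
  have := (K.indep hs).card_le_finrank_succ
  have h2 : Module.finrank ℝ (vectorSpan ℝ (Set.range ((↑) : s → Plane))) ≤ 2 := by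
    refine (Submodule.finrank_le _).trans ?_
    simp
  rw [Fintype.card_coe] at this
  omega

lemma graph_adj_iff {K : SimplicialComplex ℝ Plane} {x y : Plane} :
    (graph K).Adj x y ↔ x ≠ y ∧ {x, y} ∈ K.faces := by
  classical
  constructor
  · rintro ⟨hne, s, hs, hx, hy⟩
    exact ⟨hne, K.down_closed hs (by simp [Finset.insert_subset_iff, hx, hy]) (by simp)⟩
  · rintro ⟨hne, h⟩
    exact ⟨hne, _, h, by simp, by simp⟩

lemma mem_cellEdges_iff {t : Finset Plane} {x y : Plane} :
    s(x, y) ∈ cellEdges t ↔ x ≠ y ∧ x ∈ t ∧ y ∈ t := by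
  simp [cellEdges]

lemma graph_adj_of_mem_cells {K : SimplicialComplex ℝ Plane} {t : Finset Plane} (ht : t ∈ cells K)
    {x y : Plane} (h : s(x, y) ∈ cellEdges t) : (graph K).Adj x y :=
  ⟨(mem_cellEdges_iff.1 h).1, t, ht.1, (mem_cellEdges_iff.1 h).2⟩

lemma exists_third {t : Finset Plane} (ht : t.card = 3) {x y : Plane} (hxy : x ≠ y) (hx : x ∈ t)
    (hy : y ∈ t) : ∃ z, z ≠ x ∧ z ≠ y ∧ t = {x, y, z} := by
  classical
  have h1 : ((t.erase x).erase y).card = 1 := by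
    rw [Finset.card_erase_of_mem (Finset.mem_erase.2 ⟨hxy.symm, hy⟩), Finset.card_erase_of_mem hx,
      ht]
  obtain ⟨z, hz⟩ := Finset.card_eq_one.1 h1
  have hz' : z ∈ (t.erase x).erase y := by rw [hz]; simp
  simp only [Finset.mem_erase] at hz'
  refine ⟨z, hz'.2.1, hz'.1, ?_⟩
  rw [← Finset.insert_erase hx, ← Finset.insert_erase (Finset.mem_erase.2 ⟨hxy.symm, hy⟩), hz]

lemma card_triple {x y z : Plane} (hxy : x ≠ y) (hzx : z ≠ x) (hzy : z ≠ y) :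
    ({x, y, z} : Finset Plane).card = 3 :=
  Finset.card_eq_three.2 ⟨x, y, z, hxy, hzx.symm, hzy.symm, rfl⟩

lemma card_of_cell {K : SimplicialComplex ℝ Plane} {x y z : Plane} (h : {x, y, z} ∈ cells K) :
    x ≠ y ∧ z ≠ x ∧ z ≠ y := by
  obtain ⟨-, h⟩ := h
  refine ⟨?_, ?_, ?_⟩ <;> rintro rfl
  · have := Finset.card_le_two (a := z) (b := x)
    simp at h
    have := Finset.card_le_two (a := x) (b := z)
    omega
  · have := Finset.card_le_two (a := z) (b := y)
    have e : ({z, y, z} : Finset Plane) = {z, y} := by ext; simp; tauto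
    rw [e] at h; omega
  · have := Finset.card_le_two (a := x) (b := z)
    simp at h; omega

lemma coord_ext {x y : Plane} (h0 : x 0 = y 0) (h1 : x 1 = y 1) : x = y := by
  ext i; fin_cases i
  · exact h0
  · exact h1

lemma cross_ne_zero {K : SimplicialComplex ℝ Plane} {p a b : Plane} (h : {p, a, b} ∈ cells K) :
    cross (a - p) (b - p) ≠ 0 := by
  classical
  obtain ⟨hpa, hbp, hba⟩ := card_of_cell h
  intro hc
  have hi := K.indep h.1
  simp only [cross, PiLp.sub_apply] at hc
  have hs : ∀ {M : Type} [AddCommMonoid M] (f : Plane → M),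
      ∑ y ∈ ({p, a, b} : Finset Plane), f y = f p + (f a + f b) := by
    intro M _ f
    rw [Finset.sum_insert (by simp [hpa, hbp.symm]), Finset.sum_pair hba.symm]
  have key : ∀ α β : ℝ, α * (a 0 - p 0) + β * (b 0 - p 0) = 0 →
      α * (a 1 - p 1) + β * (b 1 - p 1) = 0 → α = 0 ∧ β = 0 := by
    intro α β h0 h1
    have := eq_zero_of_sum_eq_zero hi
      (w := fun y => if y = p then -(α + β) else if y = a then α else β)
      (by rw [hs]; simp [hpa.symm, hbp, hba])
      (by
        rw [hs]; simp only [if_true, hpa.symm, hbp, hba, if_false]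
        apply coord_ext <;> simp <;> linarith)
    have h3 := this a (by simp)
    have h4 := this b (by simp)
    simp [hpa.symm, hbp, hba] at h3 h4
    exact ⟨h3, h4⟩
  -- If the cross product vanishes, the coordinates with index `0` of `b - p` and `a - p`, the
  -- second with a sign, are the coefficients of a linear relation between `a - p` and `b - p`;
  -- likewise those with index `1`. By independence all of them vanish.
  have k1 := key (b 0 - p 0) (-(a 0 - p 0)) (by ring) (by linarith)
  have k2 := key (b 1 - p 1) (-(a 1 - p 1)) (by linarith) (by ring)
  exact hbp (coord_ext (by linarith) (by linarith))

/-- No edge at `p` other than the sides points into a triangle at `p`. -/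
lemma not_mem_cone {K : SimplicialComplex ℝ Plane} {p a b u : Plane} (ht : {p, a, b} ∈ cells K)
    (hu : {p, u} ∈ K.faces) (hup : u ≠ p) (hua : u ≠ a) (hub : u ≠ b) {α β : ℝ} (hα : 0 ≤ α)
    (hβ : 0 ≤ β) : u - p ≠ α • (a - p) + β • (b - p) := by
  classical
  obtain ⟨hpa, hbp, hba⟩ := card_of_cell ht
  intro h
  -- The point `p + ε • (u - p)` lies on the edge `p u` because `ε ≤ 1`, and in the triangle because
  -- `ε * (α + β) ≤ 1`. Its coordinate at `u` is `ε` in the first face and `0` in the second.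
  set ε : ℝ := 1 / (1 + α + β) with hε
  have hε0 : 0 < ε := by positivity
  have hε1 : ε ≤ 1 := by rw [hε, div_le_one (by positivity)]; linarith
  have hεs : ε * (1 + α + β) = 1 := by rw [hε]; field_simp
  have c1 : IsCoord {p, u} (p + ε • (u - p)) (fun y => if y = p then 1 - ε else if y = u then ε
      else 0) := by
    refine ⟨fun y => ?_, fun y hy => ?_, ?_, ?_⟩
    · dsimp only; split_ifs <;> linarith
    · simp only [Finset.mem_insert, Finset.mem_singleton, not_or] at hy
      simp [hy.1, hy.2]
    · rw [Finset.sum_pair hup.symm]; simp [hup]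
    · rw [Finset.sum_pair hup.symm]; simp [hup]; module
  have hs : ∀ {M : Type} [AddCommMonoid M] (f : Plane → M),
      ∑ y ∈ ({p, a, b} : Finset Plane), f y = f p + (f a + f b) := by
    intro M _ f
    rw [Finset.sum_insert (by simp [hpa, hbp.symm]), Finset.sum_pair hba.symm]
  have c2 : IsCoord {p, a, b} (p + ε • (u - p)) (fun y => if y = p then 1 - ε * α - ε * β else
      if y = a then ε * α else if y = b then ε * β else 0) := by
    refine ⟨fun y => ?_, fun y hy => ?_, ?_, ?_⟩
    · dsimp only; split_ifs
      · nlinarith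
      · positivity
      · positivity
      · exact le_rfl
    · simp only [Finset.mem_insert, Finset.mem_singleton, not_or] at hy
      simp [hy.1, hy.2]
    · rw [hs]; simp [hpa.symm, hbp, hba]
    · rw [hs, h]; simp [hpa.symm, hbp, hba]; module
  have e := congrFun (c1.unique hu ht.1 c2) u
  simp [hup, hua, hub] at e
  linarith

/-- The vectors `α • A + β • B` with `α, β ≥ 0` are described by signs of cross products. -/
lemma exists_cone {A B U : Plane} (h : 0 < cross A B) (h1 : 0 ≤ cross A U) (h2 : 0 ≤ cross U B) :
    ∃ α β : ℝ, 0 ≤ α ∧ 0 ≤ β ∧ U = α • A + β • B := by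
  refine ⟨cross U B / cross A B, cross A U / cross A B, by positivity, by positivity, ?_⟩
  have hne := h.ne'
  apply coord_ext <;> simp only [PiLp.add_apply, PiLp.smul_apply, smul_eq_mul] <;> field_simp <;>
    simp only [cross] <;> ring

lemma cross_swap (u v : Plane) : cross u v = - cross v u := by
  simp only [cross]; ring

lemma not_cone_cross {K : SimplicialComplex ℝ Plane} {p a b u : Plane} (ht : {p, a, b} ∈ cells K)
    (hu : {p, u} ∈ K.faces) (hup : u ≠ p) (hua : u ≠ a) (hub : u ≠ b)
    (h : 0 < cross (a - p) (b - p)) (h1 : 0 ≤ cross (a - p) (u - p))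
    (h2 : 0 ≤ cross (u - p) (b - p)) : False := by
  obtain ⟨α, β, hα, hβ, e⟩ := exists_cone h h1 h2
  exact not_mem_cone ht hu hup hua hub hα hβ e

lemma cell_perm {K : SimplicialComplex ℝ Plane} {a b c : Plane} (h : {a, b, c} ∈ cells K) :
    {a, c, b} ∈ cells K := by
  rwa [show ({a, c, b} : Finset Plane) = {a, b, c} by ext; simp; tauto]

lemma cell_rot {K : SimplicialComplex ℝ Plane} {a b c : Plane} (h : {a, b, c} ∈ cells K) :
    {b, c, a} ∈ cells K := by
  rwa [show ({b, c, a} : Finset Plane) = {a, b, c} by ext; simp; tauto]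

lemma face_of_cell {K : SimplicialComplex ℝ Plane} {a b c : Plane} (h : {a, b, c} ∈ cells K) :
    {a, b} ∈ K.faces :=
  K.down_closed h.1 (by intro; simp; tauto) (by simp)

lemma pair_face_swap {K : SimplicialComplex ℝ Plane} {a b : Plane} (h : {a, b} ∈ K.faces) :
    {b, a} ∈ K.faces := by
  rwa [Finset.pair_comm]

/-- Two triangles with a common side lie on different sides of it. -/
lemma cross_mul_neg {K : SimplicialComplex ℝ Plane} {a b w w' : Plane} (h : {a, b, w} ∈ cells K)
    (h' : {a, b, w'} ∈ cells K) (hw : w ≠ w') :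
    cross (b - a) (w - a) * cross (b - a) (w' - a) < 0 := by
  by_contra hc
  rw [not_lt] at hc
  have n1 := cross_ne_zero h
  have n2 := cross_ne_zero h'
  obtain ⟨hab, hwa, hwb⟩ := card_of_cell h
  obtain ⟨-, hwa', hwb'⟩ := card_of_cell h'
  have f1 : {a, w} ∈ K.faces := face_of_cell (cell_perm h)
  have f2 : {a, w'} ∈ K.faces := face_of_cell (cell_perm h')
  have hpos : 0 < cross (b - a) (w - a) * cross (b - a) (w' - a) :=
    lt_of_le_of_ne hc (mul_ne_zero n1 n2).symm
  -- If both third vertices are on the same side, the one of the edges `a w`, `a w'` that makes the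
  -- smaller angle with `a b` points into the other triangle, contrary to `not_cone_cross`.
  rcases mul_pos_iff.1 hpos with ⟨p1, p2⟩ | ⟨p1, p2⟩
  · rcases le_total 0 (cross (w' - a) (w - a)) with q | q
    · exact not_cone_cross h f2 hwa' hwb' hw.symm p1 p2.le q
    · rw [cross_swap] at q
      exact not_cone_cross h' f1 hwa hwb hw p2 p1.le (by linarith)
  · rw [cross_swap] at p1 p2
    rcases le_total 0 (cross (w' - a) (w - a)) with q | q
    · exact not_cone_cross (cell_perm h') f1 hwa hw hwb (by linarith) q (by linarith)
    · rw [cross_swap] at q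
      exact not_cone_cross (cell_perm h) f2 hwa' hw.symm hwb' (by linarith) (by linarith)
        (by linarith)

/-- An edge is a side of at most two triangles. -/
lemma cell_unique {K : SimplicialComplex ℝ Plane} {a b : Plane} {t₁ t₂ t₃ : Finset Plane}
    (h₁ : t₁ ∈ cells K) (h₂ : t₂ ∈ cells K) (h₃ : t₃ ∈ cells K) (e₁ : s(a, b) ∈ cellEdges t₁)
    (e₂ : s(a, b) ∈ cellEdges t₂) (e₃ : s(a, b) ∈ cellEdges t₃) (n₂ : t₂ ≠ t₁) (n₃ : t₃ ≠ t₁) :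
    t₂ = t₃ := by
  rw [mem_cellEdges_iff] at e₁ e₂ e₃
  obtain ⟨w₁, -, -, rfl⟩ := exists_third h₁.2 e₁.1 e₁.2.1 e₁.2.2
  obtain ⟨w₂, -, -, rfl⟩ := exists_third h₂.2 e₁.1 e₂.2.1 e₂.2.2
  obtain ⟨w₃, -, -, rfl⟩ := exists_third h₃.2 e₁.1 e₃.2.1 e₃.2.2
  by_contra hne
  -- Of three points off the line `a b`, two lie on the same side.
  have k1 := cross_mul_neg h₁ h₂ (fun h => n₂ (by rw [h]))
  have k2 := cross_mul_neg h₁ h₃ (fun h => n₃ (by rw [h]))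
  have k3 := cross_mul_neg h₂ h₃ (fun h => hne (by rw [h]))
  have := mul_pos_of_neg_of_neg k1 k2
  nlinarith [sq_nonneg (cross (b - a) (w₁ - a))]

/-! ### Sides of a path -/

/-- The edge `p b` does not point into the triangle `p a x`, so the side on which `x` lies is
decided by the orientation of this triangle alone, whatever the angle at `p` is. Together with the
next lemma this compares the sides at the two ends of a common stretch of two curves. -/
lemma leftOf_iff_of_cell_left {K : SimplicialComplex ℝ Plane} {a p b x : Plane}
    (ht : {p, a, x} ∈ cells K) (hb : {p, b} ∈ K.faces) (hbp : b ≠ p) (hba : b ≠ a) (hbx : b ≠ x) :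
    LeftOf a p b x ↔ 0 < cross (x - p) (a - p) := by
  have hne := cross_ne_zero ht
  have s1 := cross_swap (a - p) (x - p)
  have s2 := cross_swap (a - p) (b - p)
  have s3 := cross_swap (x - p) (b - p)
  constructor
  · rintro (h | ⟨h1, h2 | h2⟩)
    · exact h.2.2
    · by_contra h3
      have : 0 < cross (a - p) (x - p) := lt_of_le_of_ne (by linarith) hne.symm
      exact not_cone_cross ht hb hbp hba hbx this (by linarith) h2.le
    · exact h2
  · intro h
    by_cases h1 : 0 < cross (b - p) (a - p)
    · refine Or.inl ⟨h1, ?_, h⟩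
      by_contra h3
      exact not_cone_cross (cell_perm ht) hb hbp hbx hba h (by linarith) h1.le
    · exact Or.inr ⟨not_lt.1 h1, Or.inr h⟩

lemma leftOf_iff_of_cell_right {K : SimplicialComplex ℝ Plane} {a p b x : Plane}
    (ht : {p, b, x} ∈ cells K) (ha : {p, a} ∈ K.faces) (hap : a ≠ p) (hab : a ≠ b) (hax : a ≠ x) :
    LeftOf a p b x ↔ 0 < cross (b - p) (x - p) := by
  have hne := cross_ne_zero ht
  have s1 := cross_swap (a - p) (x - p)
  have s2 := cross_swap (a - p) (b - p)
  have s3 := cross_swap (x - p) (b - p)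
  constructor
  · rintro (h | ⟨h1, h2 | h2⟩)
    · exact h.2.1
    · exact h2
    · by_contra h3
      have : 0 < cross (x - p) (b - p) := by
        rcases lt_or_gt_of_ne hne with h | h <;> linarith
      exact not_cone_cross (cell_perm ht) ha hap hax hab this h2.le (by linarith)
  · intro h
    by_cases h1 : 0 < cross (b - p) (a - p)
    · refine Or.inl ⟨h1, h, ?_⟩
      by_contra h3
      exact not_cone_cross ht ha hap hab hax h h1.le (by linarith)
    · exact Or.inr ⟨not_lt.1 h1, Or.inl h⟩

lemma cross_rot (x y z : Plane) : cross (y - x) (z - x) = cross (z - y) (x - y) := by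
  simp only [cross, PiLp.sub_apply]; ring

/-- A nonempty finite set of triangles has a side that belongs to only one of them. -/
lemma exists_edge_mem_unique {K : SimplicialComplex ℝ Plane} {A : Set (Finset Plane)}
    (hA : A ⊆ cells K) (hfin : A.Finite) (hne : A.Nonempty) :
    ∃ a b : Plane, ∃ t ∈ A, s(a, b) ∈ cellEdges t ∧ ∀ t' ∈ A, s(a, b) ∈ cellEdges t' → t' = t := by
  classical
  let V : Set Plane := ⋃ t ∈ A, (t : Set Plane)
  have hV : V.Finite := hfin.biUnion fun t _ => t.finite_toSet
  have hVmem : ∀ t ∈ A, ∀ x ∈ t, x ∈ V := fun t ht x hx => Set.mem_biUnion ht hx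
  -- The vertex `u` farthest from the origin is an extreme point of all the vertices. Below, `hgt`
  -- is the inner product of `u - x` with `u`; it measures the depth under the tangent at `u` of the
  -- circle about the origin and is positive at all other vertices.
  let sq : Plane → ℝ := fun x => x 0 * x 0 + x 1 * x 1
  obtain ⟨u, huV, humax⟩ : ∃ u ∈ V, ∀ x ∈ V, sq x ≤ sq u := by
    obtain ⟨t, ht⟩ := hne
    have : t.Nonempty := Finset.card_pos.1 (by rw [(hA ht).2]; norm_num)
    obtain ⟨x, hx⟩ := this
    exact Set.exists_max_image V sq hV ⟨x, hVmem t ht x hx⟩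
  obtain ⟨t₀, ht₀, hut₀⟩ : ∃ t ∈ A, u ∈ t := by simpa [V] using huV
  let hgt : Plane → ℝ := fun x => (u 0 - x 0) * u 0 + (u 1 - x 1) * u 1
  have hhgt : ∀ x ∈ V, x ≠ u → 0 < hgt x := by
    intro x hx hxu
    have h1 := humax x hx
    have h2 : 0 < (u 0 - x 0) ^ 2 + (u 1 - x 1) ^ 2 := by
      by_contra h
      have h0 := sq_nonneg (u 0 - x 0)
      have h1 := sq_nonneg (u 1 - x 1)
      exact hxu (coord_ext (by nlinarith) (by nlinarith))
    simp only [sq] at h1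
    simp only [hgt]; nlinarith
  -- The slope of the direction from `u` to `x` with respect to that tangent; the least slope
  -- belongs to an extreme edge `u w`.
  let sl : Plane → ℝ := fun x => cross u (x - u) / hgt x
  let W : Set Plane := {x | x ≠ u ∧ ∃ t ∈ A, u ∈ t ∧ x ∈ t}
  have hWV : W ⊆ V := fun x ⟨_, t, ht, _, hx⟩ => hVmem t ht x hx
  obtain ⟨w, ⟨hwu, t, ht, hut, hwt⟩, hmin⟩ : ∃ w ∈ W, ∀ x ∈ W, sl w ≤ sl x := by
    refine Set.exists_min_image W sl (hV.subset hWV) ?_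
    obtain ⟨x, hx, hxu⟩ := Finset.exists_mem_ne (s := t₀) (by rw [(hA ht₀).2]; norm_num) u
    exact ⟨x, hxu, t₀, ht₀, hut₀, hx⟩
  have hwV : w ∈ V := hVmem t ht w hwt
  have hw0 := hhgt w hwV hwu
  have husq : 0 < sq u := by
    by_contra h
    have h0 := mul_self_nonneg (u 0)
    have h1 := mul_self_nonneg (u 1)
    simp only [sq] at h
    have e0 : u 0 = 0 := by nlinarith
    have e1 : u 1 = 0 := by nlinarith
    simp only [hgt, e0, e1] at hw0
    simp at hw0
  -- All triangles of `A` at `u` lie on one side of the line `u w`, whereas two triangles with the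
  -- common side `u w` would lie on both.
  have hside : ∀ x ∈ W, cross (w - u) (x - u) ≤ 0 := by
    intro x hx
    have hx0 := hhgt x (hWV hx) hx.1
    have h1 := hmin x hx
    rw [div_le_div_iff₀ hw0 hx0] at h1
    have e : cross (w - u) (x - u) * sq u
        = cross u (w - u) * hgt x - cross u (x - u) * hgt w := by
      simp only [cross, hgt, sq, PiLp.sub_apply]; ring
    by_contra h
    rw [not_le] at h
    have := mul_pos h husq
    linarith
  refine ⟨u, w, t, ht, mem_cellEdges_iff.2 ⟨hwu.symm, hut, hwt⟩, fun t' ht' he => ?_⟩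
  rw [mem_cellEdges_iff] at he
  obtain ⟨z, hzu, hzw, rfl⟩ := exists_third (hA ht).2 hwu.symm hut hwt
  obtain ⟨z', hzu', hzw', rfl⟩ := exists_third (hA ht').2 hwu.symm he.2.1 he.2.2
  by_contra hcon
  have hneg := cross_mul_neg (hA ht) (hA ht') (fun h => hcon (by rw [h]))
  have s1 := hside z ⟨hzu, _, ht, by simp, by simp⟩
  have s2 := hside z' ⟨hzu', _, ht', by simp, by simp⟩
  nlinarith

end DiscretePlane

namespace DiscretePlane

open Geometry

/-! ### Stellar subdivision -/

/-- The weight `a` of `v` is distributed according to the coordinates `ω` of `v`. In this way points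
of faces of the starred complex get their coordinates in the old complex, where they are unique. -/
lemma IsCoord.insert_point {s : Finset Plane} {v x : Plane} {w ω : Plane → ℝ} {m : Finset Plane}
    (hω : IsCoord m v ω) (hsm : s ⊆ m) {a : ℝ} (ha : 0 ≤ a) (hw : ∀ y, 0 ≤ w y)
    (hws : ∀ y ∉ s, w y = 0) (h1 : a + ∑ y ∈ s, w y = 1) (hx : a • v + ∑ y ∈ s, w y • y = x) :
    IsCoord m x (fun y => a * ω y + w y) := by
  have key : ∀ {M : Type} [AddCommMonoid M] (f : Plane → M), (∀ y ∉ s, f y = 0) →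
      ∑ y ∈ m, f y = ∑ y ∈ s, f y := fun f hf =>
    (Finset.sum_subset hsm fun y _ hy => hf y hy).symm
  refine ⟨fun y => add_nonneg (mul_nonneg ha (hω.1 y)) (hw y), fun y hy => ?_, ?_, ?_⟩
  · simp [hω.2.1 y hy, hws y fun h => hy (hsm h)]
  · rw [Finset.sum_add_distrib, ← Finset.mul_sum, hω.2.2.1, mul_one, key w hws, h1]
  · simp_rw [add_smul, mul_smul]
    rw [Finset.sum_add_distrib, ← Finset.smul_sum, hω.2.2.2,
      key (fun y => w y • y) fun y hy => by simp only [hws y hy, zero_smul], hx]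

lemma exists_weights_insert {r : Finset Plane} {v x : Plane} (hv : v ∉ r) :
    x ∈ convexHull ℝ ((insert v r : Finset Plane) : Set Plane) ↔
    ∃ (a : ℝ) (w : Plane → ℝ), 0 ≤ a ∧ (∀ y, 0 ≤ w y) ∧ (∀ y ∉ r, w y = 0) ∧
      a + ∑ y ∈ r, w y = 1 ∧ a • v + ∑ y ∈ r, w y • y = x := by
  classical
  rw [mem_convexHull_iff_exists_isCoord]
  constructor
  · rintro ⟨w, h0, hs, h1, h2⟩
    have hne : ∀ y ∈ r, y ≠ v := fun y hy h => hv (h ▸ hy)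
    refine ⟨w v, fun y => if y = v then 0 else w y, h0 v, fun y => ?_, fun y hy => ?_, ?_, ?_⟩
    · dsimp only; split_ifs
      · exact le_rfl
      · exact h0 y
    · dsimp only; split_ifs with h
      · rfl
      · exact hs y (by simp [h, hy])
    · rw [← h1, Finset.sum_insert hv]
      congr 1; exact Finset.sum_congr rfl fun y hy => if_neg (hne y hy)
    · rw [← h2, Finset.sum_insert hv]
      congr 1; exact Finset.sum_congr rfl fun y hy => by simp only [if_neg (hne y hy)]
  · rintro ⟨a, w, ha, h0, hs, h1, h2⟩
    have hne : ∀ y ∈ r, y ≠ v := fun y hy h => hv (h ▸ hy)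
    refine ⟨fun y => if y = v then a else w y, fun y => ?_, fun y hy => ?_, ?_, ?_⟩
    · dsimp only; split_ifs
      · exact ha
      · exact h0 y
    · simp only [Finset.mem_insert, not_or] at hy
      simp [hy.1, hs y hy.2]
    · rw [Finset.sum_insert hv, ← h1]
      simp only [if_true]
      congr 1; exact Finset.sum_congr rfl fun y hy => if_neg (hne y hy)
    · rw [Finset.sum_insert hv, ← h2]
      simp only [if_true]
      congr 1; exact Finset.sum_congr rfl fun y hy => by simp only [if_neg (hne y hy)]

/-- If `v` were a vertex, the face `s₀`, whose open simplex contains it, would be contained in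
`{v}`. -/
lemma not_mem_of_mem_openHull {K : SimplicialComplex ℝ Plane} {s₀ m : Finset Plane} {v : Plane}
    (h₀ : s₀ ∈ K.faces) (hc : 2 ≤ s₀.card) (hv : v ∈ openHull s₀) (hm : m ∈ K.faces) : v ∉ m := by
  intro h
  have hvv : {v} ∈ K.faces := K.down_closed hm (by simpa using h) (by simp)
  have := Finset.card_le_card (subset_of_mem_openHull h₀ hvv hv (by simp))
  simp at this; omega

open Classical in
/-- The subdivision of `K` obtained by starring the face `s₀` at its inner point `v`. -/
noncomputable def star (K : SimplicialComplex ℝ Plane) (s₀ : Finset Plane) (v : Plane)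
    (h₀ : s₀ ∈ K.faces) (hc : 2 ≤ s₀.card) (hv : v ∈ openHull s₀) :
    SimplicialComplex ℝ Plane where
  faces := {s | (s ∈ K.faces ∧ ¬ s₀ ⊆ s) ∨
    ∃ r, r ∪ s₀ ∈ K.faces ∧ ¬ s₀ ⊆ r ∧ s = insert v r}
  isRelLowerSet_faces := by
    rintro s hs
    refine ⟨?_, fun t hts hne => ?_⟩
    · rcases hs with ⟨hs, -⟩ | ⟨r, -, -, rfl⟩
      · exact K.nonempty_of_mem_faces hs
      · simp
    · rcases hs with ⟨hs, hn⟩ | ⟨r, hr, hn, rfl⟩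
      · exact Or.inl ⟨K.down_closed hs hts hne, fun h => hn (h.trans hts)⟩
      · have hvr : v ∉ r := fun h =>
          not_mem_of_mem_openHull h₀ hc hv hr (Finset.mem_union_left _ h)
        by_cases hvt : v ∈ t
        · refine Or.inr ⟨t.erase v, ?_, fun h => hn (h.trans ?_), (Finset.insert_erase hvt).symm⟩
          · refine K.down_closed hr (Finset.union_subset_union ?_ le_rfl)
              ((K.nonempty_of_mem_faces h₀).mono Finset.subset_union_right)
            rw [← Finset.erase_insert hvr]; exact Finset.erase_subset_erase _ hts
          · rw [← Finset.erase_insert hvr]; exact Finset.erase_subset_erase _ hts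
        · have htr : t ⊆ r := (Finset.subset_insert_iff_of_notMem hvt).1 hts
          exact Or.inl ⟨K.down_closed hr (htr.trans Finset.subset_union_left) hne,
            fun h => hn (h.trans htr)⟩
  indep := by
    rintro s (⟨hs, -⟩ | ⟨r, hr, hn, rfl⟩)
    · exact K.indep hs
    · have hvr : v ∉ r := fun h =>
        not_mem_of_mem_openHull h₀ hc hv hr (Finset.mem_union_left _ h)
      obtain ⟨ω, hω, hpos⟩ := hv
      have hωm := hω.mono (Finset.subset_union_right (s₁ := r))
      obtain ⟨u, hu, hur⟩ := Finset.not_subset.1 hn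
      rw [affineIndependent_iff]
      suffices H : ∀ w : Plane → ℝ, ∑ y ∈ insert v r, w y = 0 → ∑ y ∈ insert v r, w y • y = 0 →
          ∀ y ∈ insert v r, w y = 0 by
        intro T w h1 h2 e he
        let w' : Plane → ℝ := fun y => if h : y ∈ insert v r then if ⟨y, h⟩ ∈ T then w ⟨y, h⟩ else 0
          else 0
        have hw' : ∀ y : (insert v r : Finset Plane), w' y = if y ∈ T then w y else 0 := by
          rintro ⟨y, hy⟩
          have : w' y = _ := dif_pos hy
          exact this
        have := H w' ?_ ?_ e.1 e.2
        · rwa [hw' e, if_pos he] at this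
        · rw [← Finset.sum_coe_sort, ← h1]
          simp_rw [hw']
          rw [Finset.sum_ite_mem, Finset.univ_inter]
        · rw [← Finset.sum_coe_sort, ← h2]
          simp_rw [hw', ite_smul, zero_smul]
          rw [Finset.sum_ite_mem, Finset.univ_inter]
      intro w h1 h2
      rw [Finset.sum_insert hvr] at h1 h2
      let w₁ : Plane → ℝ := fun y => if y ∈ r then w y else 0
      -- Expressing `v` by `s₀` turns the relation into one between the points of the old face `r ∪
      -- s₀`. At the point `u` of `s₀` outside `r` its coefficient is `w v * ω u`, whence `w v = 0`.
      have k := eq_zero_of_sum_eq_zero (K.indep hr) (w := fun y => w v * ω y + w₁ y) ?_ ?_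
      · have hwv : w v = 0 := by
          have := k u (Finset.mem_union_right _ hu)
          simp only [w₁, if_neg hur, add_zero] at this
          exact (mul_eq_zero.1 this).resolve_right (hpos u hu).ne'
        intro y hy
        rcases Finset.mem_insert.1 hy with rfl | hy
        · exact hwv
        · have := k y (Finset.mem_union_left _ hy)
          simpa [w₁, hy, hwv] using this
      · rw [Finset.sum_add_distrib, ← Finset.mul_sum, hωm.2.2.1, mul_one, Finset.sum_ite_mem,
          Finset.union_inter_cancel_left, h1]
      · simp_rw [add_smul, mul_smul]
        rw [Finset.sum_add_distrib, ← Finset.smul_sum, hωm.2.2.2]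
        simp_rw [w₁, ite_smul, zero_smul]
        rw [Finset.sum_ite_mem, Finset.union_inter_cancel_left, h2]
  inter_subset_convexHull := by
    have hvn : ∀ r, r ∪ s₀ ∈ K.faces → v ∉ r := fun r hr h =>
      not_mem_of_mem_openHull h₀ hc hv hr (Finset.mem_union_left _ h)
    obtain ⟨ω, hω, hpos⟩ := hv
    -- At a vertex `u` of `s₀` outside `s` the old coordinate vanishes, but it is at least `a * ω
    -- u`. So `v` has weight zero and only common old vertices remain.
    have mixed : ∀ {s r : Finset Plane}, s ∈ K.faces → ¬ s₀ ⊆ s → r ∪ s₀ ∈ K.faces →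
        ∀ x, x ∈ convexHull ℝ (s : Set Plane) →
        x ∈ convexHull ℝ ((insert v r : Finset Plane) : Set Plane) →
        x ∈ convexHull ℝ (s ∩ (insert v r : Finset Plane) : Set Plane) := by
      intro s r hs hn hr x hxs hxr
      obtain ⟨a, w, ha, hw, hwr, h1, h2⟩ := (exists_weights_insert (hvn r hr)).1 hxr
      obtain ⟨w', hw'⟩ := mem_convexHull_iff_exists_isCoord.1 hxs
      have hωm := hω.mono (Finset.subset_union_right (s₁ := r))
      have e := hw'.unique hs hr (hωm.insert_point Finset.subset_union_left ha hw hwr h1 h2)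
      obtain ⟨u, hu, hus⟩ := Finset.not_subset.1 hn
      have ha0 : a = 0 := by
        have k := congrFun e u
        rw [hw'.2.1 u hus] at k
        have k1 := mul_nonneg ha (hpos u hu).le
        have k2 := hw u
        exact (mul_eq_zero.1 (by linarith : a * ω u = 0)).resolve_right (hpos u hu).ne'
      have e' : w' = w := by rw [e]; funext y; simp [ha0]
      rw [← Finset.coe_inter]
      refine (hw'.of_support fun y hy => ?_).mem
      by_cases hys : y ∈ s
      · rw [e']
        exact hwr y fun h => hy (Finset.mem_inter.2 ⟨hys, Finset.mem_insert_of_mem h⟩)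
      · exact hw'.2.1 y hys
    -- Comparing the coordinates at a point of `s₀` outside `r` and at one outside `r'` gives the
    -- two inequalities between the weights `a` and `a'` of `v`. The remaining weights then agree
    -- too, so they are supported on `r ∩ r'`.
    have both : ∀ {r r' : Finset Plane}, r ∪ s₀ ∈ K.faces → ¬ s₀ ⊆ r → r' ∪ s₀ ∈ K.faces →
        ¬ s₀ ⊆ r' → ∀ x, x ∈ convexHull ℝ ((insert v r : Finset Plane) : Set Plane) →
        x ∈ convexHull ℝ ((insert v r' : Finset Plane) : Set Plane) →
        x ∈ convexHull ℝ ((insert v r : Finset Plane) ∩ (insert v r' : Finset Plane) :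
          Set Plane) := by
      intro r r' hr hn hr' hn' x hx hx'
      obtain ⟨a, w, ha, hw, hwr, h1, h2⟩ := (exists_weights_insert (hvn r hr)).1 hx
      obtain ⟨a', w', ha', hw', hwr', h1', h2'⟩ := (exists_weights_insert (hvn r' hr')).1 hx'
      have hωm := hω.mono (Finset.subset_union_right (s₁ := r))
      have hωm' := hω.mono (Finset.subset_union_right (s₁ := r'))
      have e := (hωm.insert_point Finset.subset_union_left ha hw hwr h1 h2).unique hr hr'
        (hωm'.insert_point Finset.subset_union_left ha' hw' hwr' h1' h2')
      obtain ⟨u, hu, hur⟩ := Finset.not_subset.1 hn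
      obtain ⟨u', hu', hur'⟩ := Finset.not_subset.1 hn'
      have e1 : a = a' := by
        have k := congrFun e u
        have k' := congrFun e u'
        simp only [hwr u hur, hwr' u' hur', add_zero] at k k'
        have := hw' u
        have := hw u'
        refine le_antisymm ?_ ?_
        · exact le_of_mul_le_mul_right (by linarith) (hpos u' hu')
        · exact le_of_mul_le_mul_right (by linarith) (hpos u hu)
      have e2 : w = w' := by
        funext y
        have k := congrFun e y
        simp only [e1] at k
        linarith
      rw [← Finset.coe_inter, ← Finset.insert_inter_distrib]
      have hsup : ∀ y ∈ r, y ∉ r ∩ r' → w y = 0 := fun y hy hy' => by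
        rw [e2]; exact hwr' y fun h => hy' (Finset.mem_inter.2 ⟨hy, h⟩)
      refine (exists_weights_insert (fun h => hvn r hr (Finset.mem_inter.1 h).1)).2
        ⟨a, w, ha, hw, fun y hy => ?_, ?_, ?_⟩
      · by_cases hyr : y ∈ r
        · exact hsup y hyr hy
        · exact hwr y hyr
      · rw [← h1, Finset.sum_subset Finset.inter_subset_left hsup]
      · rw [← h2, Finset.sum_subset Finset.inter_subset_left fun y hy hy' => by
          rw [hsup y hy hy', zero_smul]]
    rintro s t (⟨hs, hn⟩ | ⟨r, hr, hn, rfl⟩) (⟨ht, hn'⟩ | ⟨r', hr', hn', rfl⟩) x ⟨hx, hx'⟩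
    · exact K.inter_subset_convexHull hs ht ⟨hx, hx'⟩
    · exact mixed hs hn hr' x hx hx'
    · rw [Set.inter_comm]; exact mixed ht hn' hr x hx' hx
    · exact both hr hn hr' hn' x hx hx'

section Star

variable {K : SimplicialComplex ℝ Plane} {s₀ : Finset Plane} {v : Plane} {h₀ : s₀ ∈ K.faces}
  {hc : 2 ≤ s₀.card} {hv : v ∈ openHull s₀}

open Classical in
lemma mem_star_faces {s : Finset Plane} : s ∈ (star K s₀ v h₀ hc hv).faces ↔
    (s ∈ K.faces ∧ ¬ s₀ ⊆ s) ∨ ∃ r, r ∪ s₀ ∈ K.faces ∧ ¬ s₀ ⊆ r ∧ s = insert v r := Iff.rfl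

lemma star_isSubdivision : IsSubdivision (star K s₀ v h₀ hc hv) K := by
  classical
  have hsub : ∀ s ∈ (star K s₀ v h₀ hc hv).faces,
      ∃ t ∈ K.faces, convexHull ℝ (s : Set Plane) ⊆ convexHull ℝ (t : Set Plane) := by
    rintro s (⟨hs, -⟩ | ⟨r, hr, hn, rfl⟩)
    · exact ⟨s, hs, le_rfl⟩
    · refine ⟨_, hr, convexHull_min ?_ (convex_convexHull ℝ _)⟩
      rw [Finset.coe_insert, Set.insert_subset_iff]
      refine ⟨convexHull_mono (by simp) (openHull_subset _ hv), ?_⟩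
      exact Set.Subset.trans (by simp) (subset_convexHull ℝ _)
  refine ⟨?_, hsub⟩
  ext x
  constructor
  · intro hx
    obtain ⟨s, hs, hx⟩ := SimplicialComplex.mem_space_iff.1 hx
    obtain ⟨t, ht, hst⟩ := hsub s hs
    exact SimplicialComplex.mem_space_iff.2 ⟨t, ht, hst hx⟩
  · intro hx
    obtain ⟨s, hs, hx⟩ := SimplicialComplex.mem_space_iff.1 hx
    by_cases hn : s₀ ⊆ s
    swap
    · exact SimplicialComplex.mem_space_iff.2 ⟨s, Or.inl ⟨hs, hn⟩, hx⟩
    have hvs := not_mem_of_mem_openHull h₀ hc hv hs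
    obtain ⟨ω, hω, hpos⟩ := hv
    obtain ⟨w, hw⟩ := mem_convexHull_iff_exists_isCoord.1 hx
    -- The minimal ratio `a` is the largest multiple of `v` that can be split off from `x` with
    -- nonnegative weights left; at `u` nothing is left, so `x` lies in the simplex of `v` and
    -- `s.erase u`.
    obtain ⟨u, hu, hmin⟩ := Finset.exists_min_image s₀ (fun y => w y / ω y)
      (K.nonempty_of_mem_faces h₀)
    have hus := hn hu
    set a := w u / ω u with ha
    have hωs := hω.mono hn
    have hau : a * ω u = w u := by rw [ha]; field_simp [(hpos u hu).ne']
    have ha0 : 0 ≤ a := div_nonneg (hw.1 u) (hpos u hu).le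
    refine SimplicialComplex.mem_space_iff.2 ⟨insert v (s.erase u), Or.inr ⟨s.erase u, ?_, ?_, rfl⟩,
      (exists_weights_insert (fun h => hvs (Finset.mem_of_mem_erase h))).2
        ⟨a, fun y => w y - a * ω y, ha0, fun y => ?_, fun y hy => ?_, ?_, ?_⟩⟩
    · rwa [show s.erase u ∪ s₀ = s from ?_]
      ext y; simp only [Finset.mem_union, Finset.mem_erase]
      constructor
      · rintro (h | h)
        · exact h.2
        · exact hn h
      · intro h
        by_cases hyu : y = u
        · exact Or.inr (hyu ▸ hu)
        · exact Or.inl ⟨hyu, h⟩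
    · exact fun h => (Finset.notMem_erase u s) (h hu)
    · by_cases hy : y ∈ s₀
      · have := hmin y hy
        rw [le_div_iff₀ (hpos y hy)] at this
        dsimp only; linarith
      · simp [hω.2.1 y hy, hw.1 y]
    · by_cases hyu : y = u
      · subst hyu; simp only [hau, sub_self]
      · have hys : y ∉ s := fun h => hy (Finset.mem_erase.2 ⟨hyu, h⟩)
        simp [hw.2.1 y hys, hωs.2.1 y hys]
    · have h1 := Finset.add_sum_erase s (fun y => w y - a * ω y) hus
      simp only [hau, sub_self, zero_add] at h1
      rw [h1, Finset.sum_sub_distrib, ← Finset.mul_sum, hw.2.2.1, hωs.2.2.1]; ring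
    · have h1 := Finset.add_sum_erase s (fun y => (w y - a * ω y) • y) hus
      simp only [hau, sub_self, zero_add, zero_smul] at h1
      rw [h1]
      simp_rw [sub_smul, mul_smul]
      rw [Finset.sum_sub_distrib, ← Finset.smul_sum, hw.2.2.2, hωs.2.2.2]; abel

lemma star_finite (hK : K.faces.Finite) : (star K s₀ v h₀ hc hv).faces.Finite := by
  classical
  have h2 : {r : Finset Plane | r ∪ s₀ ∈ K.faces}.Finite := by
    refine (hK.biUnion fun s _ => s.powerset.finite_toSet).subset fun r hr => ?_
    exact Set.mem_biUnion hr (Finset.mem_coe.2 (Finset.mem_powerset.2 Finset.subset_union_left))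
  refine (hK.union (h2.image fun r => insert v r)).subset ?_
  rintro s (⟨hs, -⟩ | ⟨r, hr, hn, rfl⟩)
  · exact Or.inl hs
  · exact Or.inr ⟨r, hr, rfl⟩

lemma IsSubdivision.trans {K L M : SimplicialComplex ℝ Plane} (h : IsSubdivision K L)
    (h' : IsSubdivision L M) : IsSubdivision K M := by
  refine ⟨h.1.trans h'.1, fun s hs => ?_⟩
  obtain ⟨t, ht, hst⟩ := h.2 s hs
  obtain ⟨u, hu, htu⟩ := h'.2 t ht
  exact ⟨u, hu, hst.trans htu⟩

lemma IsSubdivision.refl (K : SimplicialComplex ℝ Plane) : IsSubdivision K K :=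
  ⟨rfl, fun s hs => ⟨s, hs, le_rfl⟩⟩

/-- Every face is contained in a triangle. -/
def IsPure (K : SimplicialComplex ℝ Plane) : Prop := ∀ s ∈ K.faces, ∃ t ∈ cells K, s ⊆ t

/-- A triangle `m` containing `s₀` is replaced by the triangles `insert v (m.erase u)` with `u ∈
s₀`. A face of the new complex misses some such `u` and fits into the corresponding triangle. -/
lemma star_isPure (hK : IsPure K) : IsPure (star K s₀ v h₀ hc hv) := by
  classical
  have key : ∀ m ∈ cells K, s₀ ⊆ m → ∀ u ∈ s₀,
      insert v (m.erase u) ∈ cells (star K s₀ v h₀ hc hv) := by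
    intro m hm hsm u hu
    have hvm := not_mem_of_mem_openHull h₀ hc hv hm.1
    refine ⟨Or.inr ⟨m.erase u, ?_, fun h => Finset.notMem_erase u m (h hu), rfl⟩, ?_⟩
    · rw [show m.erase u ∪ s₀ = m from ?_]
      · exact hm.1
      · ext y; simp only [Finset.mem_union, Finset.mem_erase]
        constructor
        · rintro (h | h)
          · exact h.2
          · exact hsm h
        · intro h
          by_cases hyu : y = u
          · exact Or.inr (hyu ▸ hu)
          · exact Or.inl ⟨hyu, h⟩
    · rw [Finset.card_insert_of_notMem fun h => hvm (Finset.mem_of_mem_erase h),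
        Finset.card_erase_of_mem (hsm hu), hm.2]
  rintro s (⟨hs, hn⟩ | ⟨r, hr, hn, rfl⟩)
  · obtain ⟨m, hm, hsm⟩ := hK s hs
    by_cases h : s₀ ⊆ m
    · obtain ⟨u, hu, hus⟩ := Finset.not_subset.1 hn
      refine ⟨_, key m hm h u hu, fun y hy => Finset.mem_insert_of_mem (Finset.mem_erase.2
        ⟨fun h => hus (h ▸ hy), hsm hy⟩)⟩
    · exact ⟨m, ⟨Or.inl ⟨hm.1, h⟩, hm.2⟩, hsm⟩
  · obtain ⟨m, hm, hsm⟩ := hK _ hr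
    obtain ⟨u, hu, hur⟩ := Finset.not_subset.1 hn
    refine ⟨_, key m hm (Finset.subset_union_right.trans hsm) u hu,
      Finset.insert_subset_insert _ fun y hy => Finset.mem_erase.2
        ⟨fun h => hur (h ▸ hy), hsm (Finset.mem_union_left _ hy)⟩⟩

lemma star_vertex : {v} ∈ (star K s₀ v h₀ hc hv).faces := by
  classical
  refine Or.inr ⟨∅, by simpa using h₀, fun h => ?_, by simp⟩
  rw [Finset.subset_empty.1 h] at hc
  simp at hc

lemma star_adj_old {x y : Plane} (hx : x ≠ v) (hy : y ≠ v) :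
    (graph (star K s₀ v h₀ hc hv)).Adj x y ↔ (graph K).Adj x y ∧ s₀ ≠ {x, y} := by
  classical
  rw [graph_adj_iff, graph_adj_iff, mem_star_faces]
  constructor
  · rintro ⟨hne, ⟨h, hn⟩ | ⟨r, hr, hn, e⟩⟩
    · exact ⟨⟨hne, h⟩, fun h => hn h.subset⟩
    · have : v ∈ ({x, y} : Finset Plane) := by rw [e]; simp
      simp [hx.symm, hy.symm] at this
  · rintro ⟨⟨hne, h⟩, hn⟩
    refine ⟨hne, Or.inl ⟨h, fun hs => hn ?_⟩⟩
    refine Finset.eq_of_subset_of_card_le hs ?_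
    rw [Finset.card_pair hne]; exact hc

lemma star_adj_new {y : Plane} :
    (graph (star K s₀ v h₀ hc hv)).Adj v y ↔ insert y s₀ ∈ K.faces := by
  classical
  rw [graph_adj_iff, mem_star_faces]
  constructor
  · rintro ⟨hne, ⟨h, hn⟩ | ⟨r, hr, hn, e⟩⟩
    · exact absurd (Finset.mem_insert_self v {y}) (not_mem_of_mem_openHull h₀ hc hv h)
    · have hy : y ∈ insert v r := by rw [← e]; simp
      have hyr : y ∈ r := (Finset.mem_insert.1 hy).resolve_left hne.symm
      exact K.down_closed hr (Finset.insert_subset (Finset.mem_union_left _ hyr)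
        Finset.subset_union_right) (by simp)
  · intro h
    have hne : v ≠ y := fun e => not_mem_of_mem_openHull h₀ hc hv h (by simp [e])
    refine ⟨hne, Or.inr ⟨{y}, by simpa using h, fun hs => ?_, rfl⟩⟩
    have := Finset.card_le_card hs
    simp at this; omega

end Star

end DiscretePlane

namespace DiscretePlane

open Geometry

/-! ### Chains modulo 2 -/

/-- Chains of edges modulo 2. -/
abbrev Chain := Sym2 Plane → ZMod 2

open Classical in
/-- The edge `a b` as a chain. -/
noncomputable def edgeChain (a b : Plane) : Chain := Pi.single s(a, b) 1

open Classical in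
/-- The boundary of a triangle as a chain. -/
noncomputable def bdry (t : Finset Plane) : Chain := fun e => if e ∈ cellEdges t then 1 else 0

/-- The boundaries modulo 2 of the complex `K`. -/
noncomputable def boundaries (K : SimplicialComplex ℝ Plane) : Submodule (ZMod 2) Chain :=
  Submodule.span (ZMod 2) (bdry '' cells K)

lemma edgeChain_comm (a b : Plane) : edgeChain a b = edgeChain b a := by
  rw [edgeChain, edgeChain, Sym2.eq_swap]

lemma chain_two : (2 : Chain) = 0 := by
  funext e; exact CharTwo.two_eq_zero

lemma bdry_triple {a b c : Plane} (hab : a ≠ b) (hca : c ≠ a) (hcb : c ≠ b) :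
    bdry {a, b, c} = edgeChain a b + edgeChain b c + edgeChain c a := by
  classical
  funext e
  induction e using Sym2.ind with | _ x y => ?_
  simp only [bdry, edgeChain, Pi.add_apply, Pi.single_apply, mem_cellEdges_iff, Sym2.eq_iff,
    Finset.mem_insert, Finset.mem_singleton]
  by_cases h : x ≠ y ∧ (x = a ∨ x = b ∨ x = c) ∧ (y = a ∨ y = b ∨ y = c)
  · rw [if_pos h]
    obtain ⟨hxy, rfl | rfl | rfl, rfl | rfl | rfl⟩ := h <;>
      first | exact absurd rfl hxy | simp [hab, hca, hcb, hab.symm, hca.symm, hcb.symm]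
  · rw [if_neg h, if_neg, if_neg, if_neg]
    · simp
    all_goals
      contrapose! h
      rcases h with ⟨rfl, rfl⟩ | ⟨rfl, rfl⟩ <;>
        simp [hab, hca, hcb, hab.symm, hca.symm, hcb.symm]

lemma bdry_mem_boundaries {K : SimplicialComplex ℝ Plane} {t : Finset Plane} (ht : t ∈ cells K) :
    bdry t ∈ boundaries K :=
  Submodule.subset_span ⟨t, ht, rfl⟩

lemma triple_mem_boundaries {K : SimplicialComplex ℝ Plane} {a b c : Plane}
    (ht : {a, b, c} ∈ cells K) :
    edgeChain a b + edgeChain b c + edgeChain c a ∈ boundaries K := by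
  obtain ⟨hab, hca, hcb⟩ := card_of_cell ht
  rw [← bdry_triple hab hca hcb]; exact bdry_mem_boundaries ht

/-- Edges are coboundaries modulo boundaries: this says that the first homology modulo 2 of `K`
vanishes. -/
def HasPotential (K : SimplicialComplex ℝ Plane) : Prop :=
  ∃ g : Plane → Chain, ∀ a b, (graph K).Adj a b → edgeChain a b + g a + g b ∈ boundaries K

section Star

variable {K : SimplicialComplex ℝ Plane} {s₀ : Finset Plane} {v : Plane} {h₀ : s₀ ∈ K.faces}
  {hc : 2 ≤ s₀.card} {hv : v ∈ openHull s₀}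

open Classical in
lemma cell_star {x y : Plane} (hxy : x ≠ y) (h : {x, y} ∪ s₀ ∈ K.faces) (hn : ¬ s₀ ⊆ {x, y}) :
    {v, x, y} ∈ cells (star K s₀ v h₀ hc hv) := by
  refine ⟨Or.inr ⟨_, h, hn, rfl⟩, ?_⟩
  have hvm := not_mem_of_mem_openHull h₀ hc hv h
  simp only [Finset.mem_union, Finset.mem_insert, Finset.mem_singleton, not_or] at hvm
  exact card_triple hvm.1.1 (Ne.symm hvm.1.2) hxy.symm

lemma cell_star_old {t : Finset Plane} (ht : t ∈ cells K) (hn : ¬ s₀ ⊆ t) :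
    t ∈ cells (star K s₀ v h₀ hc hv) :=
  ⟨Or.inl ⟨ht.1, hn⟩, ht.2⟩

/-- This is the chain map of the subdivision: the boundary of a triangle containing `s₀` becomes the
sum of the boundaries of its parts, in which the inner edges cancel modulo 2. Only when `s₀` is an
edge does an edge get replaced. -/
lemma exists_subdivision_map : ∃ sd : Chain →ₗ[ZMod 2] Chain,
    (∀ x ∈ boundaries K, sd x ∈ boundaries (star K s₀ v h₀ hc hv)) ∧
    (∀ x y, s₀ ≠ {x, y} → sd (edgeChain x y) = edgeChain x y) ∧
    (∀ x y, s₀ = {x, y} → sd (edgeChain x y) = edgeChain x v + edgeChain v y) := by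
  classical
  have hne : ∀ {m : Finset Plane}, m ∈ K.faces → v ∉ m := not_mem_of_mem_openHull h₀ hc hv
  have h3 := card_le_three h₀
  obtain h2 | h2 : s₀.card = 2 ∨ s₀.card = 3 := by omega
  · obtain ⟨a, b, hab, rfl⟩ := Finset.card_eq_two.1 h2
    -- Modulo 2, adding `a b + a v + v b` once for each occurrence of `a b` replaces `a b` by `a v +
    -- v b`.
    let sd : Chain →ₗ[ZMod 2] Chain := LinearMap.id +
      (LinearMap.proj s(a, b)).smulRight (edgeChain a b + edgeChain a v + edgeChain v b)
    have hsd : ∀ x : Chain, sd x = x + x s(a, b) •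
      (edgeChain a b + edgeChain a v + edgeChain v b) := fun x => rfl
    have hva : v ≠ a := fun h => hne h₀ (by simp [h])
    have hvb : v ≠ b := fun h => hne h₀ (by simp [h])
    refine ⟨sd, ?_, ?_, ?_⟩
    · intro x hx
      refine Submodule.span_induction (p := fun x _ => sd x ∈ boundaries _) ?_ ?_ ?_ ?_ hx
      · rintro _ ⟨t, ht, rfl⟩
        rw [hsd]
        by_cases he : s(a, b) ∈ cellEdges t
        · have e1 : bdry t s(a, b) = 1 := if_pos he
          rw [mem_cellEdges_iff] at he
          obtain ⟨c, hca, hcb, rfl⟩ := exists_third ht.2 hab he.2.1 he.2.2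
          have hU : ({a, c} : Finset Plane) ∪ {a, b} = {a, b, c} := by ext; simp; tauto
          have hU' : ({b, c} : Finset Plane) ∪ {a, b} = {a, b, c} := by ext; simp; tauto
          have c1 : {v, a, c} ∈ cells (star K {a, b} v h₀ hc hv) :=
            cell_star hca.symm (by rw [hU]; exact ht.1) (by
              simp [Finset.insert_subset_iff, hab.symm, hcb.symm])
          have c2 : {v, b, c} ∈ cells (star K {a, b} v h₀ hc hv) :=
            cell_star hcb.symm (by rw [hU']; exact ht.1) (by
              simp [Finset.insert_subset_iff, hab, hca.symm])
          have := Submodule.add_mem _ (triple_mem_boundaries c1) (triple_mem_boundaries c2)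
          convert this using 1
          rw [e1, one_smul, bdry_triple hab hca hcb, edgeChain_comm a v, edgeChain_comm c v,
            edgeChain_comm c a]
          linear_combination (edgeChain a b - edgeChain v c) * chain_two
        · have e1 : bdry t s(a, b) = 0 := if_neg he
          rw [e1, zero_smul, add_zero]
          refine bdry_mem_boundaries (cell_star_old ht fun h => he ?_)
          rw [mem_cellEdges_iff]
          exact ⟨hab, h (by simp), h (by simp)⟩
      · rw [map_zero]; exact Submodule.zero_mem _
      · intro x y _ _ hx hy; rw [map_add]; exact Submodule.add_mem _ hx hy
      · intro c x _ hx; rw [map_smul]; exact Submodule.smul_mem _ c hx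
    · intro x y hxy
      have : s(a, b) ≠ s(x, y) := fun h => hxy (by
        rw [Sym2.eq_iff] at h
        rcases h with ⟨rfl, rfl⟩ | ⟨rfl, rfl⟩
        · rfl
        · exact Finset.pair_comm _ _)
      rw [hsd, edgeChain, Pi.single_eq_of_ne this, zero_smul, add_zero]
    · intro x y hxy
      have hs : s(x, y) = s(a, b) ∧ edgeChain x v + edgeChain v y = edgeChain a v + edgeChain v b := by
        have hx : x ∈ ({a, b} : Finset Plane) := by rw [hxy]; simp
        have hy : y ∈ ({a, b} : Finset Plane) := by rw [hxy]; simp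
        have hne : x ≠ y := by rintro rfl; rw [hxy] at hc; simp at hc
        simp only [Finset.mem_insert, Finset.mem_singleton] at hx hy
        rcases hx with rfl | rfl <;> rcases hy with rfl | rfl
        · exact absurd rfl hne
        · exact ⟨rfl, rfl⟩
        · exact ⟨Sym2.eq_swap, by rw [edgeChain_comm x, edgeChain_comm v y, add_comm]⟩
        · exact absurd rfl hne
      have e1 : edgeChain x y = edgeChain a b := by rw [edgeChain, hs.1, edgeChain]
      rw [hs.2, e1, hsd, show edgeChain a b s(a, b) = 1 from Pi.single_eq_same _ _, one_smul]
      linear_combination (edgeChain a b) * chain_two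
  · obtain ⟨a, b, c, hab, hac, hbc, rfl⟩ := Finset.card_eq_three.1 h2
    refine ⟨LinearMap.id, ?_, fun _ _ _ => rfl, fun x y hxy => ?_⟩
    · intro x hx
      rw [LinearMap.id_apply]
      refine Submodule.span_induction (p := fun x _ => x ∈ boundaries _) ?_
        (Submodule.zero_mem _) (fun x y _ _ => Submodule.add_mem _)
        (fun c x _ => Submodule.smul_mem _ c) hx
      rintro _ ⟨t, ht, rfl⟩
      by_cases he : {a, b, c} ⊆ t
      · have e := Finset.eq_of_subset_of_card_le he (by rw [ht.2, h2])
        subst e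
        have hU : ∀ {x y}, x ∈ ({a, b, c} : Finset Plane) → y ∈ ({a, b, c} : Finset Plane) →
            ({x, y} : Finset Plane) ∪ {a, b, c} ∈ K.faces := by
          intro x y hx hy
          rwa [Finset.union_eq_right.2]
          simp only [Finset.insert_subset_iff, Finset.singleton_subset_iff]
          exact ⟨hx, hy⟩
        have c1 : {v, a, b} ∈ cells (star K {a, b, c} v h₀ hc hv) :=
          cell_star hab (hU (by simp) (by simp))
            (by simp [Finset.insert_subset_iff, hac.symm, hbc.symm])
        have c2 : {v, b, c} ∈ cells (star K {a, b, c} v h₀ hc hv) :=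
          cell_star hbc (hU (by simp) (by simp)) (by simp [Finset.insert_subset_iff, hab, hac])
        have c3 : {v, c, a} ∈ cells (star K {a, b, c} v h₀ hc hv) :=
          cell_star hac.symm (hU (by simp) (by simp))
            (by simp [Finset.insert_subset_iff, hab.symm, hbc])
        have := Submodule.add_mem _ (Submodule.add_mem _ (triple_mem_boundaries c1)
          (triple_mem_boundaries c2)) (triple_mem_boundaries c3)
        convert this using 1
        rw [bdry_triple hab hac.symm hbc.symm, edgeChain_comm a v, edgeChain_comm b v,
          edgeChain_comm c v]
        linear_combination (-edgeChain v a - edgeChain v b - edgeChain v c) * chain_two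
      · exact bdry_mem_boundaries (cell_star_old ht he)
    · rw [hxy] at h2
      have := Finset.card_le_two (a := x) (b := y)
      omega

lemma star_hasPotential (hK : HasPotential K) : HasPotential (star K s₀ v h₀ hc hv) := by
  classical
  obtain ⟨g, hg⟩ := hK
  obtain ⟨sd, hB, hE, hE'⟩ := exists_subdivision_map (h₀ := h₀) (hc := hc) (hv := hv)
  obtain ⟨a₀, ha₀⟩ := K.nonempty_of_mem_faces h₀
  have hav : a₀ ≠ v := fun h => not_mem_of_mem_openHull h₀ hc hv h₀ (h ▸ ha₀)
  -- The new vertex is thought of as reached through `a₀`. The condition at another edge `v y` then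
  -- follows from the one for `a₀ y`, via the triangle `v a₀ y`, or via the subdivided edge if `s₀ =
  -- {a₀, y}`.
  let g' : Plane → Chain := fun y => if y = v then sd (g a₀) + edgeChain a₀ v else sd (g y)
  have hgv : g' v = sd (g a₀) + edgeChain a₀ v := if_pos rfl
  have hgo : ∀ y, y ≠ v → g' y = sd (g y) := fun y hy => if_neg hy
  have old : ∀ x y, (graph K).Adj x y → s₀ ≠ {x, y} →
      edgeChain x y + sd (g x) + sd (g y) ∈ boundaries (star K s₀ v h₀ hc hv) := by
    intro x y hxy hn
    have := hB _ (hg x y hxy)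
    rwa [map_add, map_add, hE x y hn] at this
  have new : ∀ y, (graph (star K s₀ v h₀ hc hv)).Adj v y →
      edgeChain v y + g' v + g' y ∈ boundaries (star K s₀ v h₀ hc hv) := by
    intro y hy
    have hyv : y ≠ v := hy.1.symm
    rw [hgv, hgo y hyv]
    have hys := star_adj_new.1 hy
    by_cases hya : y = a₀
    · rw [hya, edgeChain_comm v a₀]
      convert Submodule.zero_mem _ using 1
      linear_combination (edgeChain a₀ v + sd (g a₀)) * chain_two
    have hadj : (graph K).Adj a₀ y := ⟨Ne.symm hya, _, hys, Finset.mem_insert_of_mem ha₀, by simp⟩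
    by_cases hs : s₀ = {a₀, y}
    · have := hB _ (hg a₀ y hadj)
      rw [map_add, map_add, hE' a₀ y hs] at this
      convert this using 1; ring
    · have hcell : {v, a₀, y} ∈ cells (star K s₀ v h₀ hc hv) := by
        refine cell_star (Ne.symm hya) ?_ fun h => hs (Finset.eq_of_subset_of_card_le h ?_)
        · rwa [show ({a₀, y} : Finset Plane) ∪ s₀ = insert y s₀ from ?_]
          ext z; simp only [Finset.mem_union, Finset.mem_insert, Finset.mem_singleton]
          constructor
          · rintro ((rfl | h) | h)
            · exact Or.inr ha₀
            · exact Or.inl h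
            · exact Or.inr h
          · tauto
        · rw [Finset.card_pair (Ne.symm hya)]; exact hc
      have := Submodule.add_mem _ (triple_mem_boundaries hcell) (old a₀ y hadj hs)
      convert this using 1
      rw [edgeChain_comm v a₀, edgeChain_comm v y]
      linear_combination (-edgeChain a₀ y) * chain_two
  refine ⟨g', fun x y hxy => ?_⟩
  by_cases hx : x = v
  · subst hx; exact new y hxy
  by_cases hy : y = v
  · subst hy
    have := new x hxy.symm
    rw [edgeChain_comm] at this
    convert this using 1; ring
  · rw [hgo x hx, hgo y hy]
    obtain ⟨h1, h2⟩ := (star_adj_old hx hy).1 hxy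
    exact old x y h1 h2

/-- The vertices of `K` are connected in its graph. -/
def IsConn (K : SimplicialComplex ℝ Plane) : Prop :=
  (∃ x, x ∈ K.vertices) ∧ ∀ x ∈ K.vertices, ∀ y ∈ K.vertices, (graph K).Reachable x y

lemma star_vertices {x : Plane} (hx : x ∈ (star K s₀ v h₀ hc hv).vertices) :
    x = v ∨ x ∈ K.vertices := by
  classical
  rcases hx with ⟨hx, -⟩ | ⟨r, -, -, e⟩
  · exact Or.inr hx
  · have : v ∈ ({x} : Finset Plane) := by rw [e]; simp
    exact Or.inl (Finset.mem_singleton.1 this).symm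

lemma star_isConn (hK : IsConn K) : IsConn (star K s₀ v h₀ hc hv) := by
  classical
  have hadj : ∀ a ∈ s₀, (graph (star K s₀ v h₀ hc hv)).Adj v a := fun a ha =>
    star_adj_new.2 (by rwa [Finset.insert_eq_self.2 ha])
  have hvm : ∀ {m}, m ∈ K.faces → v ∉ m := not_mem_of_mem_openHull h₀ hc hv
  have step : ∀ {x y}, (graph K).Adj x y → (graph (star K s₀ v h₀ hc hv)).Reachable x y := by
    intro x y h
    have hf := (graph_adj_iff.1 h).2
    have hxv : x ≠ v := fun e => hvm hf (by simp [e])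
    have hyv : y ≠ v := fun e => hvm hf (by simp [e])
    by_cases hs : s₀ = {x, y}
    · exact (hadj x (by simp [hs])).symm.reachable.trans (hadj y (by simp [hs])).reachable
    · exact ((star_adj_old hxv hyv).2 ⟨h, hs⟩).reachable
  have walk : ∀ {x y}, (graph K).Reachable x y → (graph (star K s₀ v h₀ hc hv)).Reachable x y := by
    rintro x y ⟨w⟩
    induction w with
    | nil => exact SimpleGraph.Reachable.refl _
    | cons h _ ih => exact (step h).trans ih
  obtain ⟨a₀, ha₀⟩ := K.nonempty_of_mem_faces h₀
  have ha₀v : a₀ ∈ K.vertices := K.down_closed h₀ (by simpa using ha₀) (by simp)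
  have key : ∀ x ∈ (star K s₀ v h₀ hc hv).vertices,
      (graph (star K s₀ v h₀ hc hv)).Reachable x a₀ := by
    intro x hx
    rcases star_vertices hx with rfl | hx
    · exact (hadj a₀ ha₀).reachable
    · exact walk (hK.2 x hx a₀ ha₀v)
  exact ⟨⟨v, star_vertex (h₀ := h₀) (hc := hc) (hv := hv)⟩, fun x hx y hy => (key x hx).trans (key y hy).symm⟩

end Star

/-! ### The properties preserved by starring -/

/-- The properties of the triangulations of a square from which everything else follows. -/
structure Good (c : Plane) (r : ℝ) (K : SimplicialComplex ℝ Plane) : Prop where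
  finite : K.faces.Finite
  space : K.space = square c r
  pure : IsPure K
  conn : IsConn K
  potential : HasPotential K

lemma Good.starAt {c : Plane} {r : ℝ} {K : SimplicialComplex ℝ Plane} (hK : Good c r K)
    {s₀ : Finset Plane} {v : Plane} (h₀ : s₀ ∈ K.faces) (hc : 2 ≤ s₀.card) (hv : v ∈ openHull s₀) :
    Good c r (star K s₀ v h₀ hc hv) :=
  ⟨star_finite hK.finite, star_isSubdivision.1.trans hK.space, star_isPure hK.pure,
    star_isConn hK.conn, star_hasPotential hK.potential⟩

end DiscretePlane

namespace DiscretePlane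

open Geometry

/-! ### Affine functions and cutting -/

lemma IsCoord.map_eq {s : Finset Plane} {x : Plane} {w : Plane → ℝ} (h : IsCoord s x w)
    (f : Plane →ᵃ[ℝ] ℝ) : f x = ∑ y ∈ s, w y * f y := by
  have hf : ∀ y, f y = f.linear y + f 0 := fun y => by
    rw [f.decomp]; simp
  have h1 : ∑ y ∈ s, w y * f y = f.linear (∑ y ∈ s, w y • y) + (∑ y ∈ s, w y) * f 0 := by
    rw [map_sum, Finset.sum_mul, ← Finset.sum_add_distrib]
    exact Finset.sum_congr rfl fun y _ => by rw [hf y, map_smul, smul_eq_mul]; ring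
  rw [h1, h.2.2.1, h.2.2.2, hf x, one_mul]

/-- The affine function with the given coefficients. -/
noncomputable def planeAff (α β γ : ℝ) : Plane →ᵃ[ℝ] ℝ :=
  (α • (EuclideanSpace.proj 0 : Plane →L[ℝ] ℝ).toLinearMap +
    β • (EuclideanSpace.proj 1 : Plane →L[ℝ] ℝ).toLinearMap).toAffineMap +
    AffineMap.const ℝ Plane γ

@[simp] lemma planeAff_apply (α β γ : ℝ) (z : Plane) :
    planeAff α β γ z = α * z 0 + β * z 1 + γ := by
  simp [planeAff]

/-- The set `s` is on one side of the line `f = 0`. -/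
def OneSided (f : Plane →ᵃ[ℝ] ℝ) (s : Finset Plane) : Prop :=
  (∀ x ∈ s, 0 ≤ f x) ∨ (∀ x ∈ s, f x ≤ 0)

lemma nonneg_of_mem_convexHull {f : Plane →ᵃ[ℝ] ℝ} {s : Finset Plane} (hs : ∀ x ∈ s, 0 ≤ f x)
    {x : Plane} (hx : x ∈ convexHull ℝ (s : Set Plane)) : 0 ≤ f x := by
  obtain ⟨w, hw⟩ := mem_convexHull_iff_exists_isCoord.1 hx
  rw [hw.map_eq f]
  exact Finset.sum_nonneg fun y hy => mul_nonneg (hw.1 y) (hs y hy)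

lemma nonpos_of_mem_convexHull {f : Plane →ᵃ[ℝ] ℝ} {s : Finset Plane} (hs : ∀ x ∈ s, f x ≤ 0)
    {x : Plane} (hx : x ∈ convexHull ℝ (s : Set Plane)) : f x ≤ 0 := by
  obtain ⟨w, hw⟩ := mem_convexHull_iff_exists_isCoord.1 hx
  rw [hw.map_eq f]
  exact Finset.sum_nonpos fun y hy => mul_nonpos_of_nonneg_of_nonpos (hw.1 y) (hs y hy)

lemma OneSided.of_convexHull_subset {f : Plane →ᵃ[ℝ] ℝ} {s t : Finset Plane} (ht : OneSided f t)
    (hst : convexHull ℝ (s : Set Plane) ⊆ convexHull ℝ (t : Set Plane)) : OneSided f s := by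
  have hs := (subset_convexHull ℝ (s : Set Plane)).trans hst
  rcases ht with h | h
  · exact Or.inl fun x hx => nonneg_of_mem_convexHull h (hs hx)
  · exact Or.inr fun x hx => nonpos_of_mem_convexHull h (hs hx)

/-- A sum of terms of one sign vanishes only if each term does, and on the open simplex all weights
are positive. -/
lemma OneSided.eq_zero {f : Plane →ᵃ[ℝ] ℝ} {s : Finset Plane} (h : OneSided f s) {x : Plane}
    (hx : x ∈ openHull s) (hfx : f x = 0) : ∀ y ∈ s, f y = 0 := by
  obtain ⟨w, hw, hpos⟩ := hx
  rw [hw.map_eq f] at hfx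
  intro y hy
  rcases h with h | h
  · have := (Finset.sum_eq_zero_iff_of_nonneg fun y hy => mul_nonneg (hw.1 y) (h y hy)).1 hfx y hy
    exact (mul_eq_zero.1 this).resolve_left (hpos y hy).ne'
  · have := (Finset.sum_eq_zero_iff_of_nonpos fun y hy =>
      mul_nonpos_of_nonneg_of_nonpos (hw.1 y) (h y hy)).1 hfx y hy
    exact (mul_eq_zero.1 this).resolve_left (hpos y hy).ne'

lemma OneSided.nonneg {f : Plane →ᵃ[ℝ] ℝ} {s : Finset Plane} (h : OneSided f s) {x : Plane}
    (hx : x ∈ openHull s) (hfx : 0 ≤ f x) : ∀ y ∈ s, 0 ≤ f y := by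
  by_cases h0 : f x = 0
  · exact fun y hy => (h.eq_zero hx h0 y hy).ge
  · rcases h with h | h
    · exact h
    · exact absurd (le_antisymm (nonpos_of_mem_convexHull h (openHull_subset _ hx)) hfx) h0

/-- The edges of `K` that are properly crossed by the line `f = 0`. -/
def crossed (K : SimplicialComplex ℝ Plane) (f : Plane →ᵃ[ℝ] ℝ) : Set (Plane × Plane) :=
  {p | (graph K).Adj p.1 p.2 ∧ f p.1 < 0 ∧ 0 < f p.2}

lemma adj_finite {K : SimplicialComplex ℝ Plane} (hK : K.faces.Finite) :
    {p : Plane × Plane | (graph K).Adj p.1 p.2}.Finite := by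
  have : (⋃ s ∈ K.faces, (s : Set Plane) ×ˢ (s : Set Plane)).Finite :=
    hK.biUnion fun s _ => s.finite_toSet.prod s.finite_toSet
  refine this.subset ?_
  rintro ⟨x, y⟩ ⟨-, s, hs, hx, hy⟩
  exact Set.mem_biUnion hs ⟨hx, hy⟩

lemma exists_zero_mem_openHull {f : Plane →ᵃ[ℝ] ℝ} {a b : Plane} (ha : f a < 0) (hb : 0 < f b) :
    ∃ v ∈ openHull {a, b}, f v = 0 := by
  have hab : a ≠ b := by rintro rfl; linarith
  have hd : 0 < f b - f a := by linarith
  refine ⟨(f b / (f b - f a)) • a + (-f a / (f b - f a)) • b,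
    mem_openHull_pair hab (div_pos hb hd) (div_pos (by linarith) hd) ?_ rfl, ?_⟩
  · field_simp; ring
  · have hx := mem_openHull_pair hab (div_pos hb hd) (div_pos (by linarith : 0 < -f a) hd)
      (by field_simp; ring) rfl
    have h1 : f b / (f b - f a) + -f a / (f b - f a) = 1 := by field_simp; ring
    have e : (f b / (f b - f a)) • a + (-f a / (f b - f a)) • b =
        AffineMap.lineMap a b (-f a / (f b - f a)) := by
      rw [AffineMap.lineMap_apply_module, ← h1]; simp
    rw [e, AffineMap.apply_lineMap, AffineMap.lineMap_apply_module]
    simp only [smul_eq_mul]; field_simp; ring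

/-- A crossed edge is starred at its zero of `f`. Edges at the new vertex are not crossed, as `f`
vanishes there, and the starred edge disappears; so the number of crossed edges drops. A face with
no crossed edge is on one side. -/
theorem Good.exists_oneSided {c : Plane} {r : ℝ} (f : Plane →ᵃ[ℝ] ℝ) (n : ℕ) :
    ∀ {K : SimplicialComplex ℝ Plane}, Good c r K → (crossed K f).ncard = n →
    ∃ K', Good c r K' ∧ IsSubdivision K' K ∧ ∀ s ∈ K'.faces, OneSided f s := by
  classical
  induction n using Nat.strong_induction_on with
  | _ n ih =>
  intro K hK hn
  have hfin : (crossed K f).Finite := (adj_finite hK.finite).subset fun p hp => hp.1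
  by_cases hne : (crossed K f).Nonempty
  · obtain ⟨⟨a, b⟩, hab, ha, hb⟩ := hne
    obtain ⟨v, hv, hfv⟩ := exists_zero_mem_openHull ha hb
    have h₀ := (graph_adj_iff.1 hab).2
    have hc : 2 ≤ ({a, b} : Finset Plane).card := by rw [Finset.card_pair hab.1]
    have hlt : (crossed (star K {a, b} v h₀ hc hv) f).ncard < n := by
      rw [← hn]
      refine Set.ncard_lt_ncard ⟨?_, fun h => ?_⟩ hfin
      · rintro ⟨x, y⟩ ⟨h, hx, hy⟩
        have hxv : x ≠ v := by rintro rfl; simp [hfv] at hx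
        have hyv : y ≠ v := by rintro rfl; simp [hfv] at hy
        exact ⟨((star_adj_old hxv hyv).1 h).1, hx, hy⟩
      · have hmem : (a, b) ∈ crossed K f := ⟨hab, ha, hb⟩
        obtain ⟨h1, -, -⟩ := h hmem
        have hav : a ≠ v := by rintro rfl; simp [hfv] at ha
        have hbv : b ≠ v := by rintro rfl; simp [hfv] at hb
        exact ((star_adj_old hav hbv).1 h1).2 rfl
    obtain ⟨K', h1, h2, h3⟩ := ih _ hlt (hK.starAt h₀ hc hv) rfl
    exact ⟨K', h1, h2.trans star_isSubdivision, h3⟩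
  · refine ⟨K, hK, IsSubdivision.refl K, fun s hs => ?_⟩
    by_contra hcon
    simp only [OneSided, not_or, not_forall, not_le] at hcon
    obtain ⟨⟨x, hx, hfx⟩, y, hy, hfy⟩ := hcon
    exact hne ⟨(x, y), ⟨fun e => by simp only at e; rw [e] at hfx; linarith, s, hs, hx, hy⟩,
      hfx, hfy⟩

/-- The lines are treated one after the other; earlier cuts persist because one-sidedness passes to
the faces of a subdivision. -/
theorem Good.exists_oneSided_of_finite {c : Plane} {r : ℝ} {K : SimplicialComplex ℝ Plane}
    (hK : Good c r K) {F : Set (Plane →ᵃ[ℝ] ℝ)} (hF : F.Finite) :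
    ∃ K', Good c r K' ∧ IsSubdivision K' K ∧ ∀ f ∈ F, ∀ s ∈ K'.faces, OneSided f s := by
  induction F, hF using Set.Finite.induction_on with
  | empty => exact ⟨K, hK, IsSubdivision.refl K, by simp⟩
  | @insert f F hf hF ih =>
    obtain ⟨K₁, h1, h2, h3⟩ := ih
    obtain ⟨K₂, g1, g2, g3⟩ := h1.exists_oneSided f _ rfl
    refine ⟨K₂, g1, g2.trans h2, fun g hg s hs => ?_⟩
    rcases Set.mem_insert_iff.1 hg with rfl | hg
    · exact g3 s hs
    · obtain ⟨t, ht, hst⟩ := g2.2 s hs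
      exact (h3 g hg t ht).of_convexHull_subset hst

/-! ### The initial triangulation of a square -/

lemma mem_convexHull_triple {a b c x : Plane} {α β γ : ℝ} (hα : 0 ≤ α) (hβ : 0 ≤ β) (hγ : 0 ≤ γ)
    (h1 : α + β + γ = 1) (hx : α • a + β • b + γ • c = x) :
    x ∈ convexHull ℝ (({a, b, c} : Finset Plane) : Set Plane) := by
  refine mem_convexHull_of_exists_fintype (ι := Fin 3) ![α, β, γ] ![a, b, c] ?_ ?_ ?_ ?_
  · intro i; fin_cases i <;> assumption
  · simp [Fin.sum_univ_three, h1]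
  · intro i; fin_cases i <;> simp
  · simp [Fin.sum_univ_three, hx]

lemma affineIndependent_triple {p a b : Plane} (h : cross (a - p) (b - p) ≠ 0) :
    AffineIndependent ℝ ((↑) : ({p, a, b} : Finset Plane) → Plane) := by
  classical
  have hpa : p ≠ a := by rintro rfl; simp [cross] at h
  have hpb : p ≠ b := by rintro rfl; simp [cross] at h
  have hab : a ≠ b := by rintro rfl; simp [cross, mul_comm] at h
  have hli : AffineIndependent ℝ ![p, a, b] := by
    rw [affineIndependent_iff]
    intro s w h1 h2
    suffices H : ∀ w : Fin 3 → ℝ, w 0 + w 1 + w 2 = 0 → w 0 • p + w 1 • a + w 2 • b = 0 →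
        ∀ i, w i = 0 by
      intro e he
      have := H (fun i => if i ∈ s then w i else 0) ?_ ?_ e
      · simpa [he] using this
      · have e1 : ∑ i : Fin 3, (if i ∈ s then w i else 0) = 0 := by simpa using h1
        rwa [Fin.sum_univ_three] at e1
      · have e1 : ∑ i : Fin 3, (if i ∈ s then w i else 0) • ![p, a, b] i = 0 := by
          simpa [ite_smul] using h2
        rwa [Fin.sum_univ_three] at e1
    intro w h1 h2
    have k0 := congrFun (congrArg WithLp.ofLp h2) 0
    have k1 := congrFun (congrArg WithLp.ofLp h2) 1
    simp at k0 k1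
    have e0 : w 0 = - w 1 - w 2 := by linarith
    rw [e0] at k0 k1
    simp only [cross, PiLp.sub_apply] at h
    have m1 : w 1 * ((a 0 - p 0) * (b 1 - p 1) - (a 1 - p 1) * (b 0 - p 0)) = 0 := by
      linear_combination (b 1 - p 1) * k0 - (b 0 - p 0) * k1
    have m2 : w 2 * ((a 0 - p 0) * (b 1 - p 1) - (a 1 - p 1) * (b 0 - p 0)) = 0 := by
      linear_combination -(a 1 - p 1) * k0 + (a 0 - p 0) * k1
    have w1 := (mul_eq_zero.1 m1).resolve_right h
    have w2 := (mul_eq_zero.1 m2).resolve_right h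
    intro i; fin_cases i
    · simp [e0, w1, w2]
    · exact w1
    · exact w2
  have := hli.range
  have hr : Set.range ![p, a, b] = ((({p, a, b} : Finset Plane)) : Set Plane) := by
    ext x; simp [eq_comm]; tauto
  rw [hr] at this
  exact this

lemma convex_square (c : Plane) (r : ℝ) : Convex ℝ (square c r) := by
  have h : square c r = {z | c 0 - r ≤ z 0} ∩ {z | z 0 ≤ c 0 + r} ∩
      ({z | c 1 - r ≤ z 1} ∩ {z | z 1 ≤ c 1 + r}) := by
    ext z; simp only [square, abs_le, Set.mem_ofPred_eq, Set.mem_inter_iff]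
    constructor
    · rintro ⟨⟨h1, h2⟩, h3, h4⟩; exact ⟨⟨by linarith, by linarith⟩, by linarith, by linarith⟩
    · rintro ⟨⟨h1, h2⟩, h3, h4⟩; exact ⟨⟨by linarith, by linarith⟩, by linarith, by linarith⟩
  have hl : ∀ i : Fin 2, IsLinearMap ℝ fun z : Plane => z i := fun i =>
    ⟨fun x y => rfl, fun a x => rfl⟩
  rw [h]
  exact ((convex_halfSpace_ge (hl 0) _).inter (convex_halfSpace_le (hl 0) _)).inter
    ((convex_halfSpace_ge (hl 1) _).inter (convex_halfSpace_le (hl 1) _))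

theorem exists_good (c : Plane) {r : ℝ} (hr : 0 < r) :
    ∃ K : SimplicialComplex ℝ Plane, Good c r K := by
  classical
  let a : Plane := !₂[c 0 - r, c 1 - r]
  let b : Plane := !₂[c 0 + r, c 1 - r]
  let d : Plane := !₂[c 0 + r, c 1 + r]
  let e : Plane := !₂[c 0 - r, c 1 + r]
  have a0 : a 0 = c 0 - r := rfl
  have a1 : a 1 = c 1 - r := rfl
  have b0 : b 0 = c 0 + r := rfl
  have b1 : b 1 = c 1 - r := rfl
  have d0 : d 0 = c 0 + r := rfl
  have d1 : d 1 = c 1 + r := rfl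
  have e0 : e 0 = c 0 - r := rfl
  have e1 : e 1 = c 1 + r := rfl
  clear_value a b d e
  have hab : a ≠ b := fun h => by have := congrArg (fun z : Plane => z 0) h; simp only at this; linarith
  have had : a ≠ d := fun h => by have := congrArg (fun z : Plane => z 0) h; simp only at this; linarith
  have hae : a ≠ e := fun h => by have := congrArg (fun z : Plane => z 1) h; simp only at this; linarith
  have hbd : b ≠ d := fun h => by have := congrArg (fun z : Plane => z 1) h; simp only at this; linarith
  have hbe : b ≠ e := fun h => by have := congrArg (fun z : Plane => z 0) h; simp only at this; linarith
  have hde : d ≠ e := fun h => by have := congrArg (fun z : Plane => z 0) h; simp only at this; linarith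
  have i1 : AffineIndependent ℝ ((↑) : ({a, b, d} : Finset Plane) → Plane) := by
    apply affineIndependent_triple
    simp only [cross, PiLp.sub_apply, a0, a1, b0, b1, d0, d1]
    have : 0 < r * r := mul_pos hr hr
    intro h; nlinarith
  have i2 : AffineIndependent ℝ ((↑) : ({a, d, e} : Finset Plane) → Plane) := by
    apply affineIndependent_triple
    simp only [cross, PiLp.sub_apply, a0, a1, e0, e1, d0, d1]
    have : 0 < r * r := mul_pos hr hr
    intro h; nlinarith
  have same : ∀ {m s t : Finset Plane}, AffineIndependent ℝ ((↑) : m → Plane) → s ⊆ m → t ⊆ m →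
      ∀ x w w', IsCoord s x w → IsCoord t x w' →
      x ∈ convexHull ℝ ((s : Set Plane) ∩ (t : Set Plane)) := by
    intro m s t hm hs ht x w w' hw hw'
    have ew := (hw.mono hs).unique_of_indep hm (hw'.mono ht)
    rw [← Finset.coe_inter]
    refine (hw.of_support fun y hy => ?_).mem
    by_cases hys : y ∈ s
    · rw [ew]; exact hw'.2.1 y fun h => hy (Finset.mem_inter.2 ⟨hys, h⟩)
    · exact hw.2.1 y hys
  -- The diagonal `a d` is the zero line of `f`, with `b` and `e` on different sides. A common point
  -- of faces of the two triangles therefore has weight zero at `b` and at `e`, and both faces can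
  -- be compared inside the first triangle.
  let f : Plane →ᵃ[ℝ] ℝ := planeAff 1 (-1) (c 1 - c 0)
  have fa : f a = 0 := by simp [f, a0, a1]
  have fb : f b = 2 * r := by simp [f, b0, b1]; ring
  have fd : f d = 0 := by simp [f, d0, d1]; ring
  have fe : f e = -(2 * r) := by simp [f, e0, e1]; ring
  have mixed : ∀ {s t : Finset Plane}, s ⊆ {a, b, d} → t ⊆ {a, d, e} →
      ∀ x w w', IsCoord s x w → IsCoord t x w' →
      x ∈ convexHull ℝ ((s : Set Plane) ∩ (t : Set Plane)) := by
    intro s t hs ht x w w' hw hw'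
    have v1 := (hw.mono hs).map_eq f
    have v2 := (hw'.mono ht).map_eq f
    rw [Finset.sum_insert (by simp [hab, had]), Finset.sum_pair hbd, fa, fb, fd] at v1
    rw [Finset.sum_insert (by simp [had, hae]), Finset.sum_pair hde, fa, fd, fe] at v2
    have n1 := hw.1 b
    have n2 := hw'.1 e
    have wb : w b = 0 := by nlinarith
    have we : w' e = 0 := by nlinarith
    have hs' : IsCoord (s.erase b) x w := hw.of_support fun y hy => by
      by_cases hyb : y = b
      · rw [hyb, wb]
      · exact hw.2.1 y fun h => hy (Finset.mem_erase.2 ⟨hyb, h⟩)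
    have ht' : IsCoord (t.erase e) x w' := hw'.of_support fun y hy => by
      by_cases hye : y = e
      · rw [hye, we]
      · exact hw'.2.1 y fun h => hy (Finset.mem_erase.2 ⟨hye, h⟩)
    have := same i1 ((Finset.erase_subset _ _).trans hs)
      (show t.erase e ⊆ {a, b, d} from fun y hy => by
        have h1 := ht (Finset.mem_of_mem_erase hy)
        have h2 := Finset.ne_of_mem_erase hy
        simp only [Finset.mem_insert, Finset.mem_singleton] at h1 ⊢
        tauto) x w w' hs' ht'
    refine convexHull_mono (Set.inter_subset_inter ?_ ?_) this <;>
      exact Finset.coe_subset.2 (Finset.erase_subset _ _)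
  let K : SimplicialComplex ℝ Plane := SimplicialComplex.ofErase
    {s | s ⊆ {a, b, d} ∨ s ⊆ {a, d, e}}
    (by
      rintro s (hs | hs)
      · exact i1.mono hs
      · exact i2.mono hs)
    (by
      rintro s t hts (hs | hs)
      · exact Or.inl (hts.trans hs)
      · exact Or.inr (hts.trans hs))
    (by
      rintro s hs t ht x ⟨hx, hx'⟩
      obtain ⟨w, hw⟩ := mem_convexHull_iff_exists_isCoord.1 hx
      obtain ⟨w', hw'⟩ := mem_convexHull_iff_exists_isCoord.1 hx'
      rcases hs with hs | hs <;> rcases ht with ht | ht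
      · exact same i1 hs ht x w w' hw hw'
      · exact mixed hs ht x w w' hw hw'
      · rw [Set.inter_comm]; exact mixed ht hs x w' w hw' hw
      · exact same i2 hs ht x w w' hw hw')
  have hKf : ∀ s, s ∈ K.faces ↔ (s ⊆ {a, b, d} ∨ s ⊆ {a, d, e}) ∧ s ≠ ∅ := fun s => Iff.rfl
  have c1 : {a, b, d} ∈ cells K := ⟨(hKf _).2 ⟨Or.inl le_rfl, by simp⟩,
    card_triple hab had.symm hbd.symm⟩
  have c2 : {a, d, e} ∈ cells K := ⟨(hKf _).2 ⟨Or.inr le_rfl, by simp⟩,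
    card_triple had hae.symm hde.symm⟩
  have hadj : ∀ x y, (graph K).Adj x y → x ≠ y ∧
      ((x = a ∨ x = b ∨ x = d) ∧ (y = a ∨ y = b ∨ y = d) ∨
      (x = a ∨ x = d ∨ x = e) ∧ (y = a ∨ y = d ∨ y = e)) := by
    rintro x y ⟨hne, s, ⟨hs | hs, -⟩, hx, hy⟩
    · exact ⟨hne, Or.inl ⟨by simpa using hs hx, by simpa using hs hy⟩⟩
    · exact ⟨hne, Or.inr ⟨by simpa using hs hx, by simpa using hs hy⟩⟩
  have hreach : ∀ x ∈ K.vertices, (graph K).Reachable x a := by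
    intro x hx
    by_cases hxa : x = a
    · rw [hxa]
    refine SimpleGraph.Adj.reachable ⟨hxa, ?_⟩
    rcases ((hKf _).1 hx).1 with h | h
    · exact ⟨_, c1.1, by simpa using h, by simp⟩
    · exact ⟨_, c2.1, by simpa using h, by simp⟩
  refine ⟨K, ?_, ?_, ?_, ⟨⟨a, (hKf _).2 ⟨Or.inl (by simp), by simp⟩⟩, fun x hx y hy =>
    (hreach x hx).trans (hreach y hy).symm⟩, ?_⟩
  · refine ((Finset.powerset {a, b, d}).finite_toSet.union
      (Finset.powerset {a, d, e}).finite_toSet).subset ?_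
    rintro s ⟨hs | hs, -⟩
    · exact Or.inl (Finset.mem_coe.2 (Finset.mem_powerset.2 hs))
    · exact Or.inr (Finset.mem_coe.2 (Finset.mem_powerset.2 hs))
  · have hsq : ∀ {z : Plane}, (z = a ∨ z = b ∨ z = d ∨ z = e) → z ∈ square c r := by
      rintro z (rfl | rfl | rfl | rfl) <;> simp [square, a0, a1, b0, b1, d0, d1, e0, e1, abs_of_pos hr]
    ext z
    rw [SimplicialComplex.mem_space_iff]
    constructor
    · rintro ⟨s, ⟨hs, -⟩, hz⟩
      refine convexHull_min ?_ (convex_square c r) hz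
      intro y hy
      rcases hs with hs | hs
      · have : y = a ∨ y = b ∨ y = d := by simpa using hs hy
        exact hsq (by tauto)
      · have : y = a ∨ y = d ∨ y = e := by simpa using hs hy
        exact hsq (by tauto)
    · rintro ⟨h0, h1⟩
      rw [abs_le] at h0 h1
      -- In the coordinates `p, q ∈ [0, 1]` of the square the two triangles are `q ≤ p` and `p ≤ q`.
      set p := (z 0 - c 0 + r) / (2 * r) with hp
      set q := (z 1 - c 1 + r) / (2 * r) with hq
      have hp0 : 0 ≤ p := div_nonneg (by linarith) (by linarith)
      have hq0 : 0 ≤ q := div_nonneg (by linarith) (by linarith)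
      have hp1 : p ≤ 1 := by rw [hp, div_le_one (by linarith)]; linarith
      have hq1 : q ≤ 1 := by rw [hq, div_le_one (by linarith)]; linarith
      have zp : z 0 = c 0 - r + 2 * r * p := by rw [hp]; field_simp; ring
      have zq : z 1 = c 1 - r + 2 * r * q := by rw [hq]; field_simp; ring
      rcases le_total q p with hqp | hqp
      · refine ⟨_, c1.1, mem_convexHull_triple (α := 1 - p) (β := p - q) (γ := q) (by linarith)
          (by linarith) hq0 (by ring) ?_⟩
        apply coord_ext
        · simp [a0, b0, d0, zp]; ring
        · simp [a1, b1, d1, zq]; ring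
      · refine ⟨_, c2.1, mem_convexHull_triple (α := 1 - q) (β := p) (γ := q - p) (by linarith)
          hp0 (by linarith) (by ring) ?_⟩
        apply coord_ext
        · simp [a0, e0, d0, zp]; ring
        · simp [a1, e1, d1, zq]; ring
  · rintro s ⟨hs | hs, -⟩
    · exact ⟨_, c1, hs⟩
    · exact ⟨_, c2, hs⟩
  -- All other corners are joined to `a` by an edge; this edge is the potential.
  · let g : Plane → Chain := fun y => if y = a then 0 else edgeChain a y
    have ga : g a = 0 := if_pos rfl
    have gb : g b = edgeChain a b := if_neg hab.symm
    have gd : g d = edgeChain a d := if_neg had.symm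
    have ge : g e = edgeChain a e := if_neg hae.symm
    have dbl : ∀ x : Chain, x + x = 0 := fun x => by linear_combination x * chain_two
    have t1 := triple_mem_boundaries c1
    have t2 := triple_mem_boundaries c2
    rw [edgeChain_comm d a] at t1
    rw [edgeChain_comm e a] at t2
    have t1' : edgeChain b d + edgeChain a b + edgeChain a d ∈ boundaries K := by
      convert t1 using 1; ring
    have t2' : edgeChain d e + edgeChain a d + edgeChain a e ∈ boundaries K := by
      convert t2 using 1; ring
    have t1'' : edgeChain b d + edgeChain a d + edgeChain a b ∈ boundaries K := by
      convert t1 using 1; ring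
    have t2'' : edgeChain d e + edgeChain a e + edgeChain a d ∈ boundaries K := by
      convert t2 using 1; ring
    have z := Submodule.zero_mem (boundaries K)
    refine ⟨g, fun x y hxy => ?_⟩
    obtain ⟨hne, ⟨rfl | rfl | rfl, rfl | rfl | rfl⟩ | ⟨rfl | rfl | rfl, rfl | rfl | rfl⟩⟩ :=
      hadj x y hxy <;>
    first
      | exact absurd rfl hne
      | (simp only [ga, gb, gd, ge, add_zero, dbl]; first | exact z | assumption)
      | (rw [edgeChain_comm x y]; simp only [ga, gb, gd, ge, dbl]
         first | exact z | assumption)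

end DiscretePlane

namespace DiscretePlane

open Geometry

/-! ### Fine triangulations and common subdivisions -/

theorem exists_mesh (c : Plane) {r : ℝ} (hr : 0 < r) {ε : ℝ} (hε : 0 < ε) :
    ∃ K : SimplicialComplex ℝ Plane, Good c r K ∧ HasMeshLE K ε := by
  -- Cells of a grid of width `δ` have diameter at most `√2 * δ ≤ ε`; more than `2 * r / δ` lines in
  -- each direction exhaust the square.
  set δ := ε / 2 with hδ
  have hδ0 : 0 < δ := by positivity
  obtain ⟨N, hN⟩ := exists_nat_gt (2 * r / δ)
  let F : Set (Plane →ᵃ[ℝ] ℝ) :=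
    (fun k : ℕ => planeAff 1 0 (-(c 0 - r + k * δ))) '' Set.Iic N ∪
    (fun k : ℕ => planeAff 0 1 (-(c 1 - r + k * δ))) '' Set.Iic N
  have hF : F.Finite := ((Set.finite_Iic N).image _).union ((Set.finite_Iic N).image _)
  obtain ⟨K₀, hK₀⟩ := exists_good c hr
  obtain ⟨K, hK, -, hs⟩ := hK₀.exists_oneSided_of_finite hF
  refine ⟨K, hK, fun s hsK x hx y hy => ?_⟩
  have key : ∀ i : Fin 2, (∀ k ≤ N, ∃ f ∈ F, ∀ z : Plane, f z = z i - (c i - r + k * δ)) →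
      ∀ x ∈ convexHull ℝ (s : Set Plane), ∀ y ∈ convexHull ℝ (s : Set Plane),
      x i - y i ≤ δ := by
    intro i hi x hx y hy
    have hsq : ∀ z ∈ convexHull ℝ (s : Set Plane), |z i - c i| ≤ r := by
      intro z hz
      have := SimplicialComplex.convexHull_subset_space hsK hz
      rw [hK.space] at this
      fin_cases i
      · exact this.1
      · exact this.2
    have hx' := abs_le.1 (hsq x hx)
    have hy' := abs_le.1 (hsq y hy)
    by_contra hcon
    rw [not_le] at hcon
    -- This is the first grid line strictly beyond `y`. It is at distance at most `δ` from `y`, so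
    -- it would strictly separate `y` from `x`.
    set k := ⌊(y i - (c i - r)) / δ⌋₊ + 1 with hk
    have hnn : 0 ≤ (y i - (c i - r)) / δ := div_nonneg (by linarith) hδ0.le
    have k1 : (y i - (c i - r)) / δ < k := by rw [hk]; push_cast; exact Nat.lt_floor_add_one _
    have k2 : (k : ℝ) ≤ (y i - (c i - r)) / δ + 1 := by
      rw [hk]; push_cast; linarith [Nat.floor_le hnn]
    rw [div_lt_iff₀ hδ0] at k1
    have k3 : (k : ℝ) * δ ≤ (y i - (c i - r)) + δ := by
      have := mul_le_mul_of_nonneg_right k2 hδ0.le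
      rwa [add_mul, div_mul_cancel₀ _ hδ0.ne', one_mul] at this
    have hkN : k ≤ N := by
      have : (k : ℝ) < N := by
        refine lt_of_le_of_lt ?_ hN
        rw [le_div_iff₀ hδ0]; linarith
      exact_mod_cast this.le
    obtain ⟨f, hf, hfz⟩ := hi k hkN
    rcases hs f hf s hsK with h | h
    · have := nonneg_of_mem_convexHull h hy
      rw [hfz] at this; linarith
    · have := nonpos_of_mem_convexHull h hx
      rw [hfz] at this; linarith
  have k0 := key 0 fun k hk => ⟨_, Or.inl ⟨k, hk, rfl⟩, fun z => by simp; ring⟩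
  have k1 := key 1 fun k hk => ⟨_, Or.inr ⟨k, hk, rfl⟩, fun z => by simp; ring⟩
  have h0 := k0 x hx y hy
  have h0' := k0 y hy x hx
  have h1 := k1 x hx y hy
  have h1' := k1 y hy x hx
  rw [EuclideanSpace.dist_eq, Fin.sum_univ_two, Real.dist_eq, Real.dist_eq, sq_abs, sq_abs]
  apply Real.sqrt_le_iff.2
  refine ⟨hε.le, ?_⟩
  have e0 : (x 0 - y 0) ^ 2 ≤ δ ^ 2 := by rw [sq_le_sq, abs_of_pos hδ0, abs_le]; constructor <;> linarith
  have e1 : (x 1 - y 1) ^ 2 ≤ δ ^ 2 := by rw [sq_le_sq, abs_of_pos hδ0, abs_le]; constructor <;> linarith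
  rw [hδ] at e0 e1
  nlinarith

/-- A simplex is cut out of the plane by finitely many affine functions. -/
lemma exists_affine_functions {t : Finset Plane} (ht : AffineIndependent ℝ ((↑) : t → Plane)) :
    ∃ F : Set (Plane →ᵃ[ℝ] ℝ), F.Finite ∧ ∀ s : Finset Plane, (∀ f ∈ F, OneSided f s) →
      ∀ x ∈ openHull s, x ∈ convexHull ℝ (t : Set Plane) →
      convexHull ℝ (s : Set Plane) ⊆ convexHull ℝ (t : Set Plane) := by
  classical
  -- Complete `t` to an affine basis. The hull of `t` consists of the points with nonnegative
  -- coordinates whose coordinates at basis points outside `t` vanish.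
  obtain ⟨B, htB, hB, hBtop⟩ := exists_subset_affineIndependent_affineSpan_eq_top
    (k := ℝ) (s := (t : Set Plane)) ht
  let b : AffineBasis B ℝ Plane := ⟨((↑) : B → Plane), hB, by simpa using hBtop⟩
  have hBfin : B.Finite := b.finite_set
  have := hBfin.fintype
  have hb : ∀ i : B, b i = i := fun i => rfl
  refine ⟨Set.range b.coord, Set.finite_range _, fun s hs x hx hxt => ?_⟩
  refine convexHull_min (fun q hq => ?_) (convex_convexHull ℝ _)
  obtain ⟨w, hw⟩ := mem_convexHull_iff_exists_isCoord.1 hxt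
  have hcoord : ∀ i : B, 0 ≤ b.coord i x ∧ ((i : Plane) ∉ t → b.coord i x = 0) := by
    intro i
    have hval : ∀ y, ∀ hy : y ∈ t, b.coord i y = if (i : Plane) = y then 1 else 0 := by
      intro y hy
      have := b.coord_apply i ⟨y, htB hy⟩
      rw [hb] at this
      rw [this]
      simp only [Subtype.ext_iff]
    rw [hw.map_eq]
    constructor
    · refine Finset.sum_nonneg fun y hy => mul_nonneg (hw.1 y) ?_
      rw [hval y hy]; split_ifs <;> norm_num
    · intro hi
      refine Finset.sum_eq_zero fun y hy => ?_
      rw [hval y hy, if_neg fun h => hi (by rw [h]; exact hy), mul_zero]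
  -- The inequalities and equations valid at the point `x` of the open simplex of `s` carry over to
  -- every vertex of `s`, since no coordinate changes sign on `s`.
  have hq0 : ∀ i : B, 0 ≤ b.coord i q ∧ ((i : Plane) ∉ t → b.coord i q = 0) := fun i =>
    ⟨(hs _ ⟨i, rfl⟩).nonneg hx (hcoord i).1 q hq,
      fun hi => (hs _ ⟨i, rfl⟩).eq_zero hx ((hcoord i).2 hi) q hq⟩
  let u : Plane → ℝ := fun y => if h : y ∈ B then b.coord ⟨y, h⟩ q else 0
  have hu : ∀ i : B, u i = b.coord i q := fun i => dif_pos i.2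
  have hsum : ∀ {M : Type} [AddCommMonoid M] (f : Plane → M),
      ∑ y ∈ hBfin.toFinset, f y = ∑ i : B, f i := by
    intro M _ f
    rw [← Finset.sum_coe_sort]
    exact Fintype.sum_equiv (Equiv.subtypeEquivRight (by simp)) _ _ fun _ => rfl
  have hc : IsCoord hBfin.toFinset q u := by
    refine ⟨fun y => ?_, fun y hy => ?_, ?_, ?_⟩
    · by_cases h : y ∈ B
      · exact (hq0 ⟨y, h⟩).1.trans_eq (hu ⟨y, h⟩).symm
      · have : u y = 0 := dif_neg h
        exact this.ge
    · exact dif_neg fun h => hy (by simpa using h)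
    · rw [hsum]; simp_rw [hu]; exact b.sum_coord_apply_eq_one q
    · rw [hsum (fun y => u y • y)]
      simp_rw [hu]
      exact b.linear_combination_coord_eq_self q
  refine (hc.of_support fun y hy => ?_).mem
  by_cases h : y ∈ B
  · exact (hu ⟨y, h⟩).trans ((hq0 ⟨y, h⟩).2 hy)
  · exact dif_neg h

lemma exists_openHull_nonempty {s : Finset Plane} (hs : s.Nonempty) : (openHull s).Nonempty := by
  classical
  have hc : (0 : ℝ) < s.card := by exact_mod_cast hs.card_pos
  refine ⟨∑ y ∈ s, (s.card : ℝ)⁻¹ • y, fun y => if y ∈ s then (s.card : ℝ)⁻¹ else 0,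
    ⟨fun y => ?_, fun y hy => if_neg hy, ?_, ?_⟩, fun y hy => ?_⟩
  · dsimp only; split_ifs <;> positivity
  · rw [Finset.sum_ite_mem, Finset.inter_self, Finset.sum_const, nsmul_eq_mul,
      mul_inv_cancel₀ hc.ne']
  · exact Finset.sum_congr rfl fun y hy => by simp only [if_pos hy]
  · simp only [if_pos hy]; positivity

/-- Cutting along suitable finitely many lines gives a subdivision of a given complex. -/
lemma exists_affine_functions_subdivision {L : SimplicialComplex ℝ Plane} (hL : L.faces.Finite) :
    ∃ F : Set (Plane →ᵃ[ℝ] ℝ), F.Finite ∧ ∀ K : SimplicialComplex ℝ Plane, K.space = L.space →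
      (∀ f ∈ F, ∀ s ∈ K.faces, OneSided f s) → IsSubdivision K L := by
  have h : ∀ t : Finset Plane, ∃ F : Set (Plane →ᵃ[ℝ] ℝ), F.Finite ∧ (t ∈ L.faces →
      ∀ s : Finset Plane, (∀ f ∈ F, OneSided f s) →
      ∀ x ∈ openHull s, x ∈ convexHull ℝ (t : Set Plane) →
      convexHull ℝ (s : Set Plane) ⊆ convexHull ℝ (t : Set Plane)) := by
    intro t
    by_cases ht : t ∈ L.faces
    · obtain ⟨F, h1, h2⟩ := exists_affine_functions (L.indep ht)
      exact ⟨F, h1, fun _ => h2⟩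
    · exact ⟨∅, Set.finite_empty, fun h => absurd h ht⟩
  choose F hF hF' using h
  refine ⟨⋃ t ∈ L.faces, F t, hL.biUnion fun t _ => hF t, fun K hsp hs => ⟨hsp, fun s hsK => ?_⟩⟩
  obtain ⟨x, hx⟩ := exists_openHull_nonempty (K.nonempty_of_mem_faces hsK)
  have hxK := SimplicialComplex.convexHull_subset_space hsK (openHull_subset _ hx)
  rw [hsp] at hxK
  obtain ⟨t, ht, hxt⟩ := SimplicialComplex.mem_space_iff.1 hxK
  exact ⟨t, ht, hF' t ht s (fun f hf => hs f (Set.mem_biUnion ht hf) s hsK) x hx hxt⟩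

end DiscretePlane

namespace DiscretePlane

open Geometry

/-! ### Sets of triangles and their boundaries -/

/-- The edges that belong to exactly one of the triangles in `A`. -/
def bd (A : Set (Finset Plane)) : Set (Sym2 Plane) := {e | ∃! t, t ∈ A ∧ e ∈ cellEdges t}

section

variable {K : SimplicialComplex ℝ Plane}

lemma cells_finite (hK : K.faces.Finite) : (cells K).Finite := hK.subset fun _ h => h.1

lemma cell_unique' {e : Sym2 Plane} {t₁ t₂ t₃ : Finset Plane}
    (h₁ : t₁ ∈ cells K) (h₂ : t₂ ∈ cells K) (h₃ : t₃ ∈ cells K) (e₁ : e ∈ cellEdges t₁)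
    (e₂ : e ∈ cellEdges t₂) (e₃ : e ∈ cellEdges t₃) (n₂ : t₂ ≠ t₁) (n₃ : t₃ ≠ t₁) :
    t₂ = t₃ := by
  induction e using Sym2.ind with | _ x y => ?_
  exact cell_unique h₁ h₂ h₃ e₁ e₂ e₃ n₂ n₃

-- At most two triangles contain an edge, so lying in an odd number of triangles of `B` is the same
-- as lying in exactly one. This connects `bd` with chains.
open Classical in
lemma sum_bdry_apply {B : Finset (Finset Plane)} (hB : ∀ t ∈ B, t ∈ cells K) (e : Sym2 Plane) :
    (∑ t ∈ B, bdry t) e = if e ∈ bd (B : Set (Finset Plane)) then 1 else 0 := by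
  have h1 : (∑ t ∈ B, bdry t) e = ((B.filter fun t => e ∈ cellEdges t).card : ZMod 2) := by
    simp [bdry, Finset.sum_apply]
  rw [h1]
  set D := B.filter fun t => e ∈ cellEdges t with hD
  have hD' : ∀ t, t ∈ D ↔ t ∈ B ∧ e ∈ cellEdges t := fun t => by rw [hD, Finset.mem_filter]
  have hbd : e ∈ bd (B : Set (Finset Plane)) ↔ ∃! t, t ∈ D := by
    simp only [bd, Set.mem_ofPred_eq, hD', Finset.mem_coe]
  have h2 : D.card ≤ 2 := by
    by_contra hcon
    obtain ⟨t₁, t₂, t₃, k1, k2, k3, n12, n13, n23⟩ := Finset.two_lt_card_iff.1 (not_le.1 hcon)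
    rw [hD'] at k1 k2 k3
    exact n23 (cell_unique' (hB _ k1.1) (hB _ k2.1) (hB _ k3.1) k1.2 k2.2 k3.2 n12.symm n13.symm)
  have h3 : D.card = 1 ↔ ∃! t, t ∈ D := Finset.card_eq_one.trans
    ⟨fun ⟨t, ht⟩ => ⟨t, by simp [ht], fun t' ht' => by simpa [ht] using ht'⟩,
      fun ⟨t, ht, ht'⟩ => ⟨t, Finset.eq_singleton_iff_unique_mem.2 ⟨ht, ht'⟩⟩⟩
  rw [hbd, ← h3]
  interval_cases D.card
  · simp
  · simp
  · simp; decide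

/-- A set of triangles is determined by its boundary. -/
lemma bd_injective (hK : K.faces.Finite) {A B : Set (Finset Plane)} (hA : A ⊆ cells K)
    (hB : B ⊆ cells K) (h : bd A = bd B) : A = B := by
  by_contra hne
  -- Let `t` be the only triangle at `e` in the symmetric difference. A second triangle at `e`
  -- belongs to both sets or to neither, so `e` is on exactly one of the two boundaries. Such an
  -- edge is supplied by `exists_edge_mem_unique`.
  have key : ∀ {A B : Set (Finset Plane)}, A ⊆ cells K → B ⊆ cells K → bd A = bd B →
      ∀ e, ∀ t ∈ A, t ∉ B → e ∈ cellEdges t →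
      (∀ t', (t' ∈ A ∧ t' ∉ B) ∨ (t' ∈ B ∧ t' ∉ A) → e ∈ cellEdges t' → t' = t) → False := by
    intro A B hA hB h e t htA htB he hu
    by_cases h2 : ∃ t' ∈ A, e ∈ cellEdges t' ∧ t' ≠ t
    · obtain ⟨t', ht'A, he', hne⟩ := h2
      have ht'B : t' ∈ B := by
        by_contra hc
        exact hne (hu t' (Or.inl ⟨ht'A, hc⟩) he')
      have heB : e ∈ bd B := by
        refine ⟨t', ⟨ht'B, he'⟩, fun t'' ht'' => ?_⟩
        exact (cell_unique' (hA htA) (hA ht'A) (hB ht''.1) he he' ht''.2 hne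
          (fun h => htB (h ▸ ht''.1))).symm
      rw [← h] at heB
      exact hne (heB.unique ⟨ht'A, he'⟩ ⟨htA, he⟩)
    · push Not at h2
      have heA : e ∈ bd A := ⟨t, ⟨htA, he⟩, fun t' ht' => h2 t' ht'.1 ht'.2⟩
      rw [h] at heA
      obtain ⟨t', ⟨ht'B, he'⟩, -⟩ := heA
      have hne : t' ≠ t := fun e => htB (e ▸ ht'B)
      by_cases ht'A : t' ∈ A
      · exact hne (h2 t' ht'A he')
      · exact hne (hu t' (Or.inr ⟨ht'B, ht'A⟩) he')
  have hsub : (A \ B) ∪ (B \ A) ⊆ cells K := by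
    rintro t (h | h)
    · exact hA h.1
    · exact hB h.1
  have hnon : ((A \ B) ∪ (B \ A)).Nonempty := by
    by_contra hcon
    rw [Set.not_nonempty_iff_eq_empty, Set.union_empty_iff, Set.sdiff_eq_empty,
      Set.sdiff_eq_empty] at hcon
    exact hne (hcon.1.antisymm hcon.2)
  obtain ⟨a, b, t, ht, he, hu⟩ := exists_edge_mem_unique hsub ((cells_finite hK).subset hsub) hnon
  rcases ht with ht | ht
  · exact key hA hB h _ t ht.1 ht.2 he hu
  · exact key hB hA h.symm _ t ht.1 ht.2 he fun t' ht' => hu t' ht'.symm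

lemma bd_empty : bd (∅ : Set (Finset Plane)) = ∅ := by
  ext e; simp [bd, ExistsUnique]

/-! ### Simple cycles -/

lemma IsSimpleCycle.exists_other {C : (graph K).Subgraph} (hC : IsSimpleCycle C) {x y : Plane}
    (h : C.Adj x y) : ∃ z, z ≠ y ∧ C.Adj x z ∧ ∀ u, C.Adj x u → u = y ∨ u = z := by
  obtain ⟨u, w, hw, rfl⟩ := hC
  have hx : x ∈ w.support := (w.mem_verts_toSubgraph).1 (w.toSubgraph.edge_vert h)
  have h2 := hw.ncard_neighborSet_toSubgraph_eq_two hx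
  obtain ⟨p, q, hpq, e⟩ := Set.ncard_eq_two.1 h2
  have hm : ∀ z, w.toSubgraph.Adj x z ↔ z = p ∨ z = q := fun z => by
    rw [← SimpleGraph.Subgraph.mem_neighborSet, e]; simp
  rcases (hm y).1 h with rfl | rfl
  · exact ⟨q, hpq.symm, (hm q).2 (Or.inr rfl), fun u hu => (hm u).1 hu⟩
  · exact ⟨p, hpq, (hm p).2 (Or.inl rfl), fun u hu => ((hm u).1 hu).symm⟩

lemma IsSimpleCycle.exists_adj {C : (graph K).Subgraph} (hC : IsSimpleCycle C) {x : Plane}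
    (hx : x ∈ C.verts) : ∃ y, C.Adj x y := by
  obtain ⟨u, w, hw, rfl⟩ := hC
  have h2 := hw.ncard_neighborSet_toSubgraph_eq_two ((w.mem_verts_toSubgraph).1 hx)
  obtain ⟨p, q, hpq, e⟩ := Set.ncard_eq_two.1 h2
  exact ⟨p, by rw [← SimpleGraph.Subgraph.mem_neighborSet, e]; simp⟩

lemma IsSimpleCycle.nonempty {C : (graph K).Subgraph} (hC : IsSimpleCycle C) :
    C.verts.Nonempty := by
  obtain ⟨u, w, hw, rfl⟩ := hC
  exact ⟨u, w.start_mem_verts_toSubgraph⟩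

lemma IsSimpleCycle.induction {C : (graph K).Subgraph} (hC : IsSimpleCycle C) {Q : Plane → Prop}
    (hQ : ∀ x y, C.Adj x y → Q x → Q y) {x y : Plane} (hx : x ∈ C.verts) (hy : y ∈ C.verts)
    (h : Q x) : Q y := by
  obtain ⟨u, w, hw, rfl⟩ := hC
  obtain ⟨p, hp⟩ := (SimpleGraph.Subgraph.preconnected_iff_forall_exists_walk_subgraph _).1
    w.toSubgraph_connected.preconnected hx hy
  clear hx hy
  induction p with
  | nil => exact h
  | cons hadj p ih =>
    rw [SimpleGraph.Walk.toSubgraph, sup_le_iff] at hp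
    exact ih (hQ _ _ ((SimpleGraph.Subgraph.mem_edgeSet).1 (SimpleGraph.Subgraph.edgeSet_mono hp.1 (by simp))) h) hp.2

lemma IsSimpleCycle.finite {C : (graph K).Subgraph} (hC : IsSimpleCycle C) : C.verts.Finite := by
  obtain ⟨u, w, hw, rfl⟩ := hC
  rw [SimpleGraph.Walk.verts_toSubgraph]
  exact List.finite_toSet _

/-- Every closed walk bounds, in terms of chains. -/
lemma closed_walk_mem_boundaries (hK : HasPotential K) {u : Plane} (w : (graph K).Walk u u) :
    (w.edges.map fun e => (Pi.single e 1 : Chain)).sum ∈ boundaries K := by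
  classical
  obtain ⟨g, hg⟩ := hK
  -- Modulo boundaries the sum along a walk telescopes to `g u + g v`.
  have key : ∀ {u v : Plane} (w : (graph K).Walk u v),
      (w.edges.map fun e => (Pi.single e 1 : Chain)).sum + g u + g v ∈ boundaries K := by
    intro u v w
    induction w with
    | nil =>
      convert Submodule.zero_mem _ using 1
      simp only [SimpleGraph.Walk.edges_nil, List.map_nil, List.sum_nil]
      linear_combination (g _) * chain_two
    | @cons u v w h p ih =>
      have := Submodule.add_mem _ (hg _ _ h) ih
      convert this using 1
      simp only [SimpleGraph.Walk.edges_cons, List.map_cons, List.sum_cons]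
      rw [edgeChain]
      have e : (fun e => (Pi.single e 1 : Chain)) = fun e => Pi.single e 1 := rfl
      convert (show _ = _ from ?_) using 2
      linear_combination (-(g v)) * chain_two
  have := key w
  convert this using 1
  linear_combination (-(g u)) * chain_two

open Classical in
lemma sum_single_apply (l : List (Sym2 Plane)) (hl : l.Nodup) (e : Sym2 Plane) :
    (l.map fun e => (Pi.single e 1 : Chain)).sum e = if e ∈ l then 1 else 0 := by
  induction l with
  | nil => simp
  | cons a l ih =>
    rw [List.nodup_cons] at hl
    have := ih hl.2
    simp only [List.map_cons, List.sum_cons, Pi.add_apply, this, Pi.single_apply]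
    by_cases h : e = a
    · subst h; simp [hl.1]
    · simp [h]

/-- Every closed trail is the boundary of a set of triangles. -/
theorem exists_bd_of_isTrail (hK : HasPotential K) {u : Plane} {w : (graph K).Walk u u}
    (hw : w.IsTrail) : ∃ A ⊆ cells K, ∀ e, e ∈ bd A ↔ e ∈ w.edges := by
  classical
  have h := closed_walk_mem_boundaries hK w
  rw [boundaries, Finsupp.mem_span_image_iff_linearCombination] at h
  obtain ⟨l, hl, e⟩ := h
  rw [Finsupp.mem_supported] at hl
  refine ⟨(l.support : Set (Finset Plane)), hl, ?_⟩
  have hsum : ∑ t ∈ l.support, bdry t = (w.edges.map fun e => (Pi.single e 1 : Chain)).sum := by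
    rw [← e, Finsupp.linearCombination_apply, Finsupp.sum]
    refine Finset.sum_congr rfl fun t ht => ?_
    have : l t = 1 := by
      have := Finsupp.mem_support_iff.1 ht
      generalize l t = z at this
      revert z; decide
    rw [this, one_smul]
  intro e
  have k := congrFun hsum e
  rw [sum_bdry_apply (fun t ht => hl ht), sum_single_apply _ hw.edges_nodup] at k
  by_cases h1 : e ∈ bd (l.support : Set (Finset Plane)) <;> by_cases h2 : e ∈ w.edges <;>
    simp [h1, h2] at k ⊢

/-- Every simple cycle is the boundary of a set of triangles. -/
theorem IsSimpleCycle.exists_bd (hK : HasPotential K) {C : (graph K).Subgraph}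
    (hC : IsSimpleCycle C) : ∃ A ⊆ cells K, bd A = C.edgeSet := by
  obtain ⟨u, w, hw, rfl⟩ := hC
  obtain ⟨A, hA, h⟩ := exists_bd_of_isTrail hK hw.isTrail
  exact ⟨A, hA, Set.ext fun e => by rw [h, SimpleGraph.Walk.mem_edges_toSubgraph]⟩

/-- At each point, an even number of edges belongs to the boundary of a set of triangles. -/
lemma even_bd (hK : K.faces.Finite) {B : Set (Finset Plane)} (hB : B ⊆ cells K) {x y z : Plane}
    (hyz : y ≠ z) (h : ∀ u, s(x, u) ∈ bd B → u = y ∨ u = z) :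
    s(x, y) ∈ bd B ↔ s(x, z) ∈ bd B := by
  classical
  lift B to Finset (Finset Plane) using (cells_finite hK).subset hB
  let V : Finset Plane := insert y (insert z (B.biUnion id))
  have hV : ∀ t ∈ B, t ⊆ V := fun t ht u hu =>
    Finset.mem_insert_of_mem (Finset.mem_insert_of_mem (Finset.mem_biUnion.2 ⟨t, ht, hu⟩))
  -- Double counting: each triangle at `x` has exactly two edges at `x`, and all other triangles
  -- have none.
  have h1 : ∑ u ∈ V, (∑ t ∈ B, bdry t) s(x, u) = 0 := by
    simp only [Finset.sum_apply]
    rw [Finset.sum_comm]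
    refine Finset.sum_eq_zero fun t ht => ?_
    have h2 : ∑ u ∈ V, bdry t s(x, u) = ∑ u ∈ t, bdry t s(x, u) := by
      refine (Finset.sum_subset (hV t ht) fun u _ hu => ?_).symm
      exact if_neg fun h => hu (mem_cellEdges_iff.1 h).2.2
    rw [h2]
    by_cases hx : x ∈ t
    · have h3 : ∀ u ∈ t, bdry t s(x, u) = if x ≠ u then 1 else 0 := fun u hu => by
        simp only [bdry, mem_cellEdges_iff, hx, hu, and_true]
      rw [Finset.sum_congr rfl h3, ← Finset.sum_filter, Finset.filter_ne, Finset.sum_const,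
        Finset.card_erase_of_mem hx, (hB ht).2]
      decide
    · exact Finset.sum_eq_zero fun u _ => if_neg fun h => hx (mem_cellEdges_iff.1 h).2.1
  simp_rw [sum_bdry_apply (fun t ht => hB ht)] at h1
  rw [← Finset.sum_subset (s₁ := {y, z}) (by
    intro u hu; simp only [Finset.mem_insert, Finset.mem_singleton] at hu
    rcases hu with rfl | rfl <;> simp [V]) (by
    intro u _ hu
    refine if_neg fun h' => hu ?_
    simpa using h u h'), Finset.sum_pair hyz] at h1
  by_cases k1 : s(x, y) ∈ bd (B : Set (Finset Plane)) <;>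
    by_cases k2 : s(x, z) ∈ bd (B : Set (Finset Plane)) <;> simp [k1, k2] at h1 ⊢

/-- A boundary contained in a simple cycle is empty or equal to it. -/
lemma IsSimpleCycle.bd_eq (hK : K.faces.Finite) {C : (graph K).Subgraph} (hC : IsSimpleCycle C)
    {B : Set (Finset Plane)} (hB : B ⊆ cells K) (h : bd B ⊆ C.edgeSet) :
    bd B = ∅ ∨ bd B = C.edgeSet := by
  by_cases hne : bd B = ∅
  · exact Or.inl hne
  right
  refine h.antisymm ?_
  obtain ⟨e, he⟩ := Set.nonempty_iff_ne_empty.2 hne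
  -- Only the two edges of the cycle can be boundary edges at `x`, so by parity membership passes
  -- from one edge to the next, and thus around the whole cycle.
  have key : ∀ x y y', C.Adj x y → C.Adj x y' → s(x, y) ∈ bd B → s(x, y') ∈ bd B := by
    intro x y y' hy hy' hb
    obtain ⟨z, hzy, hz, hu⟩ := hC.exists_other hy
    have := (even_bd hK hB hzy.symm fun u hu' => hu u (h hu')).1 hb
    rcases hu y' hy' with rfl | rfl
    · exact hb
    · exact this
  induction e using Sym2.ind with | _ a b => ?_
  have hab : C.Adj a b := h he
  intro e' he'
  induction e' using Sym2.ind with | _ c d => ?_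
  have hcd : C.Adj c d := he'
  have := hC.induction (Q := fun x => ∀ y, C.Adj x y → s(x, y) ∈ bd B) ?_ hab.fst_mem hcd.fst_mem
    fun y hy => key a b y hab hy he
  · exact this d hcd
  · intro x y hxy hx z hz
    have h1 := hx y hxy
    rw [Sym2.eq_swap] at h1
    exact key y x z hxy.symm hz h1

end

end DiscretePlane

namespace DiscretePlane

open Geometry Topology

/-! ### Topology of triangulations -/

section

variable {K : SimplicialComplex ℝ Plane} {c : Plane} {r : ℝ}

/-- The vertices of a triangle are an affine basis of the plane, and the interior of the hull is
where all its coordinates are positive. -/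
lemma interior_cell {t : Finset Plane} (ht : t ∈ cells K) :
    interior (convexHull ℝ (t : Set Plane)) = openHull t := by
  classical
  have hi := K.indep ht.1
  let b : AffineBasis t ℝ Plane := ⟨((↑) : t → Plane), hi, by
    rw [hi.affineSpan_eq_top_iff_card_eq_finrank_add_one]; simp [ht.2]⟩
  have hrange : Set.range b = (t : Set Plane) := Subtype.range_coe
  have hcoord : ∀ {x w}, IsCoord t x w → ∀ i : t, b.coord i x = w i := by
    intro x w hw i
    have hval : ∀ y, ∀ hy : y ∈ t, b.coord i y = if (i : Plane) = y then 1 else 0 := by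
      intro y hy
      have := b.coord_apply i ⟨y, hy⟩
      rw [show b ⟨y, hy⟩ = y from rfl] at this
      rw [this]
      simp only [Subtype.ext_iff]
    rw [hw.map_eq, Finset.sum_congr rfl fun y hy => by rw [hval y hy]]
    simp
  have hint := b.interior_convexHull
  rw [hrange] at hint
  rw [hint]
  ext x
  constructor
  · intro hx
    have hx' : x ∈ convexHull ℝ (t : Set Plane) := interior_subset (hint ▸ hx)
    obtain ⟨w, hw⟩ := mem_convexHull_iff_exists_isCoord.1 hx'
    exact ⟨w, hw, fun y hy => by rw [← hcoord hw ⟨y, hy⟩]; exact hx _⟩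
  · rintro ⟨w, hw, hpos⟩ i
    rw [hcoord hw i]; exact hpos i i.2

lemma openHull_nonempty {s : Finset Plane} (hs : s ∈ K.faces) : (openHull s).Nonempty :=
  exists_openHull_nonempty (K.nonempty_of_mem_faces hs)

lemma isCompact_hull (s : Finset Plane) : IsCompact (convexHull ℝ (s : Set Plane)) :=
  s.finite_toSet.isCompact_convexHull (𝕜 := ℝ)

/-- The union of a set of triangles. -/
def region (A : Set (Finset Plane)) : Set Plane := ⋃ t ∈ A, convexHull ℝ (t : Set Plane)

lemma mem_region {A : Set (Finset Plane)} {y : Plane} :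
    y ∈ region A ↔ ∃ t ∈ A, y ∈ convexHull ℝ (t : Set Plane) := by
  simp [region]

lemma isCompact_region (hK : K.faces.Finite) {A : Set (Finset Plane)} (hA : A ⊆ cells K) :
    IsCompact (region A) :=
  ((cells_finite hK).subset hA).isCompact_biUnion fun t _ => isCompact_hull t

lemma carrier_isCompact (hK : K.faces.Finite) (C : (graph K).Subgraph) :
    IsCompact (carrier C) := by
  have : carrier C = ⋃ p ∈ {p : Plane × Plane | C.Adj p.1 p.2}, segment ℝ p.1 p.2 := by
    ext z; simp [carrier]
  rw [this]
  refine ((adj_finite hK).subset fun p hp => C.adj_sub hp).isCompact_biUnion fun p _ => ?_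
  rw [← convexHull_pair]
  exact (Set.toFinite _).isCompact_convexHull (𝕜 := ℝ)

lemma vertices_finite (hK : K.faces.Finite) : K.vertices.Finite := by
  rw [SimplicialComplex.vertices_eq]
  exact hK.biUnion fun s _ => s.finite_toSet

lemma Good.exists_cell (hK : Good c r K) {y : Plane} (hy : y ∈ square c r) :
    ∃ t ∈ cells K, y ∈ convexHull ℝ (t : Set Plane) := by
  rw [← hK.space] at hy
  obtain ⟨s, hs, hys⟩ := SimplicialComplex.mem_space_iff.1 hy
  obtain ⟨t, ht, hst⟩ := hK.pure s hs
  exact ⟨t, ht, convexHull_mono (Finset.coe_subset.2 hst) hys⟩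

lemma Good.hull_subset (hK : Good c r K) {s : Finset Plane} (hs : s ∈ K.faces) :
    convexHull ℝ (s : Set Plane) ⊆ square c r := by
  rw [← hK.space]; exact SimplicialComplex.convexHull_subset_space hs

/-- Points of the square that are not interior lie on a supporting line. -/
lemma exists_supporting {y : Plane} (hy : y ∈ square c r) (hyi : y ∉ interior (square c r)) :
    ∃ α β γ : ℝ, 0 < α ^ 2 + β ^ 2 ∧ (∀ z ∈ square c r, 0 ≤ planeAff α β γ z) ∧
      planeAff α β γ y = 0 := by
  by_contra hcon
  push Not at hcon
  simp only [planeAff_apply] at hcon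
  have h1 := hcon 1 0 (r - c 0) (by norm_num) fun z hz => by
    have := abs_le.1 hz.1; linarith
  have h2 := hcon (-1) 0 (r + c 0) (by norm_num) fun z hz => by
    have := abs_le.1 hz.1; linarith
  have h3 := hcon 0 1 (r - c 1) (by norm_num) fun z hz => by
    have := abs_le.1 hz.2; linarith
  have h4 := hcon 0 (-1) (r + c 1) (by norm_num) fun z hz => by
    have := abs_le.1 hz.2; linarith
  apply hyi
  have hopen : IsOpen {z : Plane | |z 0 - c 0| < r ∧ |z 1 - c 1| < r} := by
    have h0 (i : Fin 2) : Continuous fun z : Plane => |z i - c i| := by fun_prop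
    exact (isOpen_lt (h0 0) continuous_const).inter (isOpen_lt (h0 1) continuous_const)
  refine mem_interior.2 ⟨_, fun z hz => ⟨hz.1.le, hz.2.le⟩, hopen, ?_⟩
  have a0 := abs_le.1 hy.1
  have a1 := abs_le.1 hy.2
  refine ⟨abs_lt.2 ⟨lt_of_le_of_ne a0.1 fun h => h1 (by linarith), lt_of_le_of_ne a0.2 fun h =>
    h2 (by linarith)⟩, abs_lt.2 ⟨lt_of_le_of_ne a1.1 fun h => h3 (by linarith),
    lt_of_le_of_ne a1.2 fun h => h4 (by linarith)⟩⟩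

lemma oneSided_of_good (hK : Good c r K) {f : Plane →ᵃ[ℝ] ℝ} (hf : ∀ z ∈ square c r, 0 ≤ f z)
    {s : Finset Plane} (hs : s ∈ K.faces) : OneSided f s :=
  Or.inl fun x hx => hf x (hK.hull_subset hs (subset_convexHull ℝ _ hx))

lemma card_eq_two_or {s : Finset Plane} (hs : s ∈ K.faces) :
    s.card = 1 ∨ s.card = 2 ∨ s.card = 3 := by
  have := card_le_three hs
  have := (K.nonempty_of_mem_faces hs).card_pos
  omega

/-- A point of a triangle of `A`, neither a vertex nor on the boundary of `A`, does not lie on any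
other triangle or on the boundary of the square. -/
lemma Good.not_mem_of_bd (hK : Good c r K) {A : Set (Finset Plane)} (hA : A ⊆ cells K)
    {C : (graph K).Subgraph} (hbd : bd A = C.edgeSet) {y : Plane} (hyv : y ∉ K.vertices)
    (hyC : y ∉ carrier C) {t : Finset Plane} (ht : t ∈ A) (hyt : y ∈ convexHull ℝ (t : Set Plane)) :
    (∀ t' ∈ cells K, y ∈ convexHull ℝ (t' : Set Plane) → t' ∈ A) ∧ y ∈ interior (square c r) := by
  classical
  obtain ⟨u, hut, hune, hyu⟩ := exists_mem_openHull hyt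
  have huK : u ∈ K.faces := K.down_closed (hA ht).1 hut hune
  have hu1 : u.card ≠ 1 := by
    intro h
    obtain ⟨z, rfl⟩ := Finset.card_eq_one.1 h
    have : y ∈ convexHull ℝ (({z} : Finset Plane) : Set Plane) := openHull_subset _ hyu
    simp at this
    exact hyv (this ▸ huK)
  -- the second triangle of `A` at an edge through `y`
  have other : ∀ a b, a ≠ b → u = {a, b} → ∃ t'' ∈ A, t'' ≠ t ∧ s(a, b) ∈ cellEdges t'' ∧
      s(a, b) ∈ cellEdges t := by
    rintro a b hab rfl
    have het : s(a, b) ∈ cellEdges t := mem_cellEdges_iff.2 ⟨hab, hut (by simp), hut (by simp)⟩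
    by_contra hcon
    push Not at hcon
    have hb : s(a, b) ∈ bd A := by
      refine ⟨t, ⟨ht, het⟩, fun t' ht' => ?_⟩
      by_contra hne
      exact hcon t' ht'.1 hne ht'.2 het
    rw [hbd] at hb
    refine hyC ⟨a, b, hb, ?_⟩
    rw [← convexHull_pair]
    simpa using openHull_subset _ hyu
  refine ⟨fun t' ht' hyt' => ?_, ?_⟩
  · by_contra ht'A
    have hne : t' ≠ t := fun h => ht'A (h ▸ ht)
    have hut' := subset_of_mem_openHull huK ht'.1 hyu hyt'
    rcases card_eq_two_or huK with h | h | h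
    · exact hu1 h
    · obtain ⟨a, b, hab, rfl⟩ := Finset.card_eq_two.1 h
      obtain ⟨t'', ht'', hne'', he'', he⟩ := other a b hab rfl
      have he' : s(a, b) ∈ cellEdges t' := mem_cellEdges_iff.2 ⟨hab, hut' (by simp), hut' (by simp)⟩
      exact ht'A (cell_unique (hA ht) ht' (hA ht'') he he' he'' hne hne'' ▸ ht'')
    · exact hne ((Finset.eq_of_subset_of_card_le hut' (by rw [h, ht'.2])).symm.trans
        (Finset.eq_of_subset_of_card_le hut (by rw [h, (hA ht).2])))
  · by_contra hyi
    -- A supporting line of the square through `y` contains the face `u`. If `u` is an edge, its two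
    -- triangles would lie on different sides of that line; if `u` is a triangle, the function would
    -- have zero gradient.
    obtain ⟨α, β, γ, hpos, hsq, hy0⟩ := exists_supporting (hK.hull_subset (hA ht).1 hyt) hyi
    have hz := (oneSided_of_good hK hsq huK).eq_zero hyu hy0
    have hside : ∀ z, ∀ s ∈ K.faces, z ∈ s → 0 ≤ planeAff α β γ z := fun z s hs hzs =>
      hsq z (hK.hull_subset hs (subset_convexHull ℝ _ hzs))
    -- The gradient `(α, β)` is orthogonal to `b - a`, so the value at `w` and the cross product at
    -- `w` are proportional.
    have cr : ∀ a b w : Plane, planeAff α β γ a = 0 → planeAff α β γ b = 0 →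
        α * cross (b - a) (w - a) = -(b 1 - a 1) * planeAff α β γ w ∧
        β * cross (b - a) (w - a) = (b 0 - a 0) * planeAff α β γ w := by
      intro a b w ha hb
      simp only [planeAff_apply] at ha hb ⊢
      simp only [cross, PiLp.sub_apply]
      constructor
      · linear_combination (b 1 - a 1) * ha - (w 1 - a 1) * ha + (w 1 - a 1) * hb
      · linear_combination -(b 0 - a 0) * ha + (w 0 - a 0) * ha - (w 0 - a 0) * hb
    rcases card_eq_two_or huK with h | h | h
    · exact hu1 h
    · obtain ⟨a, b, hab, rfl⟩ := Finset.card_eq_two.1 h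
      obtain ⟨t'', ht'', hne'', he'', he⟩ := other a b hab rfl
      rw [mem_cellEdges_iff] at he he''
      obtain ⟨w, -, -, rfl⟩ := exists_third (hA ht).2 hab he.2.1 he.2.2
      obtain ⟨w', -, -, rfl⟩ := exists_third (hA ht'').2 hab he''.2.1 he''.2.2
      have hneg := cross_mul_neg (hA ht) (hA ht'') (fun h => hne'' (by rw [h]))
      have fa := hz a (by simp)
      have fb := hz b (by simp)
      have fw := hside w _ (hA ht).1 (by simp)
      have fw' := hside w' _ (hA ht'').1 (by simp)
      obtain ⟨p1, p2⟩ := cr a b w fa fb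
      obtain ⟨q1, q2⟩ := cr a b w' fa fb
      set X := cross (b - a) (w - a)
      set Y := cross (b - a) (w' - a)
      have e : (α ^ 2 + β ^ 2) * (X * Y) =
          ((b 1 - a 1) ^ 2 + (b 0 - a 0) ^ 2) * (planeAff α β γ w * planeAff α β γ w') := by
        linear_combination α * Y * p1 - (b 1 - a 1) * planeAff α β γ w * q1 + β * Y * p2 +
          (b 0 - a 0) * planeAff α β γ w * q2
      have : 0 ≤ ((b 1 - a 1) ^ 2 + (b 0 - a 0) ^ 2) * (planeAff α β γ w * planeAff α β γ w') := by
        positivity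
      nlinarith
    · have hu := Finset.eq_of_subset_of_card_le hut (by rw [h, (hA ht).2])
      subst hu
      obtain ⟨a, b, w, hab, haw, hbw, rfl⟩ := Finset.card_eq_three.1 h
      have hne := cross_ne_zero (hA ht)
      obtain ⟨p1, p2⟩ := cr a b w (hz a (by simp)) (hz b (by simp))
      rw [hz w (by simp), mul_zero] at p1 p2
      have e1 := (mul_eq_zero.1 p1).resolve_right hne
      have e2 := (mul_eq_zero.1 p2).resolve_right hne
      rw [e1, e2] at hpos
      norm_num at hpos

lemma cross_eq_zero_of_mem_segment {f g y : Plane} (h : y ∈ segment ℝ f g) :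
    cross (f - y) (g - y) = 0 := by
  obtain ⟨a, b, -, -, hab, rfl⟩ := h
  have : a = 1 - b := by linarith
  subst this
  simp only [cross, PiLp.sub_apply, PiLp.add_apply, PiLp.smul_apply, smul_eq_mul]
  ring

/-- If `f` is on the line through `y` and `g`, it is moved a little in the orthogonal direction `n`.
The segment from the new point to `g` then misses `y`. -/
lemma exists_mem_open_cross_ne_zero {O : Set Plane} (hO : IsOpen O) (hne : O.Nonempty)
    {y g : Plane} (hg : g ≠ y) : ∃ f ∈ O, cross (f - y) (g - y) ≠ 0 := by
  obtain ⟨f, hf⟩ := hne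
  by_cases h : cross (f - y) (g - y) = 0
  swap
  · exact ⟨f, hf, h⟩
  let n : Plane := !₂[-(g 1 - y 1), g 0 - y 0]
  have n0 : n 0 = -(g 1 - y 1) := rfl
  have n1 : n 1 = g 0 - y 0 := rfl
  have hcont : Filter.Tendsto (fun s : ℝ => f + s • n) (𝓝[≠] 0) (𝓝 f) := by
    have : Continuous fun s : ℝ => f + s • n := by fun_prop
    have h2 := this.tendsto 0
    simp only [zero_smul, add_zero] at h2
    exact h2.mono_left nhdsWithin_le_nhds
  obtain ⟨s, hs, hs0⟩ := ((hcont.eventually (hO.mem_nhds hf)).and self_mem_nhdsWithin).exists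
  refine ⟨_, hs, fun h' => ?_⟩
  have e : cross (f + s • n - y) (g - y) =
      cross (f - y) (g - y) - s * ((g 0 - y 0) ^ 2 + (g 1 - y 1) ^ 2) := by
    simp only [cross, PiLp.sub_apply, PiLp.add_apply, PiLp.smul_apply, smul_eq_mul, n0, n1]; ring
  rw [h', h] at e
  have : (g 0 - y 0) ^ 2 + (g 1 - y 1) ^ 2 = 0 :=
    (mul_eq_zero.1 (by linarith : s * ((g 0 - y 0) ^ 2 + (g 1 - y 1) ^ 2) = 0)).resolve_left hs0
  exact hg (coord_ext (by nlinarith [sq_nonneg (g 0 - y 0), sq_nonneg (g 1 - y 1)])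
    (by nlinarith [sq_nonneg (g 0 - y 0), sq_nonneg (g 1 - y 1)]))

/-- The union of a set of triangles is a neighbourhood of each of its points off its boundary. -/
theorem Good.region_mem_nhds (hK : Good c r K) {A : Set (Finset Plane)} (hA : A ⊆ cells K)
    {C : (graph K).Subgraph} (hbd : bd A = C.edgeSet) {y : Plane} (hy : y ∈ region A)
    (hyC : y ∉ carrier C) : region A ∈ 𝓝 y := by
  have hFc := (isCompact_region hK.finite hA).isClosed
  have hGc := (isCompact_region hK.finite (A := cells K \ A) Set.sdiff_subset).isClosed
  have hcover : ∀ z, z ∈ region A ∪ (region (cells K \ A) ∪ closure (square c r)ᶜ) := by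
    intro z
    by_cases hz : z ∈ square c r
    · obtain ⟨t, ht, hzt⟩ := hK.exists_cell hz
      by_cases htA : t ∈ A
      · exact Or.inl (mem_region.2 ⟨t, htA, hzt⟩)
      · exact Or.inr (Or.inl (mem_region.2 ⟨t, ⟨ht, htA⟩, hzt⟩))
    · exact Or.inr (Or.inr (subset_closure hz))
  -- The ball avoids all vertices except possibly `y`, because `Good.not_mem_of_bd` says nothing
  -- about vertices.
  have hU : (carrier C ∪ (K.vertices \ {y}))ᶜ ∈ 𝓝 y := by
    refine IsOpen.mem_nhds (IsClosed.isOpen_compl (self := ?_)) ?_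
    · exact (carrier_isCompact hK.finite C).isClosed.union
        ((vertices_finite hK.finite).subset Set.sdiff_subset).isClosed
    · simp [hyC]
  obtain ⟨ε, hε, hball⟩ := Metric.mem_nhds_iff.1 hU
  refine Metric.mem_nhds_iff.2 ⟨ε, hε, fun g hg => ?_⟩
  by_contra hgF
  have hgy : g ≠ y := fun h => hgF (h ▸ hy)
  obtain ⟨t, ht, hyt⟩ := mem_region.1 hy
  have hint : (interior (convexHull ℝ (t : Set Plane))).Nonempty := by
    rw [interior_cell (hA ht)]; exact openHull_nonempty (hA ht).1
  have hycl : y ∈ closure (interior (convexHull ℝ (t : Set Plane))) := by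
    rw [(convex_convexHull ℝ _).closure_interior_eq_closure_of_nonempty_interior hint]
    exact subset_closure hyt
  have hOne : (Metric.ball y ε ∩ interior (convexHull ℝ (t : Set Plane))).Nonempty :=
    mem_closure_iff_nhds.1 hycl _ (Metric.ball_mem_nhds y hε)
  -- A segment from a point `f` of the triangle `t` to the point `g` outside the region, inside the
  -- ball and missing `y`.
  obtain ⟨f, ⟨hfb, hft⟩, hcr⟩ := exists_mem_open_cross_ne_zero
    (Metric.isOpen_ball.inter isOpen_interior) hOne hgy
  have hseg : segment ℝ f g ⊆ Metric.ball y ε := (convex_ball y ε).segment_subset hfb hg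
  have hpre : IsPreconnected (segment ℝ f g) := (convex_segment f g).isPreconnected
  -- By connectedness the segment contains a point `q` that is both in the region and in the closed
  -- set formed by the other triangles and the closure of the outside. This contradicts
  -- `Good.not_mem_of_bd`.
  obtain ⟨q, hq, hqF, hqG⟩ := isPreconnected_closed_iff.1 hpre _ _ hFc
    (hGc.union isClosed_closure) (fun z _ => hcover z)
    ⟨f, left_mem_segment ℝ f g, mem_region.2 ⟨t, ht, interior_subset hft⟩⟩
    ⟨g, right_mem_segment ℝ f g, (hcover g).resolve_left hgF⟩
  have hqy : q ≠ y := by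
    rintro rfl
    exact hcr (cross_eq_zero_of_mem_segment hq)
  have hq' := hball (hseg hq)
  simp only [Set.mem_compl_iff, Set.mem_union, not_or, Set.mem_sdiff, Set.mem_singleton_iff,
    not_and, not_not] at hq'
  obtain ⟨t', ht', hqt'⟩ := mem_region.1 hqF
  obtain ⟨k1, k2⟩ := hK.not_mem_of_bd hA hbd (fun h => hqy (hq'.2 h)) hq'.1 ht' hqt'
  rcases hqG with hqG | hqG
  · obtain ⟨t'', ht'', hqt''⟩ := mem_region.1 hqG
    exact ht''.2 (k1 t'' ht''.1 hqt'')
  · rw [closure_compl] at hqG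
    exact hqG k2

/-! ### The Jordan curve theorem for cycles of a triangulation -/

lemma not_mem_carrier_of_mem_openHull {s : Finset Plane} (hs : s ∈ K.faces)
    {C : (graph K).Subgraph} (h : ∀ x y, C.Adj x y → ¬ s ⊆ {x, y}) {z : Plane}
    (hz : z ∈ openHull s) : z ∉ carrier C := by
  classical
  rintro ⟨x, y, hxy, hzs⟩
  refine h x y hxy (subset_of_mem_openHull hs (graph_adj_iff.1 (C.adj_sub hxy)).2 hz ?_)
  rw [Finset.coe_insert, Finset.coe_singleton, convexHull_pair]
  exact hzs

lemma openHull_cell_not_mem_carrier {t : Finset Plane} (ht : t ∈ cells K)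
    (C : (graph K).Subgraph) {z : Plane} (hz : z ∈ openHull t) : z ∉ carrier C := by
  classical
  refine not_mem_carrier_of_mem_openHull ht.1 (fun x y _ h => ?_) hz
  have := (Finset.card_le_card h).trans Finset.card_le_two
  rw [ht.2] at this
  omega

/-- Off `C` the region of `A` is both open and closed, so a component of the complement of `C` that
meets it stays in it and is bounded. -/
lemma Good.region_subset_inside (hK : Good c r K) {A : Set (Finset Plane)} (hA : A ⊆ cells K)
    {C : (graph K).Subgraph} (hbd : bd A = C.edgeSet) {t : Finset Plane} (ht : t ∈ A) :
    t ∈ insideCells C := by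
  refine ⟨hA ht, fun z hz => ?_⟩
  rw [interior_cell (hA ht)] at hz
  have hzC := openHull_cell_not_mem_carrier (hA ht) C hz
  refine ⟨hzC, (isCompact_region hK.finite hA).isBounded.subset ?_⟩
  have hFc := (isCompact_region hK.finite hA).isClosed
  have hsub : connectedComponentIn (carrier C)ᶜ z ⊆ interior (region A) := by
    refine isPreconnected_connectedComponentIn.subset_left_of_subset_union isOpen_interior
      hFc.isOpen_compl ?_ ?_ ⟨z, mem_connectedComponentIn hzC, ?_⟩
    · exact Set.disjoint_left.2 fun w hw hw' => hw' (interior_subset hw)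
    · intro w hw
      by_cases hwF : w ∈ region A
      · exact Or.inl (mem_interior_iff_mem_nhds.2 (hK.region_mem_nhds hA hbd hwF
          (connectedComponentIn_subset _ _ hw)))
      · exact Or.inr hwF
    · exact mem_interior_iff_mem_nhds.2 (hK.region_mem_nhds hA hbd
        (mem_region.2 ⟨t, ht, openHull_subset _ hz⟩) hzC)
  exact hsub.trans interior_subset

lemma mem_component_of_segment {F : Set Plane} {z x y : Plane}
    (hx : x ∈ connectedComponentIn F z) (h : segment ℝ x y ⊆ F) :
    y ∈ connectedComponentIn F z := by
  rw [connectedComponentIn_eq hx]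
  exact (convex_segment x y).isPreconnected.subset_connectedComponentIn (left_mem_segment ℝ x y) h
    (right_mem_segment ℝ x y)

/-- A point outside the square is not enclosed by anything in the square. -/
lemma not_isBounded_component {F : Set Plane} (hF : (square c r)ᶜ ⊆ F) {z q : Plane}
    (hq : q ∈ connectedComponentIn F z) (hqs : q ∉ square c r) (hr : 0 < r) :
    ¬ Bornology.IsBounded (connectedComponentIn F z) := by
  intro hb
  obtain ⟨R, hR⟩ := isBounded_iff_forall_norm_le.1 hb
  obtain ⟨i, hi⟩ : ∃ i : Fin 2, r < |q i - c i| := by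
    by_contra hcon
    push Not at hcon
    exact hqs ⟨hcon 0, hcon 1⟩
  -- The ray from `q` away from the centre never returns to the square, hence lies in the component;
  -- far out on it the coordinate `i` exceeds every bound.
  have hout : ∀ s : ℝ, 0 ≤ s → q + s • (q - c) ∉ square c r := by
    intro s hs h
    have hle : |(q + s • (q - c)) i - c i| ≤ r := by
      fin_cases i
      · exact h.1
      · exact h.2
    have e : (q + s • (q - c)) i - c i = (1 + s) * (q i - c i) := by simp; ring
    rw [e, abs_mul, abs_of_pos (by linarith : 0 < 1 + s)] at hle
    nlinarith
  have hmem : ∀ s : ℝ, 0 ≤ s → q + s • (q - c) ∈ connectedComponentIn F z := by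
    intro s hs
    refine mem_component_of_segment hq fun x hx => hF ?_
    rw [segment_eq_image'] at hx
    obtain ⟨θ, hθ, rfl⟩ := hx
    have := hout (θ * s) (mul_nonneg hθ.1 hs)
    simpa [mul_smul] using this
  have hqc : 0 < |q i - c i| := hr.trans hi
  set s := (|c i| + |R| + 1) / |q i - c i| with hs
  have hs0 : 0 ≤ s := by positivity
  have h1 := hR _ (hmem s hs0)
  have h2 := PiLp.norm_apply_le (q + s • (q - c)) i
  have e : (q + s • (q - c)) i = c i + (1 + s) * (q i - c i) := by simp; ring
  rw [e, Real.norm_eq_abs] at h2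
  have h3 : (1 + s) * |q i - c i| - |c i| ≤ |c i + (1 + s) * (q i - c i)| := by
    have := abs_sub_abs_le_abs_sub ((1 + s) * (q i - c i)) (-c i)
    rw [abs_mul, abs_of_pos (by linarith : 0 < 1 + s), abs_neg] at this
    rwa [show (1 + s) * (q i - c i) - -c i = c i + (1 + s) * (q i - c i) by ring] at this
  have h4 : s * |q i - c i| = |c i| + |R| + 1 := by rw [hs]; field_simp
  have := le_abs_self R
  nlinarith

/-- The triangles that can be reached from `t` without crossing the edges in `E`. -/
def reach (K : SimplicialComplex ℝ Plane) (E : Set (Sym2 Plane)) (t : Finset Plane) :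
    Set (Finset Plane) :=
  {t' | Relation.ReflTransGen (fun t₁ t₂ => t₂ ∈ cells K ∧
    ∃ e, e ∉ E ∧ e ∈ cellEdges t₁ ∧ e ∈ cellEdges t₂) t t'}

lemma reach_subset {E : Set (Sym2 Plane)} {t : Finset Plane} (ht : t ∈ cells K) :
    reach K E t ⊆ cells K := by
  intro t' ht'
  induction ht' with
  | refl => exact ht
  | tail _ h _ => exact h.1

lemma reach_step {E : Set (Sym2 Plane)} {t t₁ t₂ : Finset Plane} (h : t₁ ∈ reach K E t)
    (h₂ : t₂ ∈ cells K) {e : Sym2 Plane} (he : e ∉ E) (h1 : e ∈ cellEdges t₁)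
    (h2 : e ∈ cellEdges t₂) : t₂ ∈ reach K E t :=
  Relation.ReflTransGen.tail h ⟨h₂, e, he, h1, h2⟩

/-- Sets of triangles are invariant under crossing edges off their boundary. -/
lemma mem_iff_of_not_mem_bd {A : Set (Finset Plane)} (hA : A ⊆ cells K) {t₁ t₂ : Finset Plane}
    (h₁ : t₁ ∈ cells K) (h₂ : t₂ ∈ cells K) {e : Sym2 Plane} (he : e ∉ bd A)
    (h1 : e ∈ cellEdges t₁) (h2 : e ∈ cellEdges t₂) : t₁ ∈ A ↔ t₂ ∈ A := by
  have key : ∀ {t₁ t₂ : Finset Plane}, t₁ ∈ cells K → t₂ ∈ cells K → e ∈ cellEdges t₁ →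
      e ∈ cellEdges t₂ → t₁ ∈ A → t₂ ∈ A := by
    intro t₁ t₂ h₁ h₂ h1 h2 ht
    by_contra hn
    refine he ⟨t₁, ⟨ht, h1⟩, fun t' ht' => ?_⟩
    by_contra hne
    exact hn (cell_unique' h₁ h₂ (hA ht'.1) h1 h2 ht'.2 (fun h => hn (h ▸ ht)) hne ▸ ht'.1)
  exact ⟨key h₁ h₂ h1 h2, key h₂ h₁ h2 h1⟩

/-- An edge on a single triangle is on the boundary of the square. -/
lemma Good.not_mem_interior_of_unique (hK : Good c r K) {t : Finset Plane} (ht : t ∈ cells K)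
    {a b : Plane} (he : s(a, b) ∈ cellEdges t)
    (hu : ∀ t' ∈ cells K, s(a, b) ∈ cellEdges t' → t' = t) {y : Plane}
    (hy : y ∈ openHull {a, b}) : y ∉ interior (square c r) := by
  classical
  intro hyi
  have hab := (mem_cellEdges_iff.1 he).1
  have hG := (isCompact_region hK.finite (A := cells K \ {t}) Set.sdiff_subset).isClosed
  obtain ⟨w, hwa, hwb, hte⟩ := exists_third ht.2 hab (mem_cellEdges_iff.1 he).2.1
    (mem_cellEdges_iff.1 he).2.2
  have hface : {a, b} ∈ K.faces := (graph_adj_iff.1 (graph_adj_of_mem_cells ht he)).2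
  have hyG : y ∉ region (cells K \ {t}) := by
    intro h
    obtain ⟨t', ht', hyt'⟩ := mem_region.1 h
    have hs := subset_of_mem_openHull hface ht'.1.1 hy hyt'
    exact ht'.2 (hu t' ht'.1 (mem_cellEdges_iff.2 ⟨hab, hs (by simp), hs (by simp)⟩))
  -- Moving from `y` a little away from the third vertex `w`, one stays in the square and off all
  -- other triangles, hence in `t`. But an affine function that vanishes on the edge and is positive
  -- at `w` is negative there.
  have hcont : Filter.Tendsto (fun s : ℝ => y + s • (y - w)) (𝓝[>] 0) (𝓝 y) := by
    have : Continuous fun s : ℝ => y + s • (y - w) := by fun_prop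
    have h2 := this.tendsto 0
    simp only [zero_smul, add_zero] at h2
    exact h2.mono_left nhdsWithin_le_nhds
  obtain ⟨s, ⟨hs1, hs2⟩, hs0⟩ := (((hcont.eventually (hG.isOpen_compl.mem_nhds hyG)).and
    (hcont.eventually (isOpen_interior.mem_nhds hyi))).and self_mem_nhdsWithin).exists
  have hs0' : 0 < s := hs0
  obtain ⟨t', ht', hqt'⟩ := hK.exists_cell (interior_subset hs2)
  have htt : t' = t := by
    by_contra hne
    exact hs1 (mem_region.2 ⟨t', ⟨ht', hne⟩, hqt'⟩)
  subst htt
  -- the affine function vanishing on the edge and positive at `w`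
  subst hte
  have hne := cross_ne_zero ht
  set σ := cross (b - a) (w - a) with hσ
  let f : Plane →ᵃ[ℝ] ℝ := planeAff (-(b 1 - a 1) * σ) ((b 0 - a 0) * σ)
    (((b 1 - a 1) * a 0 - (b 0 - a 0) * a 1) * σ)
  have hf : ∀ z, f z = cross (b - a) (z - a) * σ := by
    intro z
    simp only [f, planeAff_apply, cross, PiLp.sub_apply]; ring
  have fa : f a = 0 := by rw [hf]; simp [cross]
  have fb : f b = 0 := by rw [hf]; simp [cross]; left; ring
  have fw : 0 < f w := by rw [hf, ← hσ]; exact mul_self_pos.2 hne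
  have fy : f y = 0 := by
    obtain ⟨u, hu, -⟩ := hy
    rw [hu.map_eq, Finset.sum_pair hab, fa, fb]; ring
  have fq : f (y + s • (y - w)) = f y + s * (f y - f w) := by
    simp only [hf, cross, PiLp.sub_apply, PiLp.add_apply, PiLp.smul_apply, smul_eq_mul]; ring
  have hnn := nonneg_of_mem_convexHull (f := f) (s := {a, b, w}) (by
    intro x hx
    simp only [Finset.mem_insert, Finset.mem_singleton] at hx
    rcases hx with rfl | rfl | rfl
    · exact fa.ge
    · exact fb.ge
    · exact fw.le) hqt'
  rw [fq, fy] at hnn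
  nlinarith

lemma segment_subset_openHull {t u : Finset Plane} {y z : Plane} (hut : u ⊆ t)
    (hy : y ∈ openHull u) (hz : z ∈ openHull t) :
    segment ℝ y z ⊆ {y} ∪ openHull t := by
  rintro x ⟨a, b, ha, hb, hab, rfl⟩
  rcases hb.eq_or_lt with rfl | hb
  · left; simp at hab; simp [hab]
  · right
    obtain ⟨p, hp, -⟩ := hy
    obtain ⟨q, hq, hqpos⟩ := hz
    have hp := hp.mono hut
    refine ⟨fun x => a * p x + b * q x, ⟨fun x => ?_, fun x hx => ?_, ?_, ?_⟩, fun x hx => ?_⟩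
    · have := hp.1 x; have := hq.1 x; positivity
    · simp [hp.2.1 x hx, hq.2.1 x hx]
    · rw [Finset.sum_add_distrib, ← Finset.mul_sum, ← Finset.mul_sum, hp.2.2.1, hq.2.2.1]
      simpa using hab
    · simp_rw [add_smul, mul_smul]
      rw [Finset.sum_add_distrib, ← Finset.smul_sum, ← Finset.smul_sum, hp.2.2.2, hq.2.2.2]
    · have := hp.1 x; have := hqpos x hx; positivity

/-- The Jordan curve theorem: the triangles enclosed by a simple cycle are those in the set that
it bounds. -/
theorem Good.insideCells_eq (hK : Good c r K) (hr : 0 < r) {C : (graph K).Subgraph}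
    (hC : IsSimpleCycle C) {A : Set (Finset Plane)} (hA : A ⊆ cells K) (hbd : bd A = C.edgeSet) :
    insideCells C = A := by
  classical
  refine Set.Subset.antisymm (fun t ht => ?_) fun t ht => hK.region_subset_inside hA hbd ht
  obtain ⟨htK, hin⟩ := ht
  rw [interior_cell htK] at hin
  obtain ⟨z, hz⟩ := openHull_nonempty htK.1
  obtain ⟨hzC, hbdd⟩ := hin hz
  by_contra htA
  -- The triangles that can be reached from `t` without crossing `C` all lie in the component of
  -- `z`, which is bounded.
  have hB : reach K C.edgeSet t ⊆ cells K := reach_subset htK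
  have htB : t ∈ reach K C.edgeSet t := Relation.ReflTransGen.refl
  have hcomp : ∀ t' ∈ reach K C.edgeSet t,
      openHull t' ⊆ connectedComponentIn (carrier C)ᶜ z := by
    intro t' ht'
    induction ht' with
    | refl =>
      intro x hx
      refine mem_component_of_segment (mem_connectedComponentIn hzC) fun q hq => ?_
      rcases segment_subset_openHull le_rfl hz hx hq with h | h
      · rw [h]; exact hzC
      · exact openHull_cell_not_mem_carrier htK C h
    | @tail t₁ t₂ h1 h ih =>
      obtain ⟨h2, e, he, ha, hb⟩ := h
      have h1' := hB h1
      induction e using Sym2.ind with | _ a b => ?_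
      have hface : {a, b} ∈ K.faces := (graph_adj_iff.1 (graph_adj_of_mem_cells h2 hb)).2
      obtain ⟨y, hy⟩ := openHull_nonempty hface
      obtain ⟨x₁, hx₁⟩ := openHull_nonempty h1'.1
      have hyC : y ∉ carrier C := by
        refine not_mem_carrier_of_mem_openHull hface (fun p q hpq hs => he ?_) hy
        have hab := (mem_cellEdges_iff.1 hb).1
        have ha' := hs (Finset.mem_insert_self a {b})
        have hb' := hs (Finset.mem_insert_of_mem (Finset.mem_singleton_self b) : b ∈ {a, b})
        simp only [Finset.mem_insert, Finset.mem_singleton] at ha' hb'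
        rcases ha' with rfl | rfl <;> rcases hb' with rfl | rfl
        · exact absurd rfl hab
        · exact hpq
        · exact hpq.symm
        · exact absurd rfl hab
      have hsub : ∀ {s : Finset Plane}, s(a, b) ∈ cellEdges s → {a, b} ⊆ s := by
        intro s hs
        simp [Finset.insert_subset_iff, (mem_cellEdges_iff.1 hs).2]
      have hyW : y ∈ connectedComponentIn (carrier C)ᶜ z := by
        refine mem_component_of_segment (ih hx₁) fun q hq => ?_
        rw [segment_symm] at hq
        rcases segment_subset_openHull (hsub ha) hy hx₁ hq with h | h
        · rw [h]; exact hyC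
        · exact openHull_cell_not_mem_carrier h1' C h
      intro x hx
      refine mem_component_of_segment hyW fun q hq => ?_
      rcases segment_subset_openHull (hsub hb) hy hx hq with h | h
      · rw [h]; exact hyC
      · exact openHull_cell_not_mem_carrier h2 C h
  -- If their boundary is part of the cycle, it is empty or the whole cycle, so the reachable
  -- triangles form the empty set or `A`. But `t` is reachable and not in `A`.
  by_cases hbdB : bd (reach K C.edgeSet t) ⊆ C.edgeSet
  · rcases hC.bd_eq hK.finite hB hbdB with h | h
    · rw [← bd_empty] at h
      have := bd_injective hK.finite hB (Set.empty_subset _) h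
      rw [this] at htB
      exact htB
    · have := bd_injective hK.finite hB hA (h.trans hbd.symm)
      exact htA (this ▸ htB)
  -- Otherwise there is a boundary edge `e` off `C`. It lies on one triangle of `K` only, since a
  -- second one would be reachable; so it is on the border of the square, and the component leaves
  -- the square next to it.
  · obtain ⟨e, heB, heC⟩ := Set.not_subset.1 hbdB
    obtain ⟨t₁, ⟨ht₁, het₁⟩, hu⟩ := heB
    have hu' : ∀ t' ∈ cells K, e ∈ cellEdges t' → t' = t₁ := fun t' ht' he' =>
      hu t' ⟨reach_step ht₁ ht' heC het₁ he', he'⟩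
    induction e using Sym2.ind with | _ a b => ?_
    have hface : {a, b} ∈ K.faces := (graph_adj_iff.1 (graph_adj_of_mem_cells (hB ht₁) het₁)).2
    obtain ⟨y, hy⟩ := openHull_nonempty hface
    have hyi := hK.not_mem_interior_of_unique (hB ht₁) het₁ hu' hy
    have hab := (mem_cellEdges_iff.1 het₁).1
    have hyC : y ∉ carrier C := by
      refine not_mem_carrier_of_mem_openHull hface (fun p q hpq hs => heC ?_) hy
      have ha' := hs (Finset.mem_insert_self a {b})
      have hb' := hs (Finset.mem_insert_of_mem (Finset.mem_singleton_self b) : b ∈ {a, b})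
      simp only [Finset.mem_insert, Finset.mem_singleton] at ha' hb'
      rcases ha' with rfl | rfl <;> rcases hb' with rfl | rfl
      · exact absurd rfl hab
      · exact hpq
      · exact hpq.symm
      · exact absurd rfl hab
    obtain ⟨x₁, hx₁⟩ := openHull_nonempty (hB ht₁).1
    have hyW : y ∈ connectedComponentIn (carrier C)ᶜ z := by
      refine mem_component_of_segment (hcomp t₁ ht₁ hx₁) fun q hq => ?_
      rw [segment_symm] at hq
      have hsub : {a, b} ⊆ t₁ := by
        simp [Finset.insert_subset_iff, (mem_cellEdges_iff.1 het₁).2]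
      rcases segment_subset_openHull hsub hy hx₁ hq with h | h
      · rw [h]; exact hyC
      · exact openHull_cell_not_mem_carrier (hB ht₁) C h
    have hycl : y ∈ closure (square c r)ᶜ := by rw [closure_compl]; exact hyi
    obtain ⟨ε, hε, hball⟩ := Metric.mem_nhds_iff.1
      ((carrier_isCompact hK.finite C).isClosed.isOpen_compl.mem_nhds hyC)
    obtain ⟨q, hqb, hqs⟩ := mem_closure_iff_nhds.1 hycl _ (Metric.ball_mem_nhds y hε)
    have hqW : q ∈ connectedComponentIn (carrier C)ᶜ z := mem_component_of_segment hyW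
      (((convex_ball y ε).segment_subset (Metric.mem_ball_self hε) hqb).trans hball)
    refine not_isBounded_component (c := c) (r := r) ?_ hqW hqs hr hbdd
    intro x hx hxC
    obtain ⟨p, q, hpq, hxs⟩ := hxC
    refine hx (hK.hull_subset (graph_adj_iff.1 (C.adj_sub hpq)).2 ?_)
    rw [Finset.coe_insert, Finset.coe_singleton, convexHull_pair]
    exact hxs

end

end DiscretePlane

namespace DiscretePlane

open Geometry Topology

/-! ### Pieces cut off by a chord -/

section

variable {K : SimplicialComplex ℝ Plane} {c : Plane} {r : ℝ}

/-- If no boundary edge of `B` contains the vertex `v` of `B`, then all triangles at `v` are in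
`B`. -/
lemma Good.mem_of_vertex (hK : Good c r K) {B : Set (Finset Plane)} (hB : B ⊆ cells K)
    {v : Plane} {t₀ t : Finset Plane} (ht₀ : t₀ ∈ B) (hv₀ : v ∈ t₀)
    (hv : ∀ u, s(v, u) ∉ bd B) (ht : t ∈ cells K) (hvt : v ∈ t) : t ∈ B := by
  classical
  have hadj : ∀ a b, s(a, b) ∈ bd B → (graph K).Adj a b := by
    rintro a b ⟨t, ⟨h1, h2⟩, -⟩
    exact graph_adj_of_mem_cells (hB h1) h2
  -- The boundary of `B` as a subgraph, so that `Good.region_mem_nhds` applies; `v` is not on it.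
  let D : (graph K).Subgraph :=
    { verts := {a | ∃ b, s(a, b) ∈ bd B}
      Adj := fun a b => s(a, b) ∈ bd B
      adj_sub := fun {a b} h => hadj a b h
      edge_vert := fun {a b} h => ⟨b, h⟩
      symm := ⟨fun a b h => by rwa [Sym2.eq_swap]⟩ }
  have hD : bd B = D.edgeSet := by
    ext e; induction e using Sym2.ind with | _ a b => exact Iff.rfl
  have hvD : v ∉ carrier D := by
    rintro ⟨a, b, hab, hs⟩
    have hface : ({v} : Finset Plane) ∈ K.faces :=
      K.down_closed (hB ht₀).1 (by simpa using hv₀) (by simp)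
    have : ({v} : Finset Plane) ⊆ {a, b} := by
      refine subset_of_mem_openHull hface (graph_adj_iff.1 (hadj a b hab)).2 (x := v) ?_ ?_
      · obtain ⟨y, hy⟩ := openHull_nonempty hface
        have : y = v := by simpa using openHull_subset _ hy
        exact this ▸ hy
      · rwa [Finset.coe_insert, Finset.coe_singleton, convexHull_pair]
    have : v = a ∨ v = b := by simpa using this
    rcases this with rfl | rfl
    · exact hv b hab
    · exact hv a (by rw [Sym2.eq_swap]; exact hab)
  -- The region of `B` is a neighbourhood of `v`, so it meets the interior of every triangle at `v`.
  have hreg := hK.region_mem_nhds hB hD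
    (mem_region.2 ⟨t₀, ht₀, subset_convexHull ℝ _ hv₀⟩) hvD
  have hint : (interior (convexHull ℝ (t : Set Plane))).Nonempty := by
    rw [interior_cell ht]; exact openHull_nonempty ht.1
  have hcl : v ∈ closure (interior (convexHull ℝ (t : Set Plane))) := by
    rw [(convex_convexHull ℝ _).closure_interior_eq_closure_of_nonempty_interior hint]
    exact subset_closure (subset_convexHull ℝ _ hvt)
  obtain ⟨z, hz, hzt⟩ := mem_closure_iff_nhds.1 hcl _ hreg
  rw [interior_cell ht] at hzt
  obtain ⟨t', ht', hzt'⟩ := mem_region.1 hz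
  have hs := subset_of_mem_openHull ht.1 (hB ht').1 hzt hzt'
  rwa [Finset.eq_of_subset_of_card_le hs (by rw [ht.2, (hB ht').2])]

lemma exists_other_cell {A : Set (Finset Plane)} {e : Sym2 Plane} (he : e ∉ bd A)
    {t : Finset Plane} (ht : t ∈ A) (het : e ∈ cellEdges t) :
    ∃ t' ∈ A, t' ≠ t ∧ e ∈ cellEdges t' := by
  by_contra hcon
  push Not at hcon
  exact he ⟨t, ⟨ht, het⟩, fun t' ht' => by_contra fun h => hcon t' ht'.1 h ht'.2⟩

lemma bd_inter_subset {A B : Set (Finset Plane)} (hA : A ⊆ cells K) (hB : B ⊆ cells K) :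
    bd (A ∩ B) ⊆ bd A ∪ bd B := by
  rintro e ⟨t, ⟨ht, he⟩, hu⟩
  by_contra hcon
  rw [Set.mem_union, not_or] at hcon
  obtain ⟨t', ht', hne, he'⟩ := exists_other_cell hcon.1 ht.1 he
  exact hne (hu t' ⟨⟨ht', (mem_iff_of_not_mem_bd hB (hA ht.1) (hA ht') hcon.2 he he').1 ht.2⟩, he'⟩)

lemma bd_diff_subset {A B : Set (Finset Plane)} (hA : A ⊆ cells K) (hB : B ⊆ cells K) :
    bd (A \ B) ⊆ bd A ∪ bd B := by
  rintro e ⟨t, ⟨ht, he⟩, hu⟩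
  by_contra hcon
  rw [Set.mem_union, not_or] at hcon
  obtain ⟨t', ht', hne, he'⟩ := exists_other_cell hcon.1 ht.1 he
  exact hne (hu t' ⟨⟨ht', fun h =>
    ht.2 ((mem_iff_of_not_mem_bd hB (hA ht.1) (hA ht') hcon.2 he he').2 h)⟩, he'⟩)

/-- An edge of `t` off the boundary has a second triangle in `A`, which is left alone at this edge
when `t` is removed. -/
lemma bd_diff_singleton {A : Set (Finset Plane)} (hA : A ⊆ cells K) {t : Finset Plane}
    (ht : t ∈ A) (e : Sym2 Plane) :
    e ∈ bd (A \ {t}) ↔ (e ∈ bd A ∧ e ∉ cellEdges t) ∨ (e ∉ bd A ∧ e ∈ cellEdges t) := by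
  by_cases he : e ∈ cellEdges t
  · simp only [he, not_true_eq_false, and_false, and_true, false_or]
    constructor
    · rintro ⟨t', ⟨ht', he'⟩, -⟩ h
      exact ht'.2 (h.unique ⟨ht'.1, he'⟩ ⟨ht, he⟩)
    · intro h
      obtain ⟨t', ht', hne, he'⟩ := exists_other_cell h ht he
      exact ⟨t', ⟨⟨ht', hne⟩, he'⟩, fun t'' ht'' =>
        cell_unique' (hA ht) (hA ht''.1.1) (hA ht') he ht''.2 he' ht''.1.2 hne⟩
  · simp only [he, not_false_eq_true, and_true, and_false, or_false]
    have : ∀ t', (t' ∈ A \ {t} ∧ e ∈ cellEdges t') ↔ (t' ∈ A ∧ e ∈ cellEdges t') := fun t' =>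
      ⟨fun h => ⟨h.1.1, h.2⟩, fun h => ⟨⟨h.1, fun h' => he (h' ▸ h.2)⟩, h.2⟩⟩
    simp only [bd, Set.mem_ofPred_eq, this]

lemma mem_bd_of_subset {A B : Set (Finset Plane)} (h : B ⊆ A) {e : Sym2 Plane} (he : e ∈ bd A)
    {t : Finset Plane} (ht : t ∈ B) (het : e ∈ cellEdges t) : e ∈ bd B :=
  ⟨t, ⟨ht, het⟩, fun _ ht' => he.unique ⟨h ht'.1, ht'.2⟩ ⟨h ht, het⟩⟩

lemma mem_cellEdges_triple {x y w : Plane} (hxy : x ≠ y) (hwx : w ≠ x) (hwy : w ≠ y)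
    (e : Sym2 Plane) :
    e ∈ cellEdges {x, y, w} ↔ e = s(x, y) ∨ e = s(x, w) ∨ e = s(y, w) := by
  induction e using Sym2.ind with | _ a b => ?_
  rw [mem_cellEdges_iff]
  simp only [Finset.mem_insert, Finset.mem_singleton, Sym2.eq_iff]
  constructor
  · rintro ⟨h, rfl | rfl | rfl, rfl | rfl | rfl⟩ <;> simp_all
  · rintro ((⟨rfl, rfl⟩ | ⟨rfl, rfl⟩) | (⟨rfl, rfl⟩ | ⟨rfl, rfl⟩) | (⟨rfl, rfl⟩ | ⟨rfl, rfl⟩)) <;>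
      simp_all [Ne.symm]

/-- The vertices of a set of triangles. -/
def cellVertices (A : Set (Finset Plane)) : Set Plane := {v | ∃ t ∈ A, v ∈ t}

/-- `B` is the part of the set `A` bounded by `C` that is cut off by the chord `xz`. -/
structure IsPiece (C : (graph K).Subgraph) (A : Set (Finset Plane)) (x z : Plane)
    (B : Set (Finset Plane)) : Prop where
  subset : B ⊆ A
  mem_bd : s(x, z) ∈ bd B
  bd_subset : bd B ⊆ insert s(x, z) C.edgeSet
  not_adj : ¬ C.Adj x z

variable {C : (graph K).Subgraph} {A B : Set (Finset Plane)} {x z : Plane}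

lemma IsPiece.not_mem_bd (h : IsPiece C A x z B) (hbd : bd A = C.edgeSet) : s(x, z) ∉ bd A := by
  rw [hbd]; exact h.not_adj

/-- The chord is not on the boundary of `A`, so its second triangle is in `A` as well, on the other
side of the chord. -/
lemma IsPiece.compl (h : IsPiece C A x z B) (hA : A ⊆ cells K) (hbd : bd A = C.edgeSet) :
    IsPiece C A x z (A \ B) := by
  refine ⟨Set.sdiff_subset, ?_, ?_, h.not_adj⟩
  · obtain ⟨t, ⟨ht, he⟩, hu⟩ := h.mem_bd
    obtain ⟨t', ht', hne, he'⟩ := exists_other_cell (h.not_mem_bd hbd) (h.subset ht) he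
    refine ⟨t', ⟨⟨ht', fun h' => hne (hu t' ⟨h', he'⟩)⟩, he'⟩, fun t'' ht'' => ?_⟩
    exact cell_unique' (hA (h.subset ht)) (hA ht''.1.1) (hA ht') he ht''.2 he'
      (fun h' => ht''.1.2 (h' ▸ ht)) hne
  · intro e he
    rcases bd_diff_subset hA (h.subset.trans hA) he with h' | h'
    · exact Or.inr (hbd ▸ h')
    · exact h.bd_subset h'

/-- A piece and the rest have only the ends of the chord in common. -/
lemma IsPiece.separates (h : IsPiece C A x z B) (hK : Good c r K) (hC : IsSimpleCycle C)
    (hA : A ⊆ cells K) (hbd : bd A = C.edgeSet) {v : Plane} (h1 : v ∈ cellVertices B)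
    (h2 : v ∈ cellVertices (A \ B)) : v = x ∨ v = z := by
  by_contra hcon
  push Not at hcon
  have h' := h.compl hA hbd
  obtain ⟨t₁, ht₁, hv₁⟩ := h1
  obtain ⟨t₂, ht₂, hv₂⟩ := h2
  have hchord : ∀ u, s(v, u) ≠ s(x, z) := by
    intro u hu
    rw [Sym2.eq_iff] at hu
    rcases hu with hu | hu
    · exact hcon.1 hu.1
    · exact hcon.2 hu.1
  -- A set of triangles without a boundary edge at its vertex `v` contains all triangles at `v`. So
  -- both parts have a boundary edge at `v`, and it lies on `C`.
  have k1 : ∃ u, s(v, u) ∈ bd B := by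
    by_contra hno
    push Not at hno
    exact ht₂.2 (hK.mem_of_vertex (h.subset.trans hA) ht₁ hv₁ hno (hA ht₂.1) hv₂)
  have k2 : ∃ u, s(v, u) ∈ bd (A \ B) := by
    by_contra hno
    push Not at hno
    exact (hK.mem_of_vertex (h'.subset.trans hA) ht₂ hv₂ hno (hA (h.subset ht₁)) hv₁).2 ht₁
  obtain ⟨u, hu⟩ := k1
  obtain ⟨u', hu'⟩ := k2
  have cu : C.Adj v u := (h.bd_subset hu).resolve_left (hchord u)
  have cu' : C.Adj v u' := (h'.bd_subset hu').resolve_left (hchord u')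
  have key : s(v, u') ∉ bd B := by
    rintro ⟨t, ht, -⟩
    obtain ⟨t', ht', -⟩ := hu'
    have : s(v, u') ∈ bd A := hbd ▸ cu'
    exact ht'.1.2 (this.unique ⟨ht'.1.1, ht'.2⟩ ⟨h.subset ht.1, ht.2⟩ ▸ ht.1)
  obtain ⟨q, hq, cq, hall⟩ := hC.exists_other cu
  have huq : u' = q := (hall u' cu').resolve_left fun e => key (e ▸ hu)
  subst huq
  -- The two edges of `C` at `v` are split between the parts, so `B` would have a single boundary
  -- edge at `v`, against parity.
  exact key ((even_bd hK.finite (h.subset.trans hA) hq.symm fun w hw =>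
    hall w ((h.bd_subset hw).resolve_left (hchord w))).1 hu)

/-- The chord is one boundary edge of `B` at `x`; by parity there is another, and it lies on `C`. -/
lemma IsPiece.exists_adj (h : IsPiece C A x z B) (hK : Good c r K) (hC : IsSimpleCycle C)
    (hA : A ⊆ cells K) (hx : x ∈ C.verts) : ∃ y, C.Adj x y ∧ s(x, y) ∈ bd B := by
  by_contra hno
  push Not at hno
  obtain ⟨y, hy⟩ := hC.exists_adj hx
  refine hno y hy ((even_bd hK.finite (h.subset.trans hA) (by rintro rfl; exact h.not_adj hy)
    fun u hu => ?_).1 h.mem_bd)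
  rcases h.bd_subset hu with h' | h'
  · left
    rw [Sym2.eq_iff] at h'
    rcases h' with h' | h'
    · exact h'.2
    · exact h'.2.trans h'.1
  · exact absurd hu (hno u h')

/-- The complementary piece also has an edge of `C` at `x`, which uses up the second of the two
edges. -/
lemma IsPiece.exists_unique_adj (h : IsPiece C A x z B) (hK : Good c r K) (hC : IsSimpleCycle C)
    (hA : A ⊆ cells K) (hbd : bd A = C.edgeSet) (hx : x ∈ C.verts) :
    ∃ y, C.Adj x y ∧ s(x, y) ∈ bd B ∧ ∀ y', C.Adj x y' → s(x, y') ∈ bd B → y' = y := by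
  obtain ⟨y, hy, hyB⟩ := h.exists_adj hK hC hA hx
  obtain ⟨y', hy', hyB'⟩ := (h.compl hA hbd).exists_adj hK hC hA hx
  have key : s(x, y') ∉ bd B := by
    rintro ⟨t, ht, -⟩
    obtain ⟨t', ht', -⟩ := hyB'
    have : s(x, y') ∈ bd A := hbd ▸ hy'
    exact ht'.1.2 (this.unique ⟨ht'.1.1, ht'.2⟩ ⟨h.subset ht.1, ht.2⟩ ▸ ht.1)
  refine ⟨y, hy, hyB, fun u hu huB => ?_⟩
  obtain ⟨q, hq, cq, hall⟩ := hC.exists_other hy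
  have hq' : y' = q := (hall y' hy').resolve_left fun e => key (e ▸ hyB)
  exact (hall u hu).resolve_right fun e => key (hq' ▸ e ▸ huB)

/-- The chord and a path on `C` between its ends form a closed trail, which bounds a set of
triangles; its intersection with `A` is the piece. -/
lemma exists_isPiece (hK : Good c r K) (hC : IsSimpleCycle C) (hA : A ⊆ cells K)
    (hbd : bd A = C.edgeSet) (hx : x ∈ C.verts) (hz : z ∈ C.verts) (hxz : ¬ C.Adj x z)
    {t : Finset Plane} (ht : t ∈ A) (het : s(x, z) ∈ cellEdges t) :
    ∃ B, IsPiece C A x z B := by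
  classical
  have hconn : C.Preconnected := by
    obtain ⟨u, w, hw, rfl⟩ := hC
    exact w.toSubgraph_connected.preconnected
  obtain ⟨p, hp⟩ := (SimpleGraph.Subgraph.preconnected_iff_forall_exists_walk_subgraph _).1
    hconn hz hx
  have hpC : ∀ e ∈ p.bypass.edges, e ∈ C.edgeSet := fun e he =>
    SimpleGraph.Subgraph.edgeSet_mono hp
      ((p.mem_edges_toSubgraph).2 (p.edges_bypass_subset_edges he))
  have hadj := graph_adj_of_mem_cells (hA ht) het
  have htr : (SimpleGraph.Walk.cons hadj p.bypass).IsTrail := by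
    rw [SimpleGraph.Walk.isTrail_cons]
    exact ⟨p.bypass_isPath.isTrail, fun h => hxz (hpC _ h)⟩
  obtain ⟨A₁, hA₁, he⟩ := exists_bd_of_isTrail hK.potential htr
  have hbd₁ : bd A₁ ⊆ insert s(x, z) C.edgeSet := by
    intro e h
    rw [he, SimpleGraph.Walk.edges_cons, List.mem_cons] at h
    exact h.imp id fun h => hpC e h
  refine ⟨A ∩ A₁, Set.inter_subset_left, ?_, ?_, hxz⟩
  · have : s(x, z) ∈ bd A₁ := by rw [he]; simp
    obtain ⟨u, ⟨hu, hue⟩, huu⟩ := this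
    have huA : u ∈ A := (mem_iff_of_not_mem_bd hA (hA ht) (hA₁ hu)
      (by rw [hbd]; exact hxz) het hue).1 ht
    exact ⟨u, ⟨⟨huA, hu⟩, hue⟩, fun u' hu' => huu u' ⟨hu'.1.2, hu'.2⟩⟩
  · refine (bd_inter_subset hA hA₁).trans (Set.union_subset ?_ hbd₁)
    rw [hbd]; exact Set.subset_insert _ _

end

end DiscretePlane

namespace DiscretePlane

open Geometry SimpleGraph

/-! ### Removing a triangle along a simple cycle -/

section

variable {K : SimplicialComplex ℝ Plane} {C C' : (graph K).Subgraph} {x y z w : Plane}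

lemma IsSimpleCycle.exists_path (hC : IsSimpleCycle C) (h : C.Adj x y) :
    ∃ q : (graph K).Walk y x, q.IsPath ∧ s(x, y) ∉ q.edges ∧
      (∀ e, e ∈ C.edgeSet ↔ e = s(x, y) ∨ e ∈ q.edges) ∧ ∀ v, v ∈ C.verts ↔ v ∈ q.support := by
  classical
  have key : ∀ v : (graph K).Walk x x, v.IsCycle → v.toSubgraph = C → v.snd = y →
      ∃ q : (graph K).Walk y x, q.IsPath ∧ s(x, y) ∉ q.edges ∧
      (∀ e, e ∈ C.edgeSet ↔ e = s(x, y) ∨ e ∈ q.edges) ∧ ∀ v, v ∈ C.verts ↔ v ∈ q.support := by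
    rintro v hv rfl hy
    cases v with
    | nil => exact absurd rfl hv.ne_nil
    | cons hadj q =>
      rw [Walk.snd_cons] at hy
      subst hy
      rw [Walk.cons_isCycle_iff] at hv
      refine ⟨q, hv.1, hv.2, fun e => ?_, fun v => ?_⟩
      · rw [Walk.mem_edges_toSubgraph, Walk.edges_cons, List.mem_cons]
      · rw [Walk.mem_verts_toSubgraph, Walk.support_cons, List.mem_cons]
        exact ⟨fun h => h.elim (fun h => h ▸ q.end_mem_support) id, Or.inr⟩
  obtain ⟨u, v, hv, rfl⟩ := hC
  have hx : x ∈ v.support := (v.mem_verts_toSubgraph).1 h.fst_mem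
  have hv' := hv.rotate hx
  have hsub := v.toSubgraph_rotate hx
  have hn := hv'.neighborSet_toSubgraph_endpoint
  have hy : y ∈ (v.rotate x hx).toSubgraph.neighborSet x := by rw [hsub]; exact h
  rw [hn] at hy
  rcases hy with hy | hy
  · exact key _ hv' hsub hy.symm
  · refine key _ hv'.reverse ((Walk.toSubgraph_reverse _).trans hsub) ?_
    rw [Walk.snd_reverse]; exact hy.symm

lemma IsSimpleCycle.exists_detour (hC : IsSimpleCycle C) (h : C.Adj x y) (hw : w ∉ C.verts)
    (hxw : (graph K).Adj x w) (hyw : (graph K).Adj y w) :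
    ∃ C' : (graph K).Subgraph, IsSimpleCycle C' ∧ C'.verts = insert w C.verts ∧
      ∀ e, e ∈ C'.edgeSet ↔ (e ∈ C.edgeSet ∧ e ≠ s(x, y)) ∨ e = s(x, w) ∨ e = s(y, w) := by
  obtain ⟨q, hq, hxy, he, hv⟩ := hC.exists_path h
  have hwq : w ∉ q.support := fun h' => hw ((hv w).2 h')
  refine ⟨_, ⟨x, .cons hxw (.cons hyw.symm q), ?_, rfl⟩, ?_, fun e => ?_⟩
  · rw [Walk.cons_isCycle_iff, Walk.cons_isPath_iff, Walk.edges_cons, List.mem_cons]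
    refine ⟨⟨hq, hwq⟩, ?_⟩
    rintro (h' | h')
    · rw [Sym2.eq_iff] at h'
      rcases h' with h' | h'
      · exact hxw.ne h'.1
      · exact h.ne h'.1
    · exact hwq (q.snd_mem_support_of_mem_edges h')
  · ext v
    rw [Walk.mem_verts_toSubgraph, Walk.support_cons, Walk.support_cons, List.mem_cons,
      List.mem_cons, Set.mem_insert_iff, hv]
    exact ⟨fun h' => h'.elim (fun h' => Or.inr (h' ▸ q.end_mem_support)) id, Or.inr⟩
  · rw [Walk.mem_edges_toSubgraph, Walk.edges_cons, Walk.edges_cons, List.mem_cons,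
      List.mem_cons, he, Sym2.eq_swap (a := w)]
    constructor
    · rintro (h' | h' | h')
      · exact Or.inr (Or.inl h')
      · exact Or.inr (Or.inr h')
      · exact Or.inl ⟨Or.inr h', fun h'' => hxy (h'' ▸ h')⟩
    · rintro (⟨h' | h', h''⟩ | h' | h')
      · exact absurd h' h''
      · exact Or.inr (Or.inr h')
      · exact Or.inl h'
      · exact Or.inr (Or.inl h')

lemma IsSimpleCycle.exists_shortcut (hC : IsSimpleCycle C) (h1 : C.Adj y x) (h2 : C.Adj y z)
    (hxz : (graph K).Adj x z) (hn : ¬ C.Adj x z) :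
    ∃ C' : (graph K).Subgraph, IsSimpleCycle C' ∧ C'.verts = C.verts \ {y} ∧
      ∀ e, e ∈ C'.edgeSet ↔ (e ∈ C.edgeSet ∧ e ≠ s(y, x) ∧ e ≠ s(y, z)) ∨ e = s(x, z) := by
  obtain ⟨q, hq, hxy, he, hv⟩ := hC.exists_path h1.symm
  have hz := (he s(y, z)).1 h2
  have hz : s(y, z) ∈ q.edges := hz.resolve_left fun h => by
    rw [Sym2.eq_iff] at h
    rcases h with h | h
    · exact h1.ne h.1
    · exact hxz.ne h.2.symm
  cases q with
  | nil => exact absurd rfl h1.ne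
  | @cons _ v _ hyv q =>
    rw [Walk.cons_isPath_iff] at hq
    rw [Walk.edges_cons, List.mem_cons] at hz hxy
    push Not at hxy
    have hzv : z = v := by
      rcases hz with h | h
      · rw [Sym2.congr_right] at h; exact h
      · exact absurd (q.fst_mem_support_of_mem_edges h) hq.2
    subst hzv
    refine ⟨_, ⟨x, .cons hxz q, ?_, rfl⟩, ?_, fun e => ?_⟩
    · rw [Walk.cons_isCycle_iff]
      exact ⟨hq.1, fun h => hn ((he s(x, z)).2 (Or.inr (List.mem_cons_of_mem _ h)))⟩
    · ext v
      rw [Walk.mem_verts_toSubgraph, Walk.support_cons, List.mem_cons, Set.mem_sdiff, hv,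
        Walk.support_cons, List.mem_cons, Set.mem_singleton_iff]
      constructor
      · rintro (rfl | h)
        · exact ⟨Or.inr q.end_mem_support, h1.ne.symm⟩
        · exact ⟨Or.inr h, fun e => hq.2 (e ▸ h)⟩
      · rintro ⟨h | h, h'⟩
        · exact absurd h h'
        · exact Or.inr h
    · rw [Walk.mem_edges_toSubgraph, Walk.edges_cons, List.mem_cons, he, Walk.edges_cons,
        List.mem_cons]
      constructor
      · rintro (h | h)
        · exact Or.inr h
        · refine Or.inl ⟨Or.inr (Or.inr h), fun h' => hxy.2 ?_, fun h' => ?_⟩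
          · rw [Sym2.eq_swap, ← h']; exact h
          · exact hq.2 (q.fst_mem_support_of_mem_edges (h' ▸ h))
      · rintro (⟨h | h | h, h', h''⟩ | h)
        · exact absurd (h.trans Sym2.eq_swap) h'
        · exact absurd h h''
        · exact Or.inr h
        · exact Or.inl h

/-- Running along a simple cycle, one returns to the second vertex only via the first edge. -/
lemma IsSimpleCycle.run_ne (hC : IsSimpleCycle C) {f : ℕ → Plane} {k : ℕ} (hk : 1 ≤ k)
    (hadj : ∀ i ≤ k, C.Adj (f i) (f (i + 1))) (hne : ∀ i < k, f i ≠ f (i + 2))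
    (hfst : ∀ i, 1 ≤ i → i ≤ k → s(f i, f (i + 1)) ≠ s(f 0, f 1)) : f (k + 1) ≠ f 1 := by
  obtain ⟨q, hq, hxy, he, hv⟩ := hC.exists_path (hadj 0 (Nat.zero_le k))
  -- Deleting the first edge leaves a path `q` from `f 1` to `f 0`, and the run follows it: `f (i +
  -- 1)` is its vertex number `i`. So `f (k + 1) = f 1` would mean `k = 0`.
  have key : ∀ i, i ≤ k → i ≤ q.length ∧ f (i + 1) = q.getVert i ∧
      (i + 1 ≤ k → i < q.length ∧ f (i + 2) = q.getVert (i + 1)) := by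
    intro i
    induction i with
    | zero =>
      intro _
      refine ⟨Nat.zero_le _, by simp, fun h1 => ?_⟩
      have hm : s(f 1, f 2) ∈ q.edges :=
        ((he _).1 (hadj 1 h1)).resolve_left (hfst 1 le_rfl h1)
      have hs := hq.eq_snd_of_mem_edges hm
      refine ⟨?_, hs⟩
      by_contra h0
      have : q.edges.length = 0 := by rw [Walk.length_edges]; omega
      rw [List.length_eq_zero_iff.1 this] at hm
      simp at hm
    | succ i ih =>
      intro hi
      obtain ⟨-, h2, h3⟩ := ih (by omega)
      obtain ⟨h4, h5⟩ := h3 hi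
      refine ⟨h4, h5, fun h6 => ?_⟩
      have hm : s(f (i + 2), f (i + 3)) ∈ q.toSubgraph.edgeSet :=
        (q.mem_edges_toSubgraph).2 (((he _).1 (hadj (i + 2) h6)).resolve_left
          (hfst (i + 2) (by omega) h6))
      obtain ⟨j, hj, hjl⟩ := (Walk.toSubgraph_adj_iff q).1 hm
      have inj : ∀ a b, a ≤ q.length → b ≤ q.length → q.getVert a = q.getVert b → a = b :=
        fun a b ha hb h => hq.getVert_injOn ha hb h
      rw [h5, Sym2.eq_iff] at hj
      rcases hj with ⟨h7, h8⟩ | ⟨h7, h8⟩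
      · have := inj _ _ (by omega) h4 h7
        subst this
        exact ⟨hjl, h8.symm⟩
      -- The run would turn back along its last edge, which `hne` forbids.
      · have := inj _ _ (by omega) h4 h8
        obtain rfl : j = i := by omega
        exact absurd (h2.trans h7) (hne (j + 1) h6)
  obtain ⟨h1, h2, -⟩ := key k le_rfl
  intro h
  rw [h2] at h
  have h3 : q.getVert k = q.getVert 0 := by rw [h]; simp
  have := hq.getVert_injOn h1 (show 0 ∈ {i | i ≤ q.length} by simp) h3
  omega

/-- Replacing an edge by the two other edges of a triangle does not lead to a crossing. -/
lemma IsSimpleCycle.not_crossOver_detour (hC : IsSimpleCycle C) (h : C.Adj x y)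
    (hw : w ∉ C.verts) (ht : {x, y, w} ∈ cells K)
    (he : ∀ e, e ∈ C'.edgeSet ↔ (e ∈ C.edgeSet ∧ e ≠ s(x, y)) ∨ e = s(x, w) ∨ e = s(y, w)) :
    ¬ CrossOver C C' := by
  rintro ⟨k, f, a', t', h1, h2, h3, h4, h5, h6, h7, h8, h9, h10⟩
  have hold : ∀ a b, C.Adj a b → ¬ C'.Adj a b → s(a, b) = s(x, y) := by
    intro a b hab hn
    by_contra hc
    exact hn ((he s(a, b)).2 (Or.inl ⟨hab, hc⟩))
  have hnew : ∀ a b, C'.Adj a b → ¬ C.Adj a b → b ∈ C.verts → a = w := by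
    intro a b hab hn hb
    rcases (he s(a, b)).1 hab with h' | h' | h'
    · exact absurd h'.1 hn
    all_goals
      rw [Sym2.eq_iff] at h'
      rcases h' with h' | h'
      · exact absurd (h'.2 ▸ hb) hw
      · exact h'.1
  -- The only edge of `C` missing in `C'` is `x y`, so it is both the first and the last edge of the
  -- sequence, and both new neighbours are the third vertex of the triangle.
  have e0 := hold _ _ (h1 0 (Nat.zero_le _)) h4
  have e1 := hold _ _ (h1 (k + 1) le_rfl) h5
  obtain rfl := hnew _ _ h6 h7 (h1 0 (Nat.zero_le _)).snd_mem
  obtain rfl := hnew _ _ h8.symm (fun h' => h9 h'.symm) (h1 (k + 1) le_rfl).fst_mem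
  rcases Nat.eq_zero_or_pos k with rfl | hk
  · have e2 : s(f 0, f 1) = s(f 1, f 2) := e0.trans e1.symm
    rw [Sym2.eq_iff] at e2
    rcases e2 with e2 | e2
    · exact (h1 0 (Nat.zero_le _)).ne e2.1
    · exact h2 0 le_rfl e2.1
  have hrun := hC.run_ne (f := f) hk (fun i hi => h1 i (by omega)) (fun i hi => h2 i (by omega))
    fun i hi hik h' => by
      have := (he s(f i, f (i + 1))).1 (h3 i hi hik)
      rcases this with h'' | h'' | h''
      · exact h''.2 (h'.trans e0)
      all_goals
        rw [← h', h''] at e0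
        rw [Sym2.eq_iff] at e0
        have c1 := h.fst_mem
        have c2 := h.snd_mem
        rcases e0 with e0 | e0 <;> exact hw (by simp_all)
  -- The common stretch is the whole rest of the cycle: it runs from `f 1` round to `f (k + 1) = f
  -- 0`.
  have e2 : s(f (k + 1), f (k + 2)) = s(f 0, f 1) := e1.trans e0.symm
  rw [Sym2.eq_iff] at e2
  obtain ⟨e2, e3⟩ := e2.resolve_right fun e2 => hrun e2.1
  have hcell : {f 1, f 0, t'} ∈ cells K := by
    rw [Sym2.eq_iff] at e0
    rcases e0 with ⟨rfl, rfl⟩ | ⟨rfl, rfl⟩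
    · rwa [Finset.insert_comm]
    · exact ht
  have c1 := h1 1 (by omega)
  have ck := h1 k (by omega)
  rw [e2] at ck
  have hnw : ∀ {v}, v ∈ C.verts → v ≠ t' := fun hv h' => hw (h' ▸ hv)
  -- At both ends the side is the orientation of the same triangle, read from two of its vertices.
  apply h10
  rw [e2, e3, leftOf_iff_of_cell_left hcell (graph_adj_iff.1 (C.adj_sub c1)).2 c1.ne.symm
    (fun e => h2 0 (Nat.zero_le _) e.symm) (hnw c1.snd_mem),
    leftOf_iff_of_cell_right (by rwa [Finset.insert_comm])
    (pair_face_swap (graph_adj_iff.1 (C.adj_sub ck)).2)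
    ck.ne (fun e => h2 k le_rfl (e.trans e3.symm)) (hnw ck.fst_mem), cross_rot (f 0)]

/-- Replacing two edges of a triangle by the third one does not lead to a crossing. -/
lemma IsSimpleCycle.not_crossOver_shortcut (hC : IsSimpleCycle C) (h1 : C.Adj y x)
    (h2 : C.Adj y z) (hxz : x ≠ z) (hn : ¬ C.Adj x z) (ht : {x, y, z} ∈ cells K)
    (he : ∀ e, e ∈ C'.edgeSet ↔ (e ∈ C.edgeSet ∧ e ≠ s(y, x) ∧ e ≠ s(y, z)) ∨ e = s(x, z)) :
    ¬ CrossOver C C' := by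
  rintro ⟨k, f, a', t', k1, k2, k3, k4, k5, k6, k7, k8, k9, k10⟩
  have hold : ∀ a b, C.Adj a b → ¬ C'.Adj a b → b ≠ y → a = y ∧ (b = x ∨ b = z) := by
    intro a b hab hn hb
    by_cases e1 : s(a, b) = s(y, x)
    · rw [Sym2.eq_iff] at e1
      rcases e1 with e1 | e1
      · exact ⟨e1.1, Or.inl e1.2⟩
      · exact absurd e1.2 hb
    by_cases e2 : s(a, b) = s(y, z)
    · rw [Sym2.eq_iff] at e2
      rcases e2 with e2 | e2
      · exact ⟨e2.1, Or.inr e2.2⟩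
      · exact absurd e2.2 hb
    exact absurd ((he s(a, b)).2 (Or.inl ⟨hab, e1, e2⟩)) hn
  have hnew : ∀ a b, C'.Adj a b → ¬ C.Adj a b → (a = x ∧ b = z) ∨ (a = z ∧ b = x) := by
    intro a b hab hn
    have h' := ((he s(a, b)).1 hab).resolve_left fun h' => hn h'.1
    rwa [Sym2.eq_iff] at h'
  -- The only new edge is `x z`, so both ends of the stretch are in `{x, z}` and the new neighbour
  -- is the other of these points.
  have n1 := hnew _ _ k6 k7
  have n2 := hnew _ _ k8 k9
  have m1 : f 1 ≠ y := by
    rcases n1 with ⟨-, e⟩ | ⟨-, e⟩ <;> rw [e]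
    · exact h2.ne.symm
    · exact h1.ne.symm
  have m2 : f (k + 1) ≠ y := by
    rcases n2 with ⟨e, -⟩ | ⟨e, -⟩ <;> rw [e]
    · exact h1.ne.symm
    · exact h2.ne.symm
  -- The edges of `C` missing in `C'` both contain `y`, so the sequence starts and ends at `y`, and
  -- the stretch is the rest of the cycle between `x` and `z`.
  obtain ⟨p1, -⟩ := hold _ _ (k1 0 (Nat.zero_le _)) k4 m1
  obtain ⟨p2, -⟩ := hold _ _ (k1 (k + 1) le_rfl).symm (fun h => k5 h.symm) m2
  change f 0 = y at p1
  change f (k + 2) = y at p2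
  rcases Nat.eq_zero_or_pos k with rfl | hk
  · exact k2 0 le_rfl (p1.trans p2.symm)
  have hrun := hC.run_ne (f := f) hk (fun i hi => k1 i (by omega)) (fun i hi => k2 i (by omega))
    fun i hi hik h' => by
      rw [p1] at h'
      have h3 := (he s(f i, f (i + 1))).1 (k3 i hi hik)
      rw [h'] at h3
      rcases h3 with h'' | h''
      · rcases n1 with ⟨-, e⟩ | ⟨-, e⟩ <;> rw [e] at h''
        · exact h''.2.2 rfl
        · exact h''.2.1 rfl
      · rw [Sym2.eq_iff] at h''
        rcases h'' with h'' | h''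
        · exact h1.ne h''.1
        · exact h2.ne h''.1
  -- the two ends of the common stretch and the new neighbours there
  have hcell : {f 1, y, f (k + 1)} ∈ cells K ∧ a' = f (k + 1) ∧ t' = f 1 ∧
      ¬ C.Adj (f 1) (f (k + 1)) := by
    rcases n1 with ⟨rfl, e⟩ | ⟨rfl, e⟩ <;> rcases n2 with ⟨e', rfl⟩ | ⟨e', rfl⟩
    · rw [e, e']; exact ⟨cell_rot (cell_perm ht), rfl, rfl, fun h => hn h.symm⟩
    · exact absurd (e'.trans e.symm) hrun
    · exact absurd (e'.trans e.symm) hrun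
    · rw [e, e']; exact ⟨ht, rfl, rfl, hn⟩
  obtain ⟨hcell, rfl, rfl, hnadj⟩ := hcell
  have c1 := k1 1 (by omega)
  have ck := k1 k (by omega)
  apply k10
  rw [p1, p2, leftOf_iff_of_cell_left hcell (graph_adj_iff.1 (C.adj_sub c1)).2 c1.ne.symm
    (fun e => k2 0 (Nat.zero_le _) (p1.trans e.symm)) (fun e => hnadj (e ▸ c1)),
    leftOf_iff_of_cell_right (b := y) (p := f (k + 1)) (x := f 1)
    (by rw [Finset.insert_comm]; exact cell_rot hcell)
    (pair_face_swap (graph_adj_iff.1 (C.adj_sub ck)).2)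
    ck.ne (fun e => k2 k le_rfl (e.trans p2.symm)) (fun e => hnadj (e ▸ ck)), cross_rot]

end

end DiscretePlane

namespace DiscretePlane

open Geometry SimpleGraph

/-! ### Contracting a simple cycle by removing farthest triangles -/

section

variable {K : SimplicialComplex ℝ Plane} {c : Plane} {r : ℝ}

/-- `x` is a vertex of `C` at the largest distance from `p` in the region enclosed by `C`. -/
def IsFarthest (C : (graph K).Subgraph) (p x : Plane) : Prop :=
  x ∈ C.verts ∧ ∀ y ∈ C.verts, (regionGraph C).edist p y ≤ (regionGraph C).edist p x

/-- A step of a contraction of `C` to `p`. -/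
structure IsContractionStep (p : Plane) (C C' : (graph K).Subgraph) : Prop where
  removal : IsFarthestRemoval p C C'
  side : SideGraduallyVaried C C'
  mem : p ∈ C'.verts
  simple_or : IsSimpleCycle C' ∨ C' = (graph K).singletonSubgraph p

variable {C C' : (graph K).Subgraph} {A B : Set (Finset Plane)} {p x y z w : Plane}

lemma graduallyVaried_of_xorSum {t : Finset Plane} (ht : t ∈ cells K)
    (hsub : (t : Set Plane) ⊆ C.verts ∪ C'.verts) (h : xorSum C C' = cellEdges t) :
    GraduallyVaried C C' := by
  refine ⟨{t}, by simpa using ⟨ht, hsub⟩, fun e => ?_⟩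
  rw [h]
  by_cases he : e ∈ cellEdges t
  · have : {t' ∈ (({t} : Finset (Finset Plane)) : Set (Finset Plane)) | e ∈ cellEdges t'} = {t} := by
      ext t'; simp only [Finset.coe_singleton, Set.mem_singleton_iff, Set.mem_ofPred_eq]
      exact ⟨fun h => h.1, fun h => ⟨h, h ▸ he⟩⟩
    rw [this]; simpa using he
  · have : {t' ∈ (({t} : Finset (Finset Plane)) : Set (Finset Plane)) | e ∈ cellEdges t'} = ∅ := by
      ext t'; simp only [Finset.coe_singleton, Set.mem_singleton_iff, Set.mem_ofPred_eq,
        Set.mem_empty_iff_false, iff_false]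
      exact fun h => he (h.1 ▸ h.2)
    rw [this]; simpa using he

/-- Toggling the edges of `t` gives the boundary of `A \ {t}`, so by `Good.insideCells_eq`, applied
to both cycles, exactly `t` is lost from the enclosed triangles. -/
lemma IsContractionStep.of_edges (hK : Good c r K) (hr : 0 < r) (hC : IsSimpleCycle C)
    (hA : A ⊆ cells K) (hbd : bd A = C.edgeSet) {t : Finset Plane} (ht : t ∈ A)
    (hC' : IsSimpleCycle C') (he : ∀ e, e ∈ C'.edgeSet ↔
      (e ∈ C.edgeSet ∧ e ∉ cellEdges t) ∨ (e ∉ C.edgeSet ∧ e ∈ cellEdges t))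
    (hsub : (t : Set Plane) ⊆ C.verts ∪ C'.verts) (hx : IsFarthest C p x) (hxt : x ∈ t)
    (hcross : ¬ CrossOver C C') (hp : p ∈ C'.verts) : IsContractionStep p C C' := by
  have hxor : xorSum C C' = cellEdges t := by
    ext e
    simp only [xorSum, Set.mem_union, Set.mem_sdiff, he]
    tauto
  have h1 := hK.insideCells_eq hr hC hA hbd
  have h2 := hK.insideCells_eq hr hC' (A := A \ {t}) (Set.sdiff_subset.trans hA) (by
    ext e; rw [bd_diff_singleton hA ht, he, hbd])
  exact ⟨⟨t, h1 ▸ ht, by rw [h1, h2], hxor, x, hxt, hx.1, hx.2⟩,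
    ⟨graduallyVaried_of_xorSum (hA ht) hsub hxor, hcross⟩, hp, Or.inl hC'⟩

lemma exists_step_detour (hK : Good c r K) (hr : 0 < r) (hC : IsSimpleCycle C)
    (hA : A ⊆ cells K) (hbd : bd A = C.edgeSet) (ht : {x, y, w} ∈ A) (hxy : C.Adj x y)
    (hw : w ∉ C.verts) (hp : p ∈ C.verts) (hx : IsFarthest C p x) :
    ∃ C', IsContractionStep p C C' := by
  obtain ⟨nxy, nwx, nwy⟩ := card_of_cell (hA ht)
  have hc := mem_cellEdges_triple nxy nwx nwy
  have gx : (graph K).Adj x w := graph_adj_of_mem_cells (hA ht) ((hc _).2 (by simp))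
  have gy : (graph K).Adj y w := graph_adj_of_mem_cells (hA ht) ((hc _).2 (by simp))
  obtain ⟨C', hC', hv, he⟩ := hC.exists_detour hxy hw gx gy
  have hne : ∀ u, s(u, w) ∉ C.edgeSet := fun u h => hw (C.edge_vert h.symm)
  have hxyw : ∀ u, s(x, y) ≠ s(u, w) := fun u h => hne u (h ▸ hxy)
  refine ⟨C', .of_edges hK hr hC hA hbd ht hC' (fun e => ?_) ?_ hx (by simp)
    (hC.not_crossOver_detour hxy hw (hA ht) he) (by rw [hv]; exact Or.inr hp)⟩
  · rw [he, hc]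
    constructor
    · rintro (⟨h1, h2⟩ | rfl | rfl)
      · refine Or.inl ⟨h1, ?_⟩
        rintro (h | rfl | rfl)
        · exact h2 h
        · exact hne _ h1
        · exact hne _ h1
      · exact Or.inr ⟨hne _, by simp⟩
      · exact Or.inr ⟨hne _, by simp⟩
    · rintro (⟨h1, h2⟩ | ⟨h1, rfl | h2⟩)
      · exact Or.inl ⟨h1, fun h => h2 (Or.inl h)⟩
      · exact absurd hxy h1
      · exact Or.inr h2
  · rw [hv]
    intro u hu
    simp only [Finset.coe_insert, Finset.coe_singleton, Set.mem_insert_iff,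
      Set.mem_singleton_iff] at hu
    rcases hu with rfl | rfl | rfl
    · exact Or.inl hxy.fst_mem
    · exact Or.inl hxy.snd_mem
    · exact Or.inr (Or.inl rfl)

/-- The vertex `y` is lost, which is why it must differ from `p`. The farthest vertex may be any of
the three, since this is needed both for `x` and for `y` as the farthest one. -/
lemma exists_step_shortcut (hK : Good c r K) (hr : 0 < r) (hC : IsSimpleCycle C)
    (hA : A ⊆ cells K) (hbd : bd A = C.edgeSet) (ht : {x, y, z} ∈ A) (h1 : C.Adj y x)
    (h2 : C.Adj y z) (hn : ¬ C.Adj x z) (hp : p ∈ C.verts) (hpy : p ≠ y) {v : Plane}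
    (hv : IsFarthest C p v) (hvt : v ∈ ({x, y, z} : Finset Plane)) :
    ∃ C', IsContractionStep p C C' := by
  obtain ⟨nxy, nzx, nzy⟩ := card_of_cell (hA ht)
  have hc := mem_cellEdges_triple nxy nzx nzy
  have gx : (graph K).Adj x z := graph_adj_of_mem_cells (hA ht) ((hc _).2 (by simp))
  obtain ⟨C', hC', hv', he⟩ := hC.exists_shortcut h1 h2 gx hn
  refine ⟨C', .of_edges hK hr hC hA hbd ht hC' (fun e => ?_) ?_ hv hvt
    (hC.not_crossOver_shortcut h1 h2 nzx.symm hn (hA ht) he) (by rw [hv']; exact ⟨hp, hpy⟩)⟩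
  · rw [he, hc, Sym2.eq_swap (a := y) (b := x)]
    constructor
    · rintro (⟨k1, k2, k3⟩ | rfl)
      · refine Or.inl ⟨k1, ?_⟩
        rintro (h | rfl | h)
        · exact k2 h
        · exact hn k1
        · exact k3 h
      · exact Or.inr ⟨hn, by simp⟩
    · rintro (⟨k1, k2⟩ | ⟨k1, rfl | rfl | rfl⟩)
      · exact Or.inl ⟨k1, fun h => k2 (Or.inl h), fun h => k2 (Or.inr (Or.inr h))⟩
      · exact absurd h1.symm k1
      · exact Or.inr rfl
      · exact absurd h2 k1
  · intro u hu
    simp only [Finset.coe_insert, Finset.coe_singleton, Set.mem_insert_iff,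
      Set.mem_singleton_iff] at hu
    rcases hu with rfl | rfl | rfl
    · exact Or.inl h1.snd_mem
    · exact Or.inl h1.fst_mem
    · exact Or.inl h2.snd_mem

lemma exists_finset_of_bd (hA : A ⊆ cells K) (hbd : bd A = C.edgeSet) {x y : Plane}
    (h : C.Adj x y) : ∃ w, {x, y, w} ∈ A := by
  obtain ⟨t, ⟨ht, he⟩, -⟩ : s(x, y) ∈ bd A := hbd ▸ h
  rw [mem_cellEdges_iff] at he
  obtain ⟨w, -, -, rfl⟩ := exists_third (hA ht).2 he.1 he.2.1 he.2.2
  exact ⟨w, ht⟩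

/-- Points of a piece are separated by the chord from a point outside. -/
lemma IsPiece.edist_le (h : IsPiece C A x z B) (hK : Good c r K) (hr : 0 < r)
    (hC : IsSimpleCycle C) (hA : A ⊆ cells K) (hbd : bd A = C.edgeSet)
    (hp : p ∈ cellVertices B → p = z) (hy : y ∈ cellVertices B) (hyx : y ≠ x) (hyz : y ≠ z) :
    (regionGraph C).edist p x ≤ (regionGraph C).edist p y := by
  have hin := hK.insideCells_eq hr hC hA hbd
  have hxz : (regionGraph C).Adj z x := by
    obtain ⟨t, ⟨ht, he⟩, -⟩ := h.mem_bd
    rw [mem_cellEdges_iff] at he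
    exact ⟨he.1.symm, t, hin ▸ h.subset ht, he.2.2, he.2.1⟩
  -- Induction along a walk from `y` to `p`: as long as it avoids `x` and `z`, its vertices stay in
  -- the piece, which contains `p` at most as `z`.
  have key : ∀ y (q : (regionGraph C).Walk y p), y ∈ cellVertices B → y ≠ x → y ≠ z →
      (regionGraph C).edist p x ≤ q.length := by
    intro y q
    induction q with
    | nil => exact fun hy _ hyz => absurd (hp hy) hyz
    | @cons y v p hadj q ih =>
      intro hy hyx hyz
      have hadj' := hadj
      obtain ⟨-, t, ht, hyt, hvt⟩ := hadj'
      rw [hin] at ht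
      have htB : t ∈ B := by
        by_contra htB
        rcases h.separates hK hC hA hbd hy ⟨t, ⟨ht, htB⟩, hyt⟩ with h' | h'
        · exact hyx h'
        · exact hyz h'
      rw [Walk.length_cons]
      by_cases hvx : v = x
      · subst hvx
        refine (Walk.edist_le q.reverse).trans ?_
        rw [Walk.length_reverse]
        exact_mod_cast Nat.le_succ _
      -- When the walk arrives at `z`, the rest of it prolonged by the chord to `x` is no longer
      -- than the whole, since one step has already been spent.
      by_cases hvz : v = z
      · subst hvz
        refine (Walk.edist_le (q.reverse.concat hxz)).trans ?_
        rw [Walk.length_concat, Walk.length_reverse]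
      · exact (ih hp ⟨t, htB, hvt⟩ hvx hvz).trans (by exact_mod_cast Nat.le_succ _)
  exact le_iInf fun q : (regionGraph C).Walk p y => by
    rw [← Walk.length_reverse]
    exact key y q.reverse hy hyx hyz

/-- Induction on the size of the piece, which is cut off by a chord at the farthest vertex `x` and
contains `p` at most as the other end. Take its triangle at the edge `x y` of `C` and the third
vertex `w`. For `w` off `C` there is a detour. For `w = z` there is a shortcut past `y` or else a
smaller piece behind the chord `y z`. In the remaining case `x w` is a chord, and it cuts off a
smaller piece away from `x z`. -/
lemma exists_step_of_isPiece (hK : Good c r K) (hr : 0 < r) (hC : IsSimpleCycle C)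
    (hA : A ⊆ cells K) (hbd : bd A = C.edgeSet) (hp : p ∈ C.verts) (n : ℕ) :
    ∀ x z B, IsPiece C A x z B → B.ncard = n → IsFarthest C p x → z ∈ C.verts →
      (p ∈ cellVertices B → p = z) → ∃ C', IsContractionStep p C C' := by
  induction n using Nat.strong_induction_on with | _ n ih => ?_
  intro x z B h hn hx hz hpB
  have hBfin : B.Finite := (cells_finite hK.finite).subset (h.subset.trans hA)
  obtain ⟨y, hxy, hyB, hyu⟩ := h.exists_unique_adj hK hC hA hbd hx.1
  obtain ⟨t, ⟨ht, hxyt⟩, -⟩ := hyB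
  have hxyt' := mem_cellEdges_iff.1 hxyt
  obtain ⟨w, hwx, hwy, rfl⟩ := exists_third (hA (h.subset ht)).2 hxy.ne hxyt'.2.1 hxyt'.2.2
  have hc := mem_cellEdges_triple hxy.ne hwx hwy
  have htA := h.subset ht
  by_cases hw : w ∈ C.verts
  swap
  · exact exists_step_detour hK hr hC hA hbd htA hxy hw hp hx
  have hyBv : y ∈ cellVertices B := ⟨_, ht, by simp⟩
  by_cases hwz : w = z
  · subst hwz
    by_cases hyz : C.Adj y w
    · exact exists_step_shortcut hK hr hC hA hbd htA hxy.symm hyz h.not_adj hp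
        (fun e => hwy ((hpB (e ▸ hyBv)).symm.trans e)) hx (by simp)
    -- Being behind the chord, `y` is at least as far from `p` as `x`, so it can take over the role
    -- of `x`.
    have hy : IsFarthest C p y := ⟨hxy.snd_mem, fun u hu => (hx.2 u hu).trans
      (h.edist_le hK hr hC hA hbd hpB hyBv hxy.ne.symm hwy.symm)⟩
    refine ih _ ?_ y w (B \ {{x, y, w}}) ?_ rfl hy hw ?_
    · rw [← hn]
      exact Set.ncard_sdiff_singleton_lt_of_mem ht hBfin
    · have hb := bd_diff_singleton (h.subset.trans hA) ht
      refine ⟨Set.sdiff_subset.trans h.subset, ?_, ?_, hyz⟩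
      · rw [hb, hc]
        refine Or.inr ⟨fun h' => ?_, by simp⟩
        rcases h.bd_subset h' with h'' | h''
        · rw [Sym2.eq_iff] at h''
          rcases h'' with h'' | h''
          · exact hxy.ne h''.1.symm
          · exact hwy h''.1.symm
        · exact hyz h''
      · intro e he
        rw [hb, hc] at he
        rcases he with ⟨h1, h2⟩ | ⟨h1, rfl | rfl | rfl⟩
        · rcases h.bd_subset h1 with rfl | h3
          · exact absurd (Or.inr (Or.inl rfl)) h2
          · exact Or.inr h3
        · exact Or.inr hxy
        · exact absurd h.mem_bd h1
        · exact Or.inl rfl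
    · rintro ⟨u, hu, hpu⟩
      exact hpB ⟨u, hu.1, hpu⟩
  -- the chord from `x` to `w`
  have hxw : ¬ C.Adj x w := by
    intro h'
    refine hwy (hyu w h' (mem_bd_of_subset h.subset ?_ ht ((hc _).2 (by simp))))
    rw [hbd]; exact h'
  have hne : s(x, z) ≠ s(x, w) := fun h' => hwz (Sym2.congr_right.1 h').symm
  obtain ⟨u, ⟨huB, hue⟩, huu⟩ := h.mem_bd
  have hxz := h.not_mem_bd hbd
  -- the piece at the new chord away from the old one
  obtain ⟨B', hB', huB'⟩ : ∃ B', IsPiece C A x w B' ∧ u ∉ B' := by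
    obtain ⟨B', hB'⟩ := exists_isPiece hK hC hA hbd hx.1 hw hxw htA ((hc _).2 (by simp))
    by_cases hu : u ∈ B'
    · exact ⟨_, hB'.compl hA hbd, fun h' => h'.2 hu⟩
    · exact ⟨_, hB', hu⟩
  have hxzB' : s(x, z) ∉ bd B' := by
    intro h'
    rcases hB'.bd_subset h' with h'' | h''
    · exact hne h''
    · exact h.not_adj h''
  have hxwB : s(x, w) ∉ bd B := by
    intro h'
    rcases h.bd_subset h' with h'' | h''
    · exact hne h''.symm
    · exact hxw h''
  -- The part of `B'` outside `B` has no chord on its boundary, so it is bounded by `C` or empty. It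
  -- is not all of `A`, because the triangle `x y w` is in `B`.
  have hsub : B' ⊆ B := by
    have hAB := h.compl hA hbd
    have hD : (A \ B) ∩ B' ⊆ cells K := Set.inter_subset_left.trans (Set.sdiff_subset.trans hA)
    have hbdD : bd ((A \ B) ∩ B') ⊆ C.edgeSet := by
      intro e he
      by_contra heC
      have h1 : e = s(x, z) ∨ e = s(x, w) := by
        rcases bd_inter_subset (Set.sdiff_subset.trans hA) (hB'.subset.trans hA) he with h1 | h1
        · exact Or.inl ((hAB.bd_subset h1).resolve_right heC)
        · exact Or.inr ((hB'.bd_subset h1).resolve_right heC)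
      obtain ⟨v, ⟨hv, hve⟩, -⟩ := he
      rcases h1 with rfl | rfl
      · exact huB' ((mem_iff_of_not_mem_bd (hB'.subset.trans hA) (hA hv.1.1)
          (hA (h.subset huB)) hxzB' hve hue).1 hv.2)
      · exact hv.1.2 ((mem_iff_of_not_mem_bd (h.subset.trans hA) (hA hv.1.1)
          (hA htA) hxwB hve ((hc _).2 (by simp))).2 ht)
    have hempty : (A \ B) ∩ B' = ∅ := by
      rcases hC.bd_eq hK.finite hD hbdD with h1 | h1
      · exact bd_injective hK.finite hD (Set.empty_subset _) (h1.trans bd_empty.symm)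
      · have := bd_injective hK.finite hD hA (h1.trans hbd.symm)
        exact absurd ht ((this.symm ▸ htA : _ ∈ (A \ B) ∩ B').1.2)
    intro v hv
    by_contra hvB
    exact (hempty ▸ (⟨⟨hB'.subset hv, hvB⟩, hv⟩ : v ∈ (A \ B) ∩ B') : v ∈ (∅ : Set _))
  refine ih _ ?_ x w B' hB' rfl hx hw fun hpB' => ?_
  · rw [← hn]
    exact Set.ncard_lt_ncard ⟨hsub, fun h' => huB' (h' huB)⟩ hBfin
  -- If `p` were a vertex of `B'`, it would be `z`, which also belongs to the triangle `u` outside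
  -- `B'`; but then `z` would be an end of the chord `x w`.
  · exfalso
    have hpz : p = z := hpB (by obtain ⟨v, hv, hpv⟩ := hpB'; exact ⟨v, hsub hv, hpv⟩)
    subst hpz
    rcases hB'.separates hK hC hA hbd hpB'
      ⟨u, ⟨h.subset huB, huB'⟩, (mem_cellEdges_iff.1 hue).2.2⟩ with h1 | h1
    · exact (mem_cellEdges_iff.1 hue).1 h1.symm
    · exact hwz h1.symm

lemma exists_isFarthest (hC : IsSimpleCycle C) (p : Plane) : ∃ x, IsFarthest C p x := by
  obtain ⟨x, hx, h⟩ := Set.exists_max_image C.verts (fun y => (regionGraph C).edist p y) hC.finite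
    hC.nonempty
  exact ⟨x, hx, h⟩

lemma IsFarthest.ne (h : IsFarthest C p x) (hC : IsSimpleCycle C) : p ≠ x := by
  rintro rfl
  obtain ⟨y, hy⟩ := hC.exists_adj h.1
  have := h.2 y hy.snd_mem
  rw [SimpleGraph.edist_self, nonpos_iff_eq_zero, SimpleGraph.edist_eq_zero_iff] at this
  exact hy.ne this

lemma insideCells_singleton : insideCells ((graph K).singletonSubgraph p) = ∅ := by
  rw [Set.eq_empty_iff_forall_notMem]
  rintro t ⟨ht, hsub⟩
  rw [interior_cell ht] at hsub
  obtain ⟨z, hz⟩ := openHull_nonempty ht.1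
  have hcar : carrier ((graph K).singletonSubgraph p) = ∅ := by
    rw [Set.eq_empty_iff_forall_notMem]
    rintro z ⟨x, y, h, -⟩
    exact h
  have := (hsub hz).2
  rw [hcar, Set.compl_empty, connectedComponentIn_univ,
    (PreconnectedSpace.connectedComponent_eq_univ)] at this
  exact NormedSpace.unbounded_univ ℝ Plane this

/-- The start of the search: if the triangle at the farthest vertex cannot be removed at once, its
side `x w` is a chord and one of the two pieces is suitable for `exists_step_of_isPiece`. -/
lemma exists_step (hK : Good c r K) (hr : 0 < r) (hC : IsSimpleCycle C) (hp : p ∈ C.verts) :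
    ∃ C', IsContractionStep p C C' := by
  obtain ⟨A, hA, hbd⟩ := hC.exists_bd hK.potential
  obtain ⟨x, hx⟩ := exists_isFarthest hC p
  have hpx := hx.ne hC
  obtain ⟨y, hxy⟩ := hC.exists_adj hx.1
  obtain ⟨w, ht⟩ := exists_finset_of_bd hA hbd hxy
  obtain ⟨-, hwx, hwy⟩ := card_of_cell (hA ht)
  have hc := mem_cellEdges_triple hxy.ne hwx hwy
  by_cases hw : w ∈ C.verts
  swap
  · exact exists_step_detour hK hr hC hA hbd ht hxy hw hp hx
  by_cases hxw : C.Adj x w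
  · by_cases hyw : C.Adj y w
    -- All three sides are on `C`, so `C` is the boundary of this triangle and shrinks to `p`.
    · have hsub : cellEdges {x, y, w} ⊆ C.edgeSet := by
        intro e he
        rw [hc] at he
        rcases he with rfl | rfl | rfl
        · exact hxy
        · exact hxw
        · exact hyw
      have hs : ({({x, y, w} : Finset Plane)} : Set (Finset Plane)) ⊆ cells K := by
        rintro t rfl; exact hA ht
      have hb : bd {({x, y, w} : Finset Plane)} = cellEdges {x, y, w} := by
        ext e
        constructor
        · rintro ⟨t, ⟨rfl, he⟩, -⟩; exact he
        · exact fun he => ⟨_, ⟨rfl, he⟩, fun t h => h.1⟩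
      have hCe : cellEdges {x, y, w} = C.edgeSet := by
        rcases hC.bd_eq hK.finite hs (hb ▸ hsub) with h | h
        · rw [hb] at h
          have : s(x, y) ∈ cellEdges {x, y, w} := (hc _).2 (by simp)
          rw [h] at this
          exact absurd this (Set.notMem_empty _)
        · exact hb ▸ h
      have hin : insideCells C = {{x, y, w}} := hK.insideCells_eq hr hC hs (hb.trans hCe)
      have hxor : xorSum C ((graph K).singletonSubgraph p) = cellEdges {x, y, w} := by
        rw [xorSum, SimpleGraph.edgeSet_singletonSubgraph, hCe]; simp
      refine ⟨(graph K).singletonSubgraph p, ⟨_, hin ▸ rfl, ?_, hxor, x, by simp, hx.1, hx.2⟩,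
        ⟨graduallyVaried_of_xorSum (hA ht) ?_ hxor, ?_⟩, rfl, Or.inr rfl⟩
      · rw [hin, insideCells_singleton, Set.sdiff_self]
      · intro u hu
        simp only [Finset.coe_insert, Finset.coe_singleton, Set.mem_insert_iff,
          Set.mem_singleton_iff] at hu
        rcases hu with rfl | rfl | rfl
        · exact Or.inl hxy.fst_mem
        · exact Or.inl hxy.snd_mem
        · exact Or.inl hxw.snd_mem
      · rintro ⟨k, f, a', t', -, -, -, -, -, h, -⟩
        exact h
    -- Here the shortcut `y w` drops the farthest vertex `x` itself, which is not `p`.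
    · exact exists_step_shortcut hK hr hC hA hbd (x := y) (y := x) (z := w)
        (by rwa [Finset.insert_comm]) hxy hxw hyw hp hpx hx (by simp)
  · obtain ⟨B, hB⟩ := exists_isPiece hK hC hA hbd hx.1 hw hxw ht ((hc _).2 (by simp))
    by_cases hpB : p ∈ cellVertices B → p = w
    · exact exists_step_of_isPiece hK hr hC hA hbd hp _ x w B hB rfl hx hw hpB
    -- If `p` is in `B` but not an end of the chord other than `x`, the complementary piece is
    -- taken: there `p` could only be a common vertex of both pieces.
    · push Not at hpB
      refine exists_step_of_isPiece hK hr hC hA hbd hp _ x w _ (hB.compl hA hbd) rfl hx hw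
        fun h => ?_
      exact (hB.separates hK hC hA hbd hpB.1 h).resolve_left hpx

/-- Suppose `q` is on the cycles with numbers `i` and `k`, but not on the one with number `j`. Then
`q` is a vertex of a triangle enclosed by `Q k`, hence by `Q j`, and since `Q j` has no edge at `q`,
all triangles at `q` are enclosed by `Q j`. An edge of `Q i` at `q` lies on one triangle enclosed by
`Q i`; this triangle is enclosed by `Q j`, so the edge belongs to `Q j` as well, a contradiction. -/
lemma left_forever_of_insideCells (hK : Good c r K) (hr : 0 < r) {m : ℕ}
    {Q : ℕ → (graph K).Subgraph} (hfin : Q m = (graph K).singletonSubgraph p)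
    (hs : ∀ i < m, IsSimpleCycle (Q i)) (hp : ∀ i ≤ m, p ∈ (Q i).verts)
    (hmono : ∀ i < m, insideCells (Q (i + 1)) ⊆ insideCells (Q i)) (q : Plane) (i j k : ℕ)
    (hij : i ≤ j) (hjk : j ≤ k) (hkm : k ≤ m) (hqi : q ∈ (Q i).verts) (hqj : q ∉ (Q j).verts) :
    q ∉ (Q k).verts := by
  intro hqk
  have hmon : ∀ a b, a ≤ b → b ≤ m → insideCells (Q b) ⊆ insideCells (Q a) := by
    intro a b hab
    induction b, hab using Nat.le_induction with
    | base => exact fun _ => subset_rfl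
    | succ b hab ih => exact fun hb => (hmono b hb).trans (ih (by omega))
  -- The last term is not a cycle but the point `p`, which was never left.
  rcases hkm.eq_or_lt with rfl | hkm
  · rw [hfin] at hqk
    have : q = p := hqk
    exact hqj (this ▸ hp j hjk)
  have hin : ∀ a < m, ∃ A ⊆ cells K, bd A = (Q a).edgeSet ∧ insideCells (Q a) = A := by
    intro a ha
    obtain ⟨A, hA, hbd⟩ := (hs a ha).exists_bd hK.potential
    exact ⟨A, hA, hbd, hK.insideCells_eq hr (hs a ha) hA hbd⟩
  obtain ⟨Ai, hAi, bi, ei⟩ := hin i (by omega)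
  obtain ⟨Aj, hAj, bj, ej⟩ := hin j (by omega)
  obtain ⟨Ak, hAk, bk, ek⟩ := hin k hkm
  have hji : Aj ⊆ Ai := by rw [← ei, ← ej]; exact hmon i j hij (by omega)
  have hkj : Ak ⊆ Aj := by rw [← ek, ← ej]; exact hmon j k hjk (by omega)
  obtain ⟨u, hu⟩ := (hs k hkm).exists_adj hqk
  obtain ⟨t, ⟨ht, het⟩, -⟩ : s(q, u) ∈ bd Ak := bk ▸ hu
  have hall := fun {t'} => hK.mem_of_vertex hAj (hkj ht) (mem_cellEdges_iff.1 het).2.1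
    (fun v hv => hqj (Subgraph.edge_vert _ (show s(q, v) ∈ (Q j).edgeSet from bj ▸ hv))) (t := t')
  obtain ⟨v, hv⟩ := (hs i (by omega)).exists_adj hqi
  have hvi : s(q, v) ∈ bd Ai := bi ▸ hv
  have hvi' := hvi
  obtain ⟨t', ⟨ht', het'⟩, -⟩ := hvi'
  have := mem_bd_of_subset hji hvi (hall (hAi ht') (mem_cellEdges_iff.1 het').2.1) het'
  rw [bj] at this
  exact hqj (Subgraph.edge_vert _ (show (Q j).Adj q v from this))

/-- Every simple cycle can be contracted to each of its vertices by removing farthest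
triangles. -/
theorem Good.exists_contraction (hK : Good c r K) (hr : 0 < r) (hC : IsSimpleCycle C)
    (hp : p ∈ C.verts) : ∃ (m : ℕ) (Q : ℕ → (graph K).Subgraph),
      IsContraction C p m Q ∧ ∀ i < m, IsFarthestRemoval p (Q i) (Q (i + 1)) := by
  -- Each step removes one enclosed triangle, so their number serves for the induction.
  have key : ∀ n, ∀ C : (graph K).Subgraph, IsSimpleCycle C → p ∈ C.verts →
      (insideCells C).ncard = n → ∃ (m : ℕ) (Q : ℕ → (graph K).Subgraph),
        Q 0 = C ∧ Q m = (graph K).singletonSubgraph p ∧ (∀ i < m, IsSimpleCycle (Q i)) ∧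
        (∀ i ≤ m, p ∈ (Q i).verts) ∧ (∀ i < m, IsContractionStep p (Q i) (Q (i + 1))) := by
    intro n
    induction n using Nat.strong_induction_on with | _ n ih => ?_
    intro C hC hp hn
    obtain ⟨C', h⟩ := exists_step hK hr hC hp
    obtain ⟨m, Q, q0, qm, qs, qp, qr⟩ : ∃ (m : ℕ) (Q : ℕ → (graph K).Subgraph),
        Q 0 = C' ∧ Q m = (graph K).singletonSubgraph p ∧ (∀ i < m, IsSimpleCycle (Q i)) ∧
        (∀ i ≤ m, p ∈ (Q i).verts) ∧ (∀ i < m, IsContractionStep p (Q i) (Q (i + 1))) := by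
      rcases h.simple_or with h' | h'
      · refine ih _ ?_ C' h' h.mem rfl
        obtain ⟨t, ht, he, -⟩ := h.removal
        rw [← hn, he]
        exact Set.ncard_sdiff_singleton_lt_of_mem ht
          ((cells_finite hK.finite).subset fun _ h => h.1)
      · exact ⟨0, fun _ => C', rfl, h', by simp, fun _ _ => h.mem, by simp⟩
    refine ⟨m + 1, fun i => Nat.casesOn i C Q, rfl, qm, ?_, ?_, ?_⟩
    · rintro (_ | i) hi
      · exact hC
      · exact qs i (by omega)
    · rintro (_ | i) hi
      · exact hp
      · exact qp i (by omega)
    · rintro (_ | i) hi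
      · change IsContractionStep p C (Q 0)
        rw [q0]; exact h
      · exact qr i (by omega)
  obtain ⟨m, Q, q0, qm, qs, qp, qr⟩ := key _ C hC hp rfl
  refine ⟨m, Q, ⟨q0, qm, qs, qp, ?_, fun i hi => (qr i hi).side⟩, fun i hi => (qr i hi).removal⟩
  refine left_forever_of_insideCells hK hr qm qs qp fun i hi => ?_
  obtain ⟨t, -, he, -⟩ := (qr i hi).removal
  rw [he]; exact Set.sdiff_subset

/-- Triangulations of a square are simply connected in the discrete sense. -/
theorem Good.isDiscretelySimplyConnected (hK : Good c r K) (hr : 0 < r) :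
    IsDiscretelySimplyConnected K := by
  refine ⟨hK.conn.1, hK.conn.2, fun C hC p hp => ?_⟩
  obtain ⟨m, Q, h, -⟩ := hK.exists_contraction hr hC hp
  exact ⟨m, Q, h⟩

end

end DiscretePlane

namespace DiscretePlane

open Geometry SimpleGraph

/-! ### Subdividing off a curve -/

section

variable {K : SimplicialComplex ℝ Plane} {c : Plane} {r : ℝ} {H : SimpleGraph Plane}

/-- `v` is a vertex off `H` that has two neighbours on `H` that are not adjacent in `H`. -/
def IsBridge (H : SimpleGraph Plane) (K : SimplicialComplex ℝ Plane) (v : Plane) : Prop :=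
  v ∉ H.support ∧ ∃ a ∈ H.support, ∃ b ∈ H.support, a ≠ b ∧ (graph K).Adj v a ∧ (graph K).Adj v b ∧
    ¬ H.Adj a b

/-- `H` is a full subcomplex of `K`. -/
def IsFull (H : SimpleGraph Plane) (K : SimplicialComplex ℝ Plane) : Prop :=
  ∀ a ∈ H.support, ∀ b ∈ H.support, (graph K).Adj a b → H.Adj a b

section Star

variable {s₀ : Finset Plane} {v : Plane} {h₀ : s₀ ∈ K.faces} {hc : 2 ≤ s₀.card}
  {hv : v ∈ openHull s₀}

lemma not_mem_support_of_mem_openHull (hH : H ≤ graph K) (h₀ : s₀ ∈ K.faces) (hc : 2 ≤ s₀.card)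
    (hv : v ∈ openHull s₀) : v ∉ H.support := by
  classical
  rintro ⟨y, hy⟩
  exact not_mem_of_mem_openHull h₀ hc hv (graph_adj_iff.1 (hH hy)).2 (by simp)

lemma le_graph_star (hH : H ≤ graph K) (hs : ∀ x y, H.Adj x y → s₀ ≠ {x, y}) :
    H ≤ graph (star K s₀ v h₀ hc hv) := by
  have hvH := not_mem_support_of_mem_openHull hH h₀ hc hv
  intro x y hxy
  exact (star_adj_old (by rintro rfl; exact hvH ⟨y, hxy⟩) (by rintro rfl; exact hvH ⟨x, hxy.symm⟩)).2
    ⟨hH hxy, hs x y hxy⟩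

lemma ne_of_mem_support (hH : H ≤ graph K) {x : Plane} (hx : x ∈ H.support)
    (h₀ : s₀ ∈ K.faces) (hc : 2 ≤ s₀.card) (hv : v ∈ openHull s₀) : x ≠ v :=
  fun e => not_mem_support_of_mem_openHull hH h₀ hc hv (e ▸ hx)

lemma isFull_star (hH : H ≤ graph K) (hf : IsFull H K) : IsFull H (star K s₀ v h₀ hc hv) :=
  fun a ha b hb hab => hf a ha b hb ((star_adj_old (ne_of_mem_support hH ha h₀ hc hv)
    (ne_of_mem_support hH hb h₀ hc hv)).1 hab).1

lemma isBridge_of_star (hH : H ≤ graph K) {x : Plane} (hx : x ≠ v)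
    (h : IsBridge H (star K s₀ v h₀ hc hv) x) : IsBridge H K x := by
  obtain ⟨h1, a, ha, b, hb, hab, h2, h3, h4⟩ := h
  exact ⟨h1, a, ha, b, hb, hab, ((star_adj_old hx (ne_of_mem_support hH ha h₀ hc hv)).1 h2).1,
    ((star_adj_old hx (ne_of_mem_support hH hb h₀ hc hv)).1 h3).1, h4⟩

lemma mem_cells_of_star {t : Finset Plane} (ht : t ∈ cells (star K s₀ v h₀ hc hv)) (hvt : v ∉ t) :
    t ∈ cells K ∧ ¬ s₀ ⊆ t := by
  classical
  rcases mem_star_faces.1 ht.1 with h | ⟨r, -, -, rfl⟩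
  · exact ⟨⟨h.1, ht.2⟩, h.2⟩
  · exact absurd (Finset.mem_insert_self _ _) hvt

end Star

/-- Every edge that joins two vertices of `H` without being in `H` is starred. The new vertex is not
on `H`, so no new edge of this kind arises. -/
lemma exists_isFull (n : ℕ) :
    ∀ K : SimplicialComplex ℝ Plane, Good c r K → H ≤ graph K →
      {p : Plane × Plane | (graph K).Adj p.1 p.2 ∧ p.1 ∈ H.support ∧ p.2 ∈ H.support ∧
        ¬ H.Adj p.1 p.2}.ncard = n →
      ∃ K', Good c r K' ∧ IsSubdivision K' K ∧ H ≤ graph K' ∧ IsFull H K' := by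
  classical
  induction n using Nat.strong_induction_on with | _ n ih => ?_
  intro K hK hHK hn
  by_cases hf : IsFull H K
  · exact ⟨K, hK, .refl K, hHK, hf⟩
  simp only [IsFull] at hf
  push Not at hf
  obtain ⟨a, ha, b, hb, hab, hnab⟩ := hf
  have h₀ := (graph_adj_iff.1 hab).2
  have hc : 2 ≤ ({a, b} : Finset Plane).card := (Finset.card_pair hab.ne).ge
  obtain ⟨v, hv⟩ := openHull_nonempty h₀
  have hne : ∀ {x}, x ∈ H.support → x ≠ v := fun hx => ne_of_mem_support hHK hx h₀ hc hv
  have hle : H ≤ graph (star K _ v h₀ hc hv) := le_graph_star hHK fun x y hxy e => hnab (by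
    have ha' : a ∈ ({x, y} : Finset Plane) := e ▸ by simp
    have hb' : b ∈ ({x, y} : Finset Plane) := e ▸ by simp
    simp only [Finset.mem_insert, Finset.mem_singleton] at ha' hb'
    rcases ha' with rfl | rfl <;> rcases hb' with rfl | rfl
    · exact absurd rfl hab.ne
    · exact hxy
    · exact hxy.symm
    · exact absurd rfl hab.ne)
  refine (ih _ ?_ _ (hK.starAt h₀ hc hv) hle rfl).imp fun K' h =>
    ⟨h.1, h.2.1.trans star_isSubdivision, h.2.2⟩
  · rw [← hn]
    refine Set.ncard_lt_ncard ⟨?_, fun h => ?_⟩ ((adj_finite hK.finite).subset fun p hp => hp.1)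
    · rintro ⟨x, y⟩ ⟨k1, k2, k3, k4⟩
      exact ⟨((star_adj_old (hne k2) (hne k3)).1 k1).1, k2, k3, k4⟩
    · have := h (⟨hab, ha, hb, hnab⟩ : (a, b) ∈ {p : Plane × Plane | (graph K).Adj p.1 p.2 ∧
        p.1 ∈ H.support ∧ p.2 ∈ H.support ∧ ¬ H.Adj p.1 p.2})
      exact ((star_adj_old (hne ha) (hne hb)).1 this.1).2 rfl

/-- No triangle consists of an edge of `H` and a bridge. -/
def NoBridgeCell (H : SimpleGraph Plane) (K : SimplicialComplex ℝ Plane) : Prop :=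
  ∀ t ∈ cells K, ∀ a ∈ t, ∀ b ∈ t, ∀ v ∈ t, H.Adj a b → ¬ IsBridge H K v

/-- An offending triangle is starred at an inner point `u`. The neighbours of `u` are the vertices
of this triangle, and those of them on `H` are adjacent in `H` by fullness, so `u` is not a bridge
and no new offending triangle contains it. -/
lemma exists_noBridgeCell (n : ℕ) :
    ∀ K : SimplicialComplex ℝ Plane, Good c r K → H ≤ graph K → IsFull H K →
      {t ∈ cells K | ∃ a ∈ t, ∃ b ∈ t, ∃ v ∈ t, H.Adj a b ∧ IsBridge H K v}.ncard = n →
      ∃ K', Good c r K' ∧ IsSubdivision K' K ∧ H ≤ graph K' ∧ IsFull H K' ∧ NoBridgeCell H K' := by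
  classical
  induction n using Nat.strong_induction_on with | _ n ih => ?_
  intro K hK hHK hf hn
  by_cases hnb : NoBridgeCell H K
  · exact ⟨K, hK, .refl K, hHK, hf, hnb⟩
  simp only [NoBridgeCell] at hnb
  push Not at hnb
  obtain ⟨t, ht, a, ha, b, hb, v, hvt, hab, hbr⟩ := hnb
  have hc : 2 ≤ t.card := by rw [ht.2]; norm_num
  obtain ⟨u, hu⟩ := openHull_nonempty ht.1
  have hne : ∀ {x}, x ∈ H.support → x ≠ u := fun hx => ne_of_mem_support hHK hx ht.1 hc hu
  have hle : H ≤ graph (star K _ u ht.1 hc hu) := le_graph_star hHK fun x y hxy e => by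
    have := ht.2
    rw [e, Finset.card_pair hxy.ne] at this
    omega
  -- the new vertex is not a bridge
  have hunb : ¬ IsBridge H (star K _ u ht.1 hc hu) u := by
    rintro ⟨-, x, hx, y, hy, hxy, h1, h2, h3⟩
    have hmem : ∀ {z}, (graph (star K _ u ht.1 hc hu)).Adj u z → z ∈ t := by
      intro z hz
      have h4 := star_adj_new.1 hz
      have h5 := card_le_three h4
      by_contra hzt
      rw [Finset.card_insert_of_notMem hzt, ht.2] at h5
      omega
    exact h3 (hf x hx y hy ⟨hxy, t, ht.1, hmem h1, hmem h2⟩)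
  refine (ih _ ?_ _ (hK.starAt ht.1 hc hu) hle (isFull_star hHK hf) rfl).imp fun K' h =>
    ⟨h.1, h.2.1.trans star_isSubdivision, h.2.2⟩
  · rw [← hn]
    refine Set.ncard_lt_ncard ⟨?_, fun h => ?_⟩ ((cells_finite hK.finite).subset fun p hp => hp.1)
    · rintro t' ⟨k1, x, hx, y, hy, z, hz, k2, k3⟩
      have hzu : z ≠ u := fun e => hunb (e ▸ k3)
      have hxu := hne ⟨y, k2⟩
      have hyu := hne ⟨x, k2.symm⟩
      -- Otherwise the triangle would have four different vertices: the ends of an edge of `H`, a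
      -- bridge off `H`, and `u`.
      have hut : u ∉ t' := by
        intro hut
        have hzx : z ≠ x := fun e => k3.1 ⟨y, e ▸ k2⟩
        have hzy : z ≠ y := fun e => k3.1 ⟨x, e ▸ k2.symm⟩
        have hsub : ({x, y, z, u} : Finset Plane) ⊆ t' := by
          simp [Finset.insert_subset_iff, hx, hy, hz, hut]
        have h4 := Finset.card_le_card hsub
        rw [k1.2, Finset.card_eq_of_equiv_fin (n := 4)] at h4
        · omega
        · refine Finset.equivFinOfCardEq ?_
          rw [Finset.card_insert_of_notMem (by simp [k2.ne, hzx.symm, hxu]),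
            Finset.card_insert_of_notMem (by simp [hzy.symm, hyu]), Finset.card_pair hzu]
      exact ⟨(mem_cells_of_star k1 hut).1, x, hx, y, hy, z, hz, k2, isBridge_of_star hHK hzu k3⟩
    · have h4 := h (⟨ht, a, ha, b, hb, v, hvt, hab, hbr⟩ :
        t ∈ {t ∈ cells K | ∃ a ∈ t, ∃ b ∈ t, ∃ v ∈ t, H.Adj a b ∧ IsBridge H K v})
      have hut : u ∉ t := not_mem_of_mem_openHull ht.1 hc hu ht.1
      exact (mem_cells_of_star h4.1 hut).2 subset_rfl

/-- The edges from bridges to `H` are starred. The new vertex `u` on `v a` has only `a` as a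
neighbour on `H`: another one, `z`, would form a triangle with `v` and `a`, where `z a` is in `H` by
fullness and `v` is a bridge. So `u` is not a bridge. This is why the triangles excluded by
`NoBridgeCell` are removed beforehand. -/
lemma exists_noBridge (n : ℕ) :
    ∀ K : SimplicialComplex ℝ Plane, Good c r K → H ≤ graph K → IsFull H K → NoBridgeCell H K →
      {p : Plane × Plane | (graph K).Adj p.1 p.2 ∧ IsBridge H K p.1 ∧ p.2 ∈ H.support}.ncard = n →
      ∃ K', Good c r K' ∧ IsSubdivision K' K ∧ H ≤ graph K' ∧ IsFull H K' ∧
        ∀ v, ¬ IsBridge H K' v := by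
  classical
  induction n using Nat.strong_induction_on with | _ n ih => ?_
  intro K hK hHK hf hnb hn
  by_cases hno : ∀ v, ¬ IsBridge H K v
  · exact ⟨K, hK, .refl K, hHK, hf, hno⟩
  push Not at hno
  obtain ⟨v, hv⟩ := hno
  obtain ⟨hvH, a, ha, -, -, -, hva, -, -⟩ := id hv
  have h₀ := (graph_adj_iff.1 hva).2
  have hc : 2 ≤ ({v, a} : Finset Plane).card := (Finset.card_pair hva.ne).ge
  obtain ⟨u, hu⟩ := openHull_nonempty h₀
  have hne : ∀ {x}, x ∈ H.support → x ≠ u := fun hx => ne_of_mem_support hHK hx h₀ hc hu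
  have hle : H ≤ graph (star K _ u h₀ hc hu) := le_graph_star hHK fun x y hxy e => by
    have : v ∈ ({x, y} : Finset Plane) := e ▸ by simp
    simp only [Finset.mem_insert, Finset.mem_singleton] at this
    rcases this with rfl | rfl
    · exact hvH ⟨y, hxy⟩
    · exact hvH ⟨x, hxy.symm⟩
  have hunb : ¬ IsBridge H (star K _ u h₀ hc hu) u := by
    rintro ⟨-, x, hx, y, hy, hxy, h1, h2, h3⟩
    have hmem : ∀ {z}, z ∈ H.support → (graph (star K _ u h₀ hc hu)).Adj u z → z = a := by
      intro z hz hadj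
      have h4 := star_adj_new.1 hadj
      by_contra hza
      have hzv : z ≠ v := fun e => hvH (e ▸ hz)
      have h5 : insert z {v, a} ∈ cells K := ⟨h4, by
        rw [Finset.card_insert_of_notMem (by simp [hzv, hza]), Finset.card_pair hva.ne]⟩
      have h6 : H.Adj z a := hf z hz a ha ⟨hza, _, h4, by simp, by simp⟩
      exact hnb _ h5 z (by simp) a (by simp) v (by simp) h6 hv
    exact hxy ((hmem hx h1).trans (hmem hy h2).symm)
  have hnb' : NoBridgeCell H (star K _ u h₀ hc hu) := by
    intro t ht x hx y hy z hz hxy hz'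
    have hzu : z ≠ u := fun e => hunb (e ▸ hz')
    have hxu := hne ⟨y, hxy⟩
    have hyu := hne ⟨x, hxy.symm⟩
    have hut : u ∉ t := by
      intro hut
      have hzx : z ≠ x := fun e => hz'.1 ⟨y, e ▸ hxy⟩
      have hzy : z ≠ y := fun e => hz'.1 ⟨x, e ▸ hxy.symm⟩
      have hsub : ({x, y, z, u} : Finset Plane) ⊆ t := by
        simp [Finset.insert_subset_iff, hx, hy, hz, hut]
      have h4 := Finset.card_le_card hsub
      rw [ht.2, Finset.card_insert_of_notMem (by simp [hxy.ne, hzx.symm, hxu]),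
          Finset.card_insert_of_notMem (by simp [hzy.symm, hyu]), Finset.card_pair hzu] at h4
      omega
    exact hnb t (mem_cells_of_star ht hut).1 x hx y hy z hz hxy (isBridge_of_star hHK hzu hz')
  refine (ih _ ?_ _ (hK.starAt h₀ hc hu) hle (isFull_star hHK hf) hnb' rfl).imp fun K' h =>
    ⟨h.1, h.2.1.trans star_isSubdivision, h.2.2⟩
  · rw [← hn]
    refine Set.ncard_lt_ncard ⟨?_, fun h => ?_⟩ ((adj_finite hK.finite).subset fun p hp => hp.1)
    · rintro ⟨x, y⟩ ⟨k1, k2, k3⟩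
      have hxu : x ≠ u := fun e => hunb (e ▸ k2)
      exact ⟨((star_adj_old hxu (hne k3)).1 k1).1, isBridge_of_star hHK hxu k2, k3⟩
    · have h4 := h (⟨hva, hv, ha⟩ : (v, a) ∈ {p : Plane × Plane | (graph K).Adj p.1 p.2 ∧
        IsBridge H K p.1 ∧ p.2 ∈ H.support})
      have hvu : v ≠ u := fun e => hunb (e ▸ h4.2.1)
      exact ((star_adj_old hvu (hne ha)).1 h4.1).2 rfl

/-- A subdivision relative to `H` in which `H` is full and has no bridges. -/
theorem Good.exists_full_noBridge (hK : Good c r K) (hH : H ≤ graph K) :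
    ∃ K', Good c r K' ∧ IsSubdivision K' K ∧ H ≤ graph K' ∧ IsFull H K' ∧
      ∀ v, ¬ IsBridge H K' v := by
  obtain ⟨K₁, g1, s1, h1, f1⟩ := exists_isFull _ K hK hH rfl
  obtain ⟨K₂, g2, s2, h2, f2, n2⟩ := exists_noBridgeCell _ K₁ g1 h1 f1 rfl
  obtain ⟨K₃, g3, s3, h3, f3, n3⟩ := exists_noBridge _ K₂ g2 h2 f2 n2 rfl
  exact ⟨K₃, g3, s3.trans (s2.trans s1), h3, f3, n3⟩

/-! ### Discrete curves and wide angles -/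

variable {C : (graph K).Subgraph}

lemma isDiscreteCurve_of_isFull (hf : IsFull H K) (hCv : ∀ x, x ∈ C.verts ↔ x ∈ H.support)
    (htri : ∀ a b c, H.Adj a b → H.Adj b c → H.Adj a c → False) : IsDiscreteCurve C := by
  intro t ht hsub
  obtain ⟨a, b, d, hab, had, hbd, rfl⟩ := Finset.card_eq_three.1 ht.2
  have hm : ∀ x ∈ ({a, b, d} : Finset Plane), x ∈ H.support := fun x hx => (hCv x).1 (hsub hx)
  have hadj : ∀ x ∈ ({a, b, d} : Finset Plane), ∀ y ∈ ({a, b, d} : Finset Plane), x ≠ y →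
      H.Adj x y := fun x hx y hy hxy => hf x (hm x hx) y (hm y hy) ⟨hxy, _, ht.1, hx, hy⟩
  exact htri a b d (hadj a (by simp) b (by simp) hab) (hadj b (by simp) d (by simp) hbd)
    (hadj a (by simp) d (by simp) had)

/-- A shorter connection has at most one inner vertex. Without one, or with one on the curve,
fullness gives a triangle in `H` or an edge of `C` that is not allowed; an inner vertex off the
curve would be a bridge. -/
lemma hasWideAngles_of_isFull (hf : IsFull H K) (hnb : ∀ v, ¬ IsBridge H K v)
    (hCv : ∀ x, x ∈ C.verts ↔ x ∈ H.support) (hCa : ∀ x y, C.Adj x y ↔ H.Adj x y)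
    (htri : ∀ a b c, H.Adj a b → H.Adj b c → H.Adj a c → False) : HasWideAngles C := by
  have hcell : ∀ {x y z}, (link K x).Adj y z → (graph K).Adj x y ∧ (graph K).Adj x z ∧
      (graph K).Adj y z := by
    rintro x y z ⟨h1, h2, h3, t, ht, k1, k2, k3⟩
    exact ⟨⟨h1, t, ht.1, k1, k2⟩, ⟨h2, t, ht.1, k1, k3⟩, ⟨h3, t, ht.1, k2, k3⟩⟩
  constructor
  · intro x y z hxy hxz hyz
    have hy := (hCv y).1 hxy.snd_mem
    have hz := (hCv z).1 hxz.snd_mem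
    have hx := (hCv x).1 hxy.fst_mem
    rw [hCa] at hxy hxz
    refine le_iInf fun w => ?_
    by_contra hlt
    have hlt : w.length < 3 := by exact_mod_cast not_le.1 hlt
    cases w with
    | nil => exact hyz rfl
    | @cons _ u _ h1 w =>
      obtain ⟨-, e1, e2⟩ := hcell h1
      cases w with
      | nil => exact htri x y z hxy (hf y hy z hz e2) hxz
      | @cons _ u' _ h2 w =>
        cases w with
        | nil =>
          obtain ⟨-, -, e3⟩ := hcell h2
          by_cases hu : u ∈ H.support
          · exact htri x y u hxy (hf y hy u hu e2) (hf x hx u hu e1)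
          · refine hnb u ⟨hu, y, hy, z, hz, hyz, e2.symm, e3, fun h => htri x y z hxy h hxz⟩
        | cons h3 w =>
          simp only [Walk.length_cons] at hlt
          omega
  · intro p hp q hq hpq hn w hw
    rw [hCv] at hp hq
    rw [hCa] at hn
    by_contra hlt
    cases w with
    | nil => exact hpq rfl
    | @cons _ u _ h1 w =>
      cases w with
      | nil => exact hn (hf p hp q hq h1)
      | @cons _ u' _ h2 w =>
        cases w with
        | nil =>
          by_cases hu : u ∈ H.support
          · exact hw s(p, u) (by simp) ((hCa p u).2 (hf p hp u hu h1))
          · exact hnb u ⟨hu, p, hp, q, hq, hpq, h1.symm, h2, hn⟩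
        | cons h3 w =>
          simp only [Walk.length_cons] at hlt
          omega

end

end DiscretePlane

namespace DiscretePlane

open Geometry SimpleGraph

/-! ### Segments in a triangulation -/

section

variable {K : SimplicialComplex ℝ Plane} {a b q : Plane}

lemma lineMap_coord (a b : Plane) (ρ : ℝ) (i : Fin 2) :
    (AffineMap.lineMap a b ρ : Plane) i = a i + ρ * (b i - a i) := by
  simp [AffineMap.lineMap_apply]; ring

lemma sq_dist_pos (hab : a ≠ b) : 0 < (b 0 - a 0) ^ 2 + (b 1 - a 1) ^ 2 := by
  by_contra h
  have h0 := sq_nonneg (b 0 - a 0)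
  have h1 := sq_nonneg (b 1 - a 1)
  have e0 : (b 0 - a 0) ^ 2 = 0 := by linarith
  have e1 : (b 1 - a 1) ^ 2 = 0 := by linarith
  have e0' := pow_eq_zero_iff (two_ne_zero) |>.1 e0
  have e1' := pow_eq_zero_iff (two_ne_zero) |>.1 e1
  exact hab (coord_ext (by linarith) (by linarith))

/-- The axis-parallel lines through a point. -/
def pointFunctions (q : Plane) : Set (Plane →ᵃ[ℝ] ℝ) :=
  {planeAff 1 0 (-q 0), planeAff 0 1 (-q 1)}

/-- The open face through `q` lies on both lines through `q`, hence is a point. -/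
lemma mem_vertices_of_oneSided (hq : q ∈ K.space)
    (h : ∀ f ∈ pointFunctions q, ∀ s ∈ K.faces, OneSided f s) : q ∈ K.vertices := by
  obtain ⟨s, hs, hqs⟩ := exists_face_mem_openHull hq
  have h0 := (h _ (Or.inl rfl) s hs).eq_zero hqs (by simp)
  have h1 := (h _ (Or.inr rfl) s hs).eq_zero hqs (by simp)
  have hall : ∀ y ∈ s, y = q := fun y hy => by
    have k0 := h0 y hy
    have k1 := h1 y hy
    simp only [planeAff_apply] at k0 k1
    exact coord_ext (by linarith) (by linarith)
  obtain ⟨y, hy⟩ := K.nonempty_of_mem_faces hs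
  exact K.down_closed hs (by simpa using hall y hy ▸ hy) (by simp)

/-- The line through `a` and `b` and the perpendicular lines at these points. -/
noncomputable def sideFunctions (a b : Plane) : Set (Plane →ᵃ[ℝ] ℝ) :=
  {planeAff (-(b 1 - a 1)) (b 0 - a 0) ((b 1 - a 1) * a 0 - (b 0 - a 0) * a 1),
    planeAff (b 0 - a 0) (b 1 - a 1) (-((b 0 - a 0) * a 0 + (b 1 - a 1) * a 1)),
    planeAff (-(b 0 - a 0)) (-(b 1 - a 1)) ((b 0 - a 0) * b 0 + (b 1 - a 1) * b 1)}

/-- The face lies on the line `a b` because it is not crossed by it, and between the two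
perpendiculars because it is not crossed by these. -/
lemma exists_lineMap_of_oneSided (hab : a ≠ b)
    (h : ∀ f ∈ sideFunctions a b, ∀ s ∈ K.faces, OneSided f s) {s : Finset Plane}
    (hs : s ∈ K.faces) {ρ : ℝ} (h0 : 0 ≤ ρ) (h1 : ρ ≤ 1) (hz : AffineMap.lineMap a b ρ ∈ openHull s)
    {y : Plane} (hy : y ∈ s) : ∃ σ : ℝ, 0 ≤ σ ∧ σ ≤ 1 ∧ y = AffineMap.lineMap a b σ := by
  have hd := sq_dist_pos hab
  have k1 := (h _ (Or.inl rfl) s hs).eq_zero hz (by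
    simp only [planeAff_apply, lineMap_coord]; ring) y hy
  have k2 := (h _ (Or.inr (Or.inl rfl)) s hs).nonneg hz (by
    have : 0 ≤ ρ * ((b 0 - a 0) ^ 2 + (b 1 - a 1) ^ 2) := by positivity
    simp only [planeAff_apply, lineMap_coord]; linarith) y hy
  have k3 := (h _ (Or.inr (Or.inr rfl)) s hs).nonneg hz (by
    have : 0 ≤ (1 - ρ) * ((b 0 - a 0) ^ 2 + (b 1 - a 1) ^ 2) :=
      mul_nonneg (by linarith) hd.le
    simp only [planeAff_apply, lineMap_coord]; linarith) y hy
  simp only [planeAff_apply] at k1 k2 k3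
  set D := (b 0 - a 0) ^ 2 + (b 1 - a 1) ^ 2 with hD
  -- The parameter of the orthogonal projection of `y` to the line.
  refine ⟨((b 0 - a 0) * (y 0 - a 0) + (b 1 - a 1) * (y 1 - a 1)) / D, ?_, ?_, ?_⟩
  · exact div_nonneg (by linarith) hd.le
  · rw [div_le_one hd, hD]; linarith
  · refine coord_ext ?_ ?_
    · rw [lineMap_coord, ← sub_eq_iff_eq_add', div_mul_eq_mul_div, eq_div_iff hd.ne', hD]
      linear_combination (-(b 1 - a 1)) * k1
    · rw [lineMap_coord, ← sub_eq_iff_eq_add', div_mul_eq_mul_div, eq_div_iff hd.ne', hD]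
      linear_combination (b 0 - a 0) * k1

/-- Consecutive vertices on a segment are joined by an edge. -/
lemma adj_of_consecutive (hab : a ≠ b) (h : ∀ f ∈ sideFunctions a b, ∀ s ∈ K.faces, OneSided f s)
    (hsp : ∀ ρ : ℝ, 0 ≤ ρ → ρ ≤ 1 → AffineMap.lineMap a b ρ ∈ K.space) {σ τ : ℝ} (h0 : 0 ≤ σ)
    (hστ : σ < τ) (h1 : τ ≤ 1) (hσ : AffineMap.lineMap a b σ ∈ K.vertices)
    (hτ : AffineMap.lineMap a b τ ∈ K.vertices)
    (hno : ∀ ρ, σ < ρ → ρ < τ → AffineMap.lineMap a b ρ ∉ K.vertices) :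
    (graph K).Adj (AffineMap.lineMap a b σ) (AffineMap.lineMap a b τ) := by
  classical
  have hinj := AffineMap.lineMap_injective ℝ hab
  have hd := sq_dist_pos hab
  -- The open face through the midpoint has its vertices on the segment, but none strictly between
  -- the two given ones.
  set μ := (σ + τ) / 2 with hμ
  obtain ⟨s, hs, hms⟩ := exists_face_mem_openHull (hsp μ (by linarith) (by linarith))
  have hmem : ∀ y ∈ s, ∃ ρ : ℝ, (ρ ≤ σ ∨ τ ≤ ρ) ∧ y = AffineMap.lineMap a b ρ := by
    intro y hy
    obtain ⟨ρ, -, -, rfl⟩ := exists_lineMap_of_oneSided hab h hs (by linarith) (by linarith) hms hy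
    refine ⟨ρ, ?_, rfl⟩
    by_contra hcon
    push Not at hcon
    exact hno ρ hcon.1 hcon.2 (K.down_closed hs (by simpa using hy) (by simp))
  -- The zero line of `g` is the perpendicular at the midpoint; the face has vertices on either side
  -- of it, which gives `ρ₁ ≤ σ` and `τ ≤ ρ₂`.
  let g : Plane →ᵃ[ℝ] ℝ := planeAff (b 0 - a 0) (b 1 - a 1)
    (-((b 0 - a 0) * (a 0 + μ * (b 0 - a 0)) + (b 1 - a 1) * (a 1 + μ * (b 1 - a 1))))
  have hg : ∀ ρ : ℝ, g (AffineMap.lineMap a b ρ) =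
      (ρ - μ) * ((b 0 - a 0) ^ 2 + (b 1 - a 1) ^ 2) := fun ρ => by
    simp only [g, planeAff_apply, lineMap_coord]; ring
  have hgμ : g (AffineMap.lineMap a b μ) = 0 := by rw [hg]; ring
  obtain ⟨y₁, hy₁, hgy₁⟩ : ∃ y ∈ s, g y ≤ 0 := by
    by_contra hcon
    push Not at hcon
    have := convexHull_min (fun y hy => hcon y hy)
      ((convex_Ioi (0 : ℝ)).affine_preimage g) (openHull_subset _ hms)
    exact (ne_of_gt this) hgμ
  obtain ⟨y₂, hy₂, hgy₂⟩ : ∃ y ∈ s, 0 ≤ g y := by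
    by_contra hcon
    push Not at hcon
    have := convexHull_min (fun y hy => hcon y hy)
      ((convex_Iio (0 : ℝ)).affine_preimage g) (openHull_subset _ hms)
    exact (ne_of_lt this) hgμ
  obtain ⟨ρ₁, hρ₁, rfl⟩ := hmem y₁ hy₁
  obtain ⟨ρ₂, hρ₂, rfl⟩ := hmem y₂ hy₂
  rw [hg] at hgy₁ hgy₂
  have k₁ : ρ₁ ≤ σ := hρ₁.resolve_right fun h' => by nlinarith
  have k₂ : τ ≤ ρ₂ := hρ₂.resolve_left fun h' => by nlinarith
  have hpair : ({AffineMap.lineMap a b ρ₁, AffineMap.lineMap a b ρ₂} : Finset Plane) ∈ K.faces :=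
    K.down_closed hs (by simp [Finset.insert_subset_iff, hy₁, hy₂]) (by simp)
  -- A vertex lying on an edge is one of its ends. So the two given vertices are the ends of the
  -- edge found.
  have hend : ∀ ρ : ℝ, AffineMap.lineMap a b ρ ∈ K.vertices → ρ₁ ≤ ρ → ρ ≤ ρ₂ →
      ρ = ρ₁ ∨ ρ = ρ₂ := by
    intro ρ hv h₁ h₂
    have hlt : ρ₁ < ρ₂ := by linarith
    have hseg : AffineMap.lineMap a b ρ ∈ convexHull ℝ
        (({AffineMap.lineMap a b ρ₁, AffineMap.lineMap a b ρ₂} : Finset Plane) : Set Plane) := by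
      rw [Finset.coe_insert, Finset.coe_singleton, convexHull_pair]
      refine ⟨(ρ₂ - ρ) / (ρ₂ - ρ₁), (ρ - ρ₁) / (ρ₂ - ρ₁), div_nonneg (by linarith) (by linarith),
        div_nonneg (by linarith) (by linarith), ?_, ?_⟩
      · rw [← add_div, div_eq_one_iff_eq (by linarith)]; ring
      · have hne : ρ₂ - ρ₁ ≠ 0 := by linarith
        refine coord_ext ?_ ?_ <;>
        · simp only [PiLp.add_apply, PiLp.smul_apply, lineMap_coord, smul_eq_mul]
          field_simp
          ring
    have hv' : ({AffineMap.lineMap a b ρ} : Finset Plane) ∈ K.faces := hv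
    have hsub : ({AffineMap.lineMap a b ρ} : Finset Plane) ⊆
        {AffineMap.lineMap a b ρ₁, AffineMap.lineMap a b ρ₂} := by
      refine subset_of_mem_openHull hv' hpair (x := AffineMap.lineMap a b ρ) ?_ hseg
      obtain ⟨y, hy⟩ := openHull_nonempty hv'
      have : y = AffineMap.lineMap a b ρ := by simpa using openHull_subset _ hy
      exact this ▸ hy
    have : AffineMap.lineMap a b ρ = AffineMap.lineMap a b ρ₁ ∨
      AffineMap.lineMap a b ρ = AffineMap.lineMap a b ρ₂ := by simpa using hsub
    exact this.imp (fun e => hinj e) (fun e => hinj e)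
  have e₁ : σ = ρ₁ := (hend σ hσ k₁ (by linarith)).resolve_right (by intro e; linarith)
  have e₂ : τ = ρ₂ := (hend τ hτ (by linarith) k₂).resolve_left (by intro e; linarith)
  rw [e₁, e₂, graph_adj_iff]
  exact ⟨fun e => by have := hinj e; linarith, hpair⟩

end

/-! ### Cycles from sequences -/

section

variable {V : Type*} {G : SimpleGraph V}

lemma exists_path_of_seq (q : ℕ → V) (N : ℕ) (hadj : ∀ j < N, G.Adj (q j) (q (j + 1)))
    (hinj : ∀ i ≤ N, ∀ j ≤ N, q i = q j → i = j) :
    ∃ w : G.Walk (q 0) (q N), w.IsPath ∧ (∀ x, x ∈ w.support ↔ ∃ j ≤ N, x = q j) ∧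
      ∀ e, e ∈ w.edges ↔ ∃ j < N, e = s(q j, q (j + 1)) := by
  induction N with
  | zero => exact ⟨.nil, by simp, by simp, by simp⟩
  | succ N ih =>
    obtain ⟨w, h1, h2, h3⟩ := ih (fun j hj => hadj j (by omega))
      fun i hi j hj => hinj i (by omega) j (by omega)
    refine ⟨w.concat (hadj N (by omega)), ?_, fun x => ?_, fun e => ?_⟩
    · refine h1.concat (fun h => ?_) _
      obtain ⟨j, hj, e⟩ := (h2 _).1 h
      have := hinj _ le_rfl j (by omega) e
      omega
    · rw [Walk.support_concat, List.mem_append, h2, List.mem_singleton]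
      constructor
      · rintro (⟨j, hj, rfl⟩ | rfl)
        · exact ⟨j, by omega, rfl⟩
        · exact ⟨N + 1, le_rfl, rfl⟩
      · rintro ⟨j, hj, rfl⟩
        rcases hj.eq_or_lt with rfl | hj
        · exact Or.inr rfl
        · exact Or.inl ⟨j, by omega, rfl⟩
    · rw [Walk.edges_concat, List.concat_eq_append, List.mem_append, h3, List.mem_singleton]
      constructor
      · rintro (⟨j, hj, rfl⟩ | rfl)
        · exact ⟨j, by omega, rfl⟩
        · exact ⟨N, by omega, rfl⟩
      · rintro ⟨j, hj, rfl⟩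
        rcases (Nat.lt_succ_iff.1 hj).eq_or_lt with rfl | hj
        · exact Or.inr rfl
        · exact Or.inl ⟨j, by omega, rfl⟩

lemma exists_cycle_of_seq (q : ℕ → V) (N : ℕ) (hN : 2 ≤ N)
    (hadj : ∀ j ≤ N, G.Adj (q j) (q (j + 1)))
    (hinj : ∀ i ≤ N, ∀ j ≤ N, q i = q j → i = j) (hclose : q (N + 1) = q 0) :
    ∃ w : G.Walk (q N) (q N), w.IsCycle ∧ (∀ x, x ∈ w.support ↔ ∃ j ≤ N, x = q j) ∧
      ∀ e, e ∈ w.edges ↔ ∃ j ≤ N, e = s(q j, q (j + 1)) := by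
  obtain ⟨w, h1, h2, h3⟩ := exists_path_of_seq q N (fun j hj => hadj j hj.le) hinj
  have hlast : G.Adj (q N) (q 0) := hclose ▸ hadj N le_rfl
  refine ⟨.cons hlast w, ?_, fun x => ?_, fun e => ?_⟩
  · rw [Walk.cons_isCycle_iff]
    refine ⟨h1, fun h => ?_⟩
    obtain ⟨j, hj, e⟩ := (h3 _).1 h
    -- The closing edge is not on the path: it joins the indices `N` and `0`, which are not
    -- consecutive as `N ≥ 2`.
    rw [Sym2.eq_iff] at e
    rcases e with e | e
    · have := hinj _ le_rfl j (by omega) e.1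
      omega
    · have := hinj _ le_rfl _ (by omega) e.1
      have := hinj 0 (by omega) j (by omega) e.2
      omega
  · rw [Walk.support_cons, List.mem_cons, h2]
    exact ⟨fun h => h.elim (fun h => ⟨N, le_rfl, h⟩) id, Or.inr⟩
  · rw [Walk.edges_cons, List.mem_cons, h3]
    constructor
    · rintro (rfl | ⟨j, hj, rfl⟩)
      · exact ⟨N, le_rfl, by rw [hclose]⟩
      · exact ⟨j, hj.le, rfl⟩
    · rintro ⟨j, hj, rfl⟩
      rcases hj.eq_or_lt with rfl | hj
      · exact Or.inl (by rw [hclose])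
      · exact Or.inr ⟨j, hj, rfl⟩

/-- The elements of a finite nonempty set of real numbers in increasing order. -/
lemma exists_enumeration (Θ : Finset ℝ) (hΘ : Θ.Nonempty) :
    ∃ (N : ℕ) (θ : ℕ → ℝ), (∀ j, θ j ∈ Θ) ∧ (∀ t ∈ Θ, ∃ j ≤ N, t = θ j) ∧
      ∀ i j, i < j → j ≤ N → θ i < θ j := by
  obtain ⟨N, hN⟩ : ∃ N, Θ.card = N + 1 := ⟨Θ.card - 1, by have := hΘ.card_pos; omega⟩
  -- The index is capped at `N` to have values for all natural numbers; beyond `N` the sequence is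
  -- constant.
  refine ⟨N, fun j => Θ.orderEmbOfFin hN ⟨min j N, by omega⟩, fun j => Finset.orderEmbOfFin_mem _ _ _,
    fun t ht => ?_, fun i j hij hj => ?_⟩
  · have : t ∈ Set.range (Θ.orderEmbOfFin hN) := by rw [Finset.range_orderEmbOfFin]; exact ht
    obtain ⟨j, rfl⟩ := this
    refine ⟨j, by omega, congrArg _ (Fin.ext ?_)⟩
    simp; omega
  · refine (Θ.orderEmbOfFin hN).strictMono ?_
    rw [Fin.mk_lt_mk]; omega

end

end DiscretePlane

namespace DiscretePlane

open Geometry SimpleGraph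

/-! ### Simple polygons as simple cycles -/

section Polygon

variable {n : ℕ} {P : Polygon Plane n} {K : SimplicialComplex ℝ Plane}

/-- The vertices of a polygon, numbered cyclically by the natural numbers. -/
def corner (P : Polygon Plane n) (hn : 0 < n) (i : ℕ) : Plane := P ⟨i % n, Nat.mod_lt _ hn⟩

/-- The parametrization of a polygon that runs through one side per unit of time. -/
noncomputable def polygonPath (P : Polygon Plane n) (hn : 0 < n) (t : ℝ) : Plane :=
  AffineMap.lineMap (corner P hn ⌊t⌋₊) (corner P hn (⌊t⌋₊ + 1)) (t - ⌊t⌋₊)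

lemma corner_succ (P : Polygon Plane n) (hn : 0 < n) (i : ℕ) :
    corner P hn (i + 1) = P (finRotate n ⟨i % n, Nat.mod_lt _ hn⟩) := by
  obtain ⟨m, rfl⟩ : ∃ m, n = m + 1 := ⟨n - 1, by omega⟩
  rw [corner, finRotate_apply]
  congr 1
  ext
  rw [Fin.val_add, Fin.val_one']
  exact Nat.add_mod i 1 (m + 1)

lemma corner_add (P : Polygon Plane n) (hn : 0 < n) (i : ℕ) :
    corner P hn (i + n) = corner P hn i := by
  simp [corner]

lemma corner_val (P : Polygon Plane n) (hn : 0 < n) (i : Fin n) : corner P hn i = P i := by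
  rw [corner]; congr 1; exact Fin.ext (Nat.mod_eq_of_lt i.2)

/-- The value `ρ = 1` is included: there the integral part jumps, and the next side starts at the
same corner. -/
lemma polygonPath_add (P : Polygon Plane n) (hn : 0 < n) (i : ℕ) {ρ : ℝ} (h0 : 0 ≤ ρ)
    (h1 : ρ ≤ 1) :
    polygonPath P hn (i + ρ) = AffineMap.lineMap (corner P hn i) (corner P hn (i + 1)) ρ := by
  rcases h1.eq_or_lt with rfl | h1
  · have : ⌊(i : ℝ) + 1⌋₊ = i + 1 := by exact_mod_cast Nat.floor_natCast (R := ℝ) (i + 1)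
    rw [polygonPath, this]
    simp
  · have : ⌊(i : ℝ) + ρ⌋₊ = i := by
      rw [Nat.floor_eq_iff (by positivity)]
      constructor <;> linarith
    rw [polygonPath, this, add_sub_cancel_left]

lemma polygonPath_nat (P : Polygon Plane n) (hn : 0 < n) (i : ℕ) :
    polygonPath P hn i = corner P hn i := by
  have := polygonPath_add P hn i le_rfl zero_le_one
  simpa using this

lemma exists_nat_add {t : ℝ} (h0 : 0 ≤ t) (h1 : t < n) :
    ∃ (i : ℕ) (ρ : ℝ), i < n ∧ 0 ≤ ρ ∧ ρ < 1 ∧ t = i + ρ := by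
  refine ⟨⌊t⌋₊, t - ⌊t⌋₊, ?_, ?_, ?_, by ring⟩
  · exact (Nat.floor_lt h0).2 h1
  · linarith [Nat.floor_le h0]
  · linarith [Nat.lt_floor_add_one t]

lemma lineMap_mem_edgeSet (P : Polygon Plane n) (hn : 0 < n) (i : ℕ) {ρ : ℝ} (h0 : 0 ≤ ρ)
    (h1 : ρ ≤ 1) : AffineMap.lineMap (corner P hn i) (corner P hn (i + 1)) ρ ∈
      P.edgeSet ℝ ⟨i % n, Nat.mod_lt _ hn⟩ := by
  rw [corner_succ]
  exact ⟨ρ, ⟨h0, h1⟩, rfl⟩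

lemma exists_polygonPath_eq (P : Polygon Plane n) (hn : 0 < n) {z : Plane}
    (hz : z ∈ P.boundary ℝ) : ∃ t : ℝ, 0 ≤ t ∧ t < n ∧ z = polygonPath P hn t := by
  obtain ⟨i, hi⟩ := Set.mem_iUnion.1 hz
  obtain ⟨ρ, ⟨h0, h1⟩, rfl⟩ := hi
  have hmod : (⟨(i : ℕ) % n, Nat.mod_lt _ hn⟩ : Fin n) = i := Fin.ext (Nat.mod_eq_of_lt i.2)
  have e : AffineMap.lineMap (P i) (P (finRotate n i)) ρ = polygonPath P hn ((i : ℕ) + ρ) := by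
    rw [polygonPath_add P hn i h0 h1, corner_succ, hmod, corner_val]
  by_cases hlt : ((i : ℕ) : ℝ) + ρ < n
  · exact ⟨(i : ℕ) + ρ, by positivity, hlt, e⟩
  · refine ⟨0, le_rfl, by exact_mod_cast hn, e.trans ?_⟩
    have h2 : ((i : ℕ) : ℝ) + 1 ≤ n := by exact_mod_cast i.2
    have h3 : ((i : ℕ) : ℝ) + ρ = (n : ℕ) := by linarith
    have h4 := corner_add P hn 0
    rw [zero_add] at h4
    have h5 := polygonPath_nat P hn 0
    rw [Nat.cast_zero] at h5
    rw [h3, polygonPath_nat, h4, h5]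

lemma IsSimplePolygon.corner_injective (hP : IsSimplePolygon P) (hn : 0 < n) {i j : ℕ} (hi : i < n) (hj : j < n)
    (h : corner P hn i = corner P hn j) : i = j := by
  have := hP.2.1 h
  rw [Fin.mk.injEq, Nat.mod_eq_of_lt hi, Nat.mod_eq_of_lt hj] at this
  exact this

lemma IsSimplePolygon.corner_ne (hP : IsSimplePolygon P) (hn : 0 < n) (i : ℕ) : corner P hn i ≠ corner P hn (i + 1) := by
  intro h
  have := hP.2.1 h
  rw [Fin.mk.injEq] at this
  have h3 := hP.1
  have h4 := (Nat.modEq_iff_dvd' (Nat.le_succ i)).1 this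
  rw [Nat.succ_eq_add_one, Nat.add_sub_cancel_left] at h4
  have := Nat.le_of_dvd one_pos h4
  omega

/-- A common point of two sides is an end of both. As the parameters on the sides are less than `1`,
it is the starting corner of both, and corners are different. -/
lemma IsSimplePolygon.polygonPath_injOn (hP : IsSimplePolygon P) (hn : 0 < n) :
    Set.InjOn (polygonPath P hn) {t | 0 ≤ t ∧ t < n} := by
  rintro s ⟨hs0, hs1⟩ t ⟨ht0, ht1⟩ h
  obtain ⟨i, ρ, hi, hρ0, hρ1, rfl⟩ := exists_nat_add hs0 hs1
  obtain ⟨j, σ, hj, hσ0, hσ1, rfl⟩ := exists_nat_add ht0 ht1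
  rw [polygonPath_add P hn i hρ0 hρ1.le, polygonPath_add P hn j hσ0 hσ1.le] at h
  by_cases hij : i = j
  · subst hij
    rw [AffineMap.lineMap_injective ℝ (hP.corner_ne hn i) h]
  exfalso
  have mi := lineMap_mem_edgeSet P hn i hρ0 hρ1.le
  have mj := lineMap_mem_edgeSet P hn j hσ0 hσ1.le
  have hne : (⟨i % n, Nat.mod_lt _ hn⟩ : Fin n) ≠ ⟨j % n, Nat.mod_lt _ hn⟩ := by
    rw [Ne, Fin.mk.injEq, Nat.mod_eq_of_lt hi, Nat.mod_eq_of_lt hj]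
    exact hij
  have hI := hP.2.2 _ _ hne
  have hm : AffineMap.lineMap (corner P hn i) (corner P hn (i + 1)) ρ ∈
      ({P ⟨i % n, Nat.mod_lt _ hn⟩, P (finRotate n ⟨i % n, Nat.mod_lt _ hn⟩)} : Set Plane) ∩
        {P ⟨j % n, Nat.mod_lt _ hn⟩, P (finRotate n ⟨j % n, Nat.mod_lt _ hn⟩)} := by
    rw [← hI]; exact ⟨mi, h ▸ mj⟩
  rw [← corner_succ P hn, ← corner_succ P hn] at hm
  change _ ∈ ({corner P hn i, _} : Set Plane) ∩ {corner P hn j, _} at hm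
  have start : ∀ (k : ℕ) (τ : ℝ), τ < 1 →
      AffineMap.lineMap (corner P hn k) (corner P hn (k + 1)) τ ∈
        ({corner P hn k, corner P hn (k + 1)} : Set Plane) →
      AffineMap.lineMap (corner P hn k) (corner P hn (k + 1)) τ = corner P hn k := by
    rintro k τ hτ (hk | hk)
    · exact hk
    · have h1 : AffineMap.lineMap (corner P hn k) (corner P hn (k + 1)) τ =
          AffineMap.lineMap (corner P hn k) (corner P hn (k + 1)) (1 : ℝ) := by
        rw [AffineMap.lineMap_apply_one]; exact hk
      exact absurd (AffineMap.lineMap_injective ℝ (hP.corner_ne hn k) h1) hτ.ne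
  have e1 := start i ρ hρ1 hm.1
  have e2 := start j σ hσ1 (h ▸ hm.2)
  exact hij (hP.corner_injective hn hi hj (e1.symm.trans (h.trans e2)))

/-- A simple polygon in the 1-skeleton of a triangulation is a simple cycle. -/
theorem IsSimplePolygon.exists_isSimpleCycle (hP : IsSimplePolygon P) (hK : K.faces.Finite)
    (hsub : P.boundary ℝ ⊆ K.space) (hside : ∀ i : Fin n,
      ∀ f ∈ sideFunctions (P i) (P (finRotate n i)), ∀ s ∈ K.faces, OneSided f s)
    (hv : ∀ i, P i ∈ K.vertices) : ∃ C : (graph K).Subgraph, IsSimpleCycle C ∧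
      carrier C = P.boundary ℝ ∧ ∀ x ∈ P.boundary ℝ, x ∈ K.vertices → x ∈ C.verts := by
  classical
  have hn3 := hP.1
  have hn : 0 < n := by omega
  set γ := polygonPath P hn with hγ
  have hadd := fun i {ρ} => polygonPath_add P hn i (ρ := ρ)
  have hbdry : ∀ i {ρ : ℝ}, 0 ≤ ρ → ρ ≤ 1 →
      AffineMap.lineMap (corner P hn i) (corner P hn (i + 1)) ρ ∈ P.boundary ℝ :=
    fun i _ h0 h1 => Set.mem_iUnion.2 ⟨_, lineMap_mem_edgeSet P hn i h0 h1⟩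
  -- Finiteness comes from injectivity on `[0, n)`; the parameter `n`, at which the starting corner
  -- recurs, is added by hand.
  have hfin : {t : ℝ | 0 ≤ t ∧ t ≤ n ∧ γ t ∈ K.vertices}.Finite := by
    have h1 : {t : ℝ | (0 ≤ t ∧ t < n) ∧ γ t ∈ K.vertices}.Finite := by
      refine Set.Finite.of_finite_image ((vertices_finite hK).subset ?_)
        ((hP.polygonPath_injOn hn).mono fun t ht => ht.1)
      rintro _ ⟨t, ht, rfl⟩
      exact ht.2
    refine (h1.insert (n : ℝ)).subset fun t ht => ?_
    rcases ht.2.1.eq_or_lt with h | h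
    · exact Or.inl h
    · exact Or.inr ⟨⟨ht.1, h⟩, ht.2.2⟩
  have hmem : ∀ t, t ∈ hfin.toFinset ↔ 0 ≤ t ∧ t ≤ n ∧ γ t ∈ K.vertices := fun t => by
    rw [Set.Finite.mem_toFinset]; rfl
  have hnat : ∀ i : ℕ, i ≤ n → (i : ℝ) ∈ hfin.toFinset := fun i hi => by
    rw [hmem]
    refine ⟨by positivity, by exact_mod_cast hi, ?_⟩
    rw [hγ, polygonPath_nat]
    exact hv _
  obtain ⟨N, θ, hθ, hsurj, hmono⟩ := exists_enumeration hfin.toFinset ⟨_, hnat 0 (by omega)⟩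
  have hlt : ∀ i j, i ≤ N → θ i < θ j → i < j := fun i j hi h => by
    by_contra hle
    rcases (not_lt.1 hle).eq_or_lt with rfl | h'
    · exact lt_irrefl _ h
    · exact lt_asymm h (hmono j i h' hi)
  have hθ' : ∀ j, 0 ≤ θ j ∧ θ j ≤ n ∧ γ (θ j) ∈ K.vertices := fun j => (hmem _).1 (hθ j)
  have hθ0 : θ 0 = 0 := by
    obtain ⟨j, hj, e⟩ := hsurj _ (hnat 0 (by omega))
    rw [Nat.cast_zero] at e
    rcases Nat.eq_zero_or_pos j with rfl | hpos
    · exact e.symm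
    · have := hmono 0 j hpos hj
      have := (hθ' 0).1
      linarith
  have hθN : θ N = n := by
    obtain ⟨j, hj, e⟩ := hsurj _ (hnat n le_rfl)
    rcases hj.eq_or_lt with rfl | hj
    · exact e.symm
    · have := hmono j N hj le_rfl
      have := (hθ' N).2.1
      linarith
  -- The parameters `0 < 1 < 2 < n` all occur, so `N ≥ 3`. The cycle has the vertices with numbers
  -- `0, …, M`, where `N = M + 1`, hence at least three; number `N` is the starting point again.
  obtain ⟨j₁, hj₁, e₁⟩ := hsurj _ (hnat 1 (by omega))
  obtain ⟨j₂, hj₂, e₂⟩ := hsurj _ (hnat 2 (by omega))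
  have hn3' : (3 : ℝ) ≤ n := by exact_mod_cast hn3
  have l1 := hlt 0 j₁ (by omega) (by rw [hθ0, ← e₁]; norm_num)
  have l2 := hlt j₁ j₂ hj₁ (by rw [← e₁, ← e₂]; norm_num)
  have l3 := hlt j₂ N hj₂ (by rw [← e₂, hθN]; push_cast; linarith)
  obtain ⟨M, rfl⟩ : ∃ M, N = M + 1 := ⟨N - 1, by omega⟩
  -- consecutive parameters belong to the same side
  have hcons : ∀ j ≤ M, ∃ (i : ℕ) (σ τ : ℝ), i < n ∧ 0 ≤ σ ∧ σ < τ ∧ τ ≤ 1 ∧ θ j = i + σ ∧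
      θ (j + 1) = i + τ := by
    intro j hj
    have h1 := hmono j (j + 1) (by omega) (by omega)
    obtain ⟨i, σ, hi, h2, h3, e⟩ := exists_nat_add (hθ' j).1 (h1.trans_le (hθ' (j + 1)).2.1)
    refine ⟨i, σ, θ (j + 1) - i, hi, h2, by linarith, ?_, e, by ring⟩
    by_contra hcon
    obtain ⟨k, hk, ek⟩ := hsurj _ (hnat (i + 1) hi)
    push_cast at ek
    have := hlt j k (by omega) (by linarith)
    have := hlt k (j + 1) hk (by linarith)
    omega
  have hsegm : ∀ j ≤ M, segment ℝ (γ (θ j)) (γ (θ (j + 1))) = γ '' Set.Icc (θ j) (θ (j + 1)) := by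
    intro j hj
    obtain ⟨i, σ, τ, hi, h0, h1, h2, e, e'⟩ := hcons j hj
    rw [e, e', hγ, hadd i h0 (by linarith), hadd i (by linarith) h2, ← image_segment ℝ,
      segment_eq_Icc h1.le]
    ext z
    constructor
    · rintro ⟨ρ, hρ, rfl⟩
      exact ⟨i + ρ, ⟨by linarith [hρ.1], by linarith [hρ.2]⟩,
        hadd i (by linarith [hρ.1]) (by linarith [hρ.2])⟩
    · rintro ⟨t, ht, rfl⟩
      refine ⟨t - i, ⟨by linarith [ht.1], by linarith [ht.2]⟩, ?_⟩
      rw [← hadd i (by linarith [ht.1]) (by linarith [ht.2])]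
      congr 1; ring
  have hγb : ∀ t : ℝ, 0 ≤ t → t ≤ n → γ t ∈ P.boundary ℝ := by
    intro t h0 h1
    rcases h1.eq_or_lt with h1 | h1
    · rw [h1, hγ, polygonPath_nat]
      have := hbdry n (ρ := 0) le_rfl zero_le_one
      rwa [AffineMap.lineMap_apply_zero] at this
    · obtain ⟨i, ρ, hi, h2, h3, rfl⟩ := exists_nat_add h0 h1
      rw [hγ, hadd i h2 h3.le]
      exact hbdry i h2 h3.le
  obtain ⟨w, hw, hws, hwe⟩ := exists_cycle_of_seq (G := graph K) (fun j => γ (θ j)) M (by omega)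
    (fun j hj => by
      obtain ⟨i, σ, τ, hi, h0, h1, h2, e, e'⟩ := hcons j hj
      have v1 := (hθ' j).2.2
      have v2 := (hθ' (j + 1)).2.2
      rw [e, hγ, hadd i h0 (by linarith)] at v1 ⊢
      rw [e', hγ, hadd i (by linarith) h2] at v2
      rw [e', hadd i (by linarith) h2]
      have hs := hside ⟨i % n, Nat.mod_lt _ hn⟩
      rw [← corner_succ P hn] at hs
      refine adj_of_consecutive (hP.corner_ne hn i) hs (fun ρ k0 k1 => hsub (hbdry i k0 k1)) h0 h1 h2
        v1 v2 fun ρ k0 k1 hρ => ?_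
      rw [← hadd i (by linarith) (by linarith)] at hρ
      have := (hθ' (j + 1)).2.1
      obtain ⟨k, hk, ek⟩ := hsurj (i + ρ) ((hmem _).2
        ⟨by have : (0 : ℝ) ≤ i := Nat.cast_nonneg i
            linarith, by linarith, hρ⟩)
      have := hlt j k (by omega) (by linarith)
      have := hlt k (j + 1) hk (by linarith)
      omega)
    (fun i hi j hj h => by
      have hb : ∀ i ≤ M, θ i ∈ {t : ℝ | 0 ≤ t ∧ t < n} := fun i hi =>
        ⟨(hθ' i).1, hθN ▸ hmono i (M + 1) (by omega) le_rfl⟩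
      have he := hP.polygonPath_injOn hn (hb i hi) (hb j hj) h
      by_contra hne
      rcases lt_or_gt_of_ne hne with h' | h'
      · exact (hmono i j h' (by omega)).ne he
      · exact (hmono j i h' (by omega)).ne he.symm)
    (by
      have h4 := corner_add P hn 0
      have h5 := polygonPath_nat P hn 0
      rw [zero_add] at h4
      rw [Nat.cast_zero] at h5
      rw [hθN, hθ0, hγ, polygonPath_nat, h4, h5])
  have hfind : ∀ t : ℝ, 0 ≤ t → t < n → ∃ j ≤ M, θ j ≤ t ∧ t < θ (j + 1) := by
    intro t h0 h1
    have hex : ∃ k, t < θ k := ⟨M + 1, hθN ▸ h1⟩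
    have hk := Nat.find_spec hex
    have hkM : Nat.find hex ≤ M + 1 := Nat.find_min' hex (hθN ▸ h1)
    obtain ⟨j, ej⟩ : ∃ j, Nat.find hex = j + 1 := by
      refine ⟨Nat.find hex - 1, ?_⟩
      have : Nat.find hex ≠ 0 := fun e => by
        rw [e, hθ0] at hk
        linarith
      omega
    refine ⟨j, by omega, not_lt.1 (Nat.find_min hex (by omega)), ej ▸ hk⟩
  have hAdj : ∀ x y, w.toSubgraph.Adj x y ↔ ∃ j ≤ M, s(x, y) = s(γ (θ j), γ (θ (j + 1))) :=
    fun x y => by rw [← hwe, ← Walk.mem_edges_toSubgraph, Subgraph.mem_edgeSet]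
  refine ⟨w.toSubgraph, ⟨_, w, hw, rfl⟩, ?_, ?_⟩
  · ext z
    constructor
    · rintro ⟨x, y, hxy, hz⟩
      obtain ⟨j, hj, e⟩ := (hAdj x y).1 hxy
      have hz' : z ∈ segment ℝ (γ (θ j)) (γ (θ (j + 1))) := by
        rw [Sym2.eq_iff] at e
        rcases e with ⟨rfl, rfl⟩ | ⟨rfl, rfl⟩
        · exact hz
        · rwa [segment_symm]
      rw [hsegm j hj] at hz'
      obtain ⟨t, ht, rfl⟩ := hz'
      exact hγb t ((hθ' j).1.trans ht.1) (ht.2.trans (hθ' (j + 1)).2.1)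
    · intro hz
      obtain ⟨t, h0, h1, rfl⟩ := exists_polygonPath_eq P hn hz
      obtain ⟨j, hj, h2, h3⟩ := hfind t h0 h1
      refine ⟨_, _, (hAdj _ _).2 ⟨j, hj, rfl⟩, ?_⟩
      rw [hsegm j hj]
      exact ⟨t, ⟨h2, h3.le⟩, rfl⟩
  · intro x hx hxv
    obtain ⟨t, h0, h1, rfl⟩ := exists_polygonPath_eq P hn hx
    obtain ⟨j, hj, rfl⟩ := hsurj t ((hmem t).2 ⟨h0, h1.le, hxv⟩)
    rw [Walk.mem_verts_toSubgraph, hws]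
    refine ⟨j, ?_, rfl⟩
    have : j ≠ M + 1 := fun e => by rw [e, hθN] at h1; exact lt_irrefl _ h1
    omega

end Polygon

end DiscretePlane

namespace DiscretePlane

open Geometry SimpleGraph

/-! ### A triangulation adapted to a polygon -/

section

variable {K K' : SimplicialComplex ℝ Plane}

/-- A simple cycle of `K` whose edges are edges of `K'` is a simple cycle of `K'`. -/
lemma IsSimpleCycle.exists_transfer {C : (graph K).Subgraph} (hC : IsSimpleCycle C)
    (h : C.spanningCoe ≤ graph K') : ∃ C' : (graph K').Subgraph, IsSimpleCycle C' ∧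
      (∀ x, x ∈ C'.verts ↔ x ∈ C.verts) ∧ ∀ x y, C'.Adj x y ↔ C.Adj x y := by
  obtain ⟨u, w, hw, rfl⟩ := hC
  have he : ∀ e ∈ w.edges, e ∈ (graph K').edgeSet := by
    intro e he
    induction e using Sym2.ind with | _ x y => ?_
    exact h ((w.mem_edges_toSubgraph).2 he)
  refine ⟨(w.transfer (graph K') he).toSubgraph, ⟨u, _, hw.transfer he, rfl⟩, fun x => ?_,
    fun x y => ?_⟩
  · rw [Walk.mem_verts_toSubgraph, Walk.support_transfer, Walk.mem_verts_toSubgraph]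
  · rw [← Subgraph.mem_edgeSet, ← Subgraph.mem_edgeSet, Walk.mem_edges_toSubgraph,
      Walk.edges_transfer, Walk.mem_edges_toSubgraph]

lemma IsSimpleCycle.mem_verts_iff {C : (graph K).Subgraph} (hC : IsSimpleCycle C) {x : Plane} :
    x ∈ C.verts ↔ x ∈ C.spanningCoe.support :=
  ⟨fun h => hC.exists_adj h, fun ⟨_, h⟩ => h.fst_mem⟩

/-- With degree two, three mutually adjacent vertices are closed under adjacency, so they would be
all the vertices of the cycle. -/
lemma IsSimpleCycle.not_triangle {C : (graph K).Subgraph} (hC : IsSimpleCycle C) {s : Finset Plane}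
    (hs : 4 ≤ s.card) (hsC : ∀ x ∈ s, x ∈ C.verts) {a b d : Plane} (hab : C.Adj a b)
    (hbd : C.Adj b d) (had : C.Adj a d) : False := by
  classical
  have nb : ∀ {x y z u}, C.Adj x y → C.Adj x z → y ≠ z → C.Adj x u → u = y ∨ u = z := by
    intro x y z u hy hz hyz hu
    obtain ⟨q, -, -, hall⟩ := hC.exists_other hy
    have := (hall z hz).resolve_left hyz.symm
    exact this ▸ hall u hu
  have hsub : s ⊆ {a, b, d} := by
    intro x hx
    refine hC.induction (Q := fun v => v ∈ ({a, b, d} : Finset Plane)) ?_ hab.fst_mem (hsC x hx)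
      (by simp)
    intro v u hvu hv
    simp only [Finset.mem_insert, Finset.mem_singleton] at hv ⊢
    rcases hv with rfl | rfl | rfl
    · rcases nb hab had hbd.ne hvu with h | h <;> simp [h]
    · rcases nb hab.symm hbd had.ne hvu with h | h <;> simp [h]
    · rcases nb had.symm hbd.symm hab.ne hvu with h | h <;> simp [h]
  have := (Finset.card_le_card hsub).trans Finset.card_le_three
  omega

variable {n : ℕ} {P : Polygon Plane n} {c : Plane} {r : ℝ}

lemma corner_mem_boundary (hn : 0 < n) (i : ℕ) : corner P hn i ∈ P.boundary ℝ := by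
  have := lineMap_mem_edgeSet P hn i (ρ := 0) le_rfl zero_le_one
  rw [AffineMap.lineMap_apply_zero] at this
  exact Set.mem_iUnion.2 ⟨_, this⟩

lemma IsSimplePolygon.pos_of_boundary_subset (hP : IsSimplePolygon P)
    (h : P.boundary ℝ ⊆ square c r) : 0 < r := by
  have hn : 0 < n := by have := hP.1; omega
  by_contra hr
  have key : ∀ i, corner P hn i = c := by
    intro i
    obtain ⟨h0, h1⟩ := h (corner_mem_boundary hn i)
    have k0 : |corner P hn i 0 - c 0| = 0 := le_antisymm (by linarith) (abs_nonneg _)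
    have k1 : |corner P hn i 1 - c 1| = 0 := le_antisymm (by linarith) (abs_nonneg _)
    exact coord_ext (sub_eq_zero.1 (abs_eq_zero.1 k0)) (sub_eq_zero.1 (abs_eq_zero.1 k1))
  exact hP.corner_ne hn 0 ((key 0).trans (key 1).symm)

/-- A simple polygon in a square is a cycle, without chords and bridges, in some subdivision of a
given triangulation of the square. -/
theorem IsSimplePolygon.exists_triangulation (hP : IsSimplePolygon P)
    (hS : P.boundary ℝ ⊆ square c r) {L : SimplicialComplex ℝ Plane}
    (hL : IsTriangulation L (square c r)) {q : Plane} (hq : q ∈ P.boundary ℝ) :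
    ∃ K, Good c r K ∧ IsSubdivision K L ∧ ∃ C : (graph K).Subgraph,
      IsSimpleCycle C ∧ carrier C = P.boundary ℝ ∧ (∀ i, P i ∈ C.verts) ∧ q ∈ C.verts ∧
      IsDiscreteCurve C ∧ HasWideAngles C := by
  classical
  have hn : 0 < n := by have := hP.1; omega
  obtain ⟨F, hF, hFL⟩ := exists_affine_functions_subdivision hL.1
  obtain ⟨K₀, g₀⟩ := exists_good c (hP.pos_of_boundary_subset hS)
  -- an additional vertex, so that there are at least four
  have hn3 : (3 : ℝ) ≤ n := by exact_mod_cast hP.1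
  set m := polygonPath P hn (1 / 2) with hm
  have hm' : m = AffineMap.lineMap (corner P hn 0) (corner P hn 1) (1 / 2 : ℝ) := by
    have := polygonPath_add P hn 0 (ρ := 1 / 2) (by norm_num) (by norm_num)
    rwa [Nat.cast_zero, zero_add] at this
  have hmb : m ∈ P.boundary ℝ := by
    rw [hm']
    exact Set.mem_iUnion.2 ⟨_, lineMap_mem_edgeSet P hn 0 (by norm_num) (by norm_num)⟩
  -- One set of cuts serves all purposes: `F` makes `K₁` a subdivision of `L`, the side functions
  -- put the sides into the 1-skeleton, and the point functions make the corners, `q` and `m`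
  -- vertices.
  obtain ⟨K₁, g₁, -, h₁⟩ := g₀.exists_oneSided_of_finite
    (F := F ∪ ((⋃ i, sideFunctions (P i) (P (finRotate n i))) ∪
      ((⋃ i, pointFunctions (P i)) ∪ (pointFunctions q ∪ pointFunctions m)))) (by
    have hp : ∀ z, (pointFunctions z).Finite := fun z => by
      rw [pointFunctions]; exact Set.toFinite _
    exact hF.union ((Set.finite_iUnion fun i => by rw [sideFunctions]; exact Set.toFinite _).union
      ((Set.finite_iUnion fun i => hp _).union ((hp _).union (hp _)))))
  have hsp : P.boundary ℝ ⊆ K₁.space := g₁.space ▸ hS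
  have hPb : ∀ i, P i ∈ P.boundary ℝ := fun i => corner_val P hn i ▸ corner_mem_boundary hn i
  have hPv : ∀ i, P i ∈ K₁.vertices := fun i => mem_vertices_of_oneSided (hsp (hPb i))
    fun f hf => h₁ f (Or.inr (Or.inr (Or.inl (Set.mem_iUnion.2 ⟨i, hf⟩))))
  obtain ⟨C₁, hC₁, hcar, hCv⟩ := hP.exists_isSimpleCycle g₁.finite hsp
    (fun i f hf => h₁ f (Or.inr (Or.inl (Set.mem_iUnion.2 ⟨i, hf⟩)))) hPv
  have hPC : ∀ i, P i ∈ C₁.verts := fun i => hCv _ (hPb i) (hPv i)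
  have hqC : q ∈ C₁.verts := hCv _ hq (mem_vertices_of_oneSided (hsp hq)
    fun f hf => h₁ f (Or.inr (Or.inr (Or.inr (Or.inl hf)))))
  have hmC : m ∈ C₁.verts := hCv _ hmb (mem_vertices_of_oneSided (hsp hmb)
    fun f hf => h₁ f (Or.inr (Or.inr (Or.inr (Or.inr hf)))))
  have hfour : ∃ s : Finset Plane, 4 ≤ s.card ∧ ∀ x ∈ s, x ∈ C₁.verts := by
    have hcor : ∀ i : ℕ, polygonPath P hn i ∈ C₁.verts := fun i => by
      rw [polygonPath_nat]; exact hPC _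
    refine ⟨({0, 1 / 2, 1, 2} : Finset ℝ).image (polygonPath P hn), ?_, ?_⟩
    · rw [Finset.card_image_of_injOn]
      · norm_num
      · refine (hP.polygonPath_injOn hn).mono fun t ht => ?_
        simp only [Finset.coe_insert, Finset.coe_singleton, Set.mem_insert_iff,
          Set.mem_singleton_iff] at ht
        rcases ht with rfl | rfl | rfl | rfl <;> exact ⟨by norm_num, by linarith⟩
    · intro x hx
      simp only [Finset.mem_image, Finset.mem_insert, Finset.mem_singleton] at hx
      obtain ⟨t, rfl | rfl | rfl | rfl, rfl⟩ := hx
      · exact_mod_cast hcor 0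
      · exact hmC
      · exact_mod_cast hcor 1
      · exact_mod_cast hcor 2
  obtain ⟨s, hs, hsC⟩ := hfour
  have hle : C₁.spanningCoe ≤ graph K₁ := C₁.spanningCoe_le
  -- The cycle is kept as a plain graph on the points of the plane during the last subdivision, and
  -- then carried over to the new complex.
  obtain ⟨K₂, g₂, s₂, hle₂, hf₂, hb₂⟩ := g₁.exists_full_noBridge hle
  obtain ⟨C₂, hC₂, hv₂, ha₂⟩ := hC₁.exists_transfer hle₂
  have htri : ∀ a b d, C₁.spanningCoe.Adj a b → C₁.spanningCoe.Adj b d →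
      C₁.spanningCoe.Adj a d → False := fun a b d h1 h2 h3 => hC₁.not_triangle hs hsC h1 h2 h3
  have hv₂' : ∀ x, x ∈ C₂.verts ↔ x ∈ C₁.spanningCoe.support := fun x =>
    (hv₂ x).trans hC₁.mem_verts_iff
  refine ⟨K₂, g₂, s₂.trans (hFL K₁ (g₁.space.trans hL.2.symm) fun f hf => h₁ f (Or.inl hf)), C₂,
    hC₂, ?_, fun i => (hv₂ _).2 (hPC i), (hv₂ _).2 hqC,
    isDiscreteCurve_of_isFull hf₂ hv₂' htri, hasWideAngles_of_isFull hf₂ hb₂ hv₂' ha₂ htri⟩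
  rw [← hcar]
  ext z
  simp only [carrier, ha₂, Set.mem_ofPred_eq]

end

end DiscretePlane


/-! ### The theorem -/

theorem theorem3 {n : ℕ} (P : Polygon Plane n) (hP : IsSimplePolygon P)
    (c : Plane) (r : ℝ) (hS : P.boundary ℝ ⊆ interior (square c r)) :
    (∀ ε : ℝ, 0 < ε → ∃ T₀ : Geometry.SimplicialComplex ℝ Plane,
      IsTriangulation T₀ (square c r) ∧ HasMeshLE T₀ ε) ∧
    ∀ T₀ : Geometry.SimplicialComplex ℝ Plane, IsTriangulation T₀ (square c r) →
      ∀ p₀ ∈ P.boundary ℝ,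
        ∃ T : Geometry.SimplicialComplex ℝ Plane,
          IsTriangulation T (square c r) ∧ IsSubdivision T T₀ ∧
          IsDiscretelySimplyConnected T ∧
          ∃ C : (graph T).Subgraph,
            IsSimpleCycle C ∧ carrier C = P.boundary ℝ ∧
            (∀ i : Fin n, P i ∈ C.verts) ∧ p₀ ∈ C.verts ∧
            IsDiscreteCurve C ∧ HasWideAngles C ∧
            ∀ p ∈ C.verts, ∃ (m : ℕ) (Q : ℕ → (graph T).Subgraph),
              IsContraction C p m Q ∧ ∀ i < m, IsFarthestRemoval p (Q i) (Q (i + 1)) := by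
  have hS' : P.boundary ℝ ⊆ square c r := hS.trans interior_subset
  have hr : 0 < r := hP.pos_of_boundary_subset hS'
  refine ⟨fun ε hε => ?_, fun T₀ hT₀ p₀ hp₀ => ?_⟩
  · obtain ⟨K, hK, hmesh⟩ := exists_mesh c hr hε
    exact ⟨K, ⟨hK.finite, hK.space⟩, hmesh⟩
  · obtain ⟨K, hK, hsub, C, hC, hcar, hv, hp, hd, hw⟩ := hP.exists_triangulation hS' hT₀ hp₀
    exact ⟨K, ⟨hK.finite, hK.space⟩, hsub, hK.isDiscretelySimplyConnected hr, C, hC, hcar, hv, hp,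
      hd, hw, fun p hp => hK.exists_contraction hr hC hp⟩
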